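/- **Setting.** There are $K$ arms $[K]=\{1,\dots,K\}$, a context space $\mathcal X$, a law $P_X$ on $\mathcal X$ and a conditional law $P_{Y|A,X}$ of real outcomes. In round $t=1,2,\dots$, given the history $H_{t-1}=(X_i,A_i,Y_i)_{i<t}$, a context $X_t\sim P_X$ is drawn, then an arm $A_t$ with $P(A_t=a\mid X_t=x,H_{t-1})=\pi_t(x,a)$, where the policy $\pi_t$ is determined by $H_{t-1}$, and then an outcome $Y_t\sim P_{Y|A_t,X_t}$. Let $g(x,a)$ and $v(x,a)$ be the conditional mean and variance of $Y$ given $X=x,A=a$, let $\mu(a)=E_{P_X}[g(X,a)]$, and let $\Delta(a)$ be the set of $w\in\mathbb R^K$ with $w(a)=-1$ whose other entries are nonnegative and sum to $1$. Assume that there is a unique arm $a^*$ maximizing $\mu$, that $v(x,a)>0$ for all $x,a$, and that $|Y_t|<B$ for all $t$ for some constant $B$. Let $g_t:\mathcal X\times[K]\to\mathbb R$ be regression functions determined by $H_{t-1}$. Assume that there are a deterministic policy $\pi_\infty$, a deterministic function $g_\infty$ and constants $\kappa, B'<\infty$ such that, almost surely, 1. $\|\pi_t(\cdot,a)-\pi_\infty(\cdot,a)\|_{L_2(P_X)}\to0$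 for all $a$, and $\pi_t(x,a)>0$, $1/\pi_t(x,a)\le\kappa$ for all $t,x,a$; 2. $\|g_t(\cdot,a)-g_\infty(\cdot,a)\|^2_{L_2(P_X)}\to0$ for all $a$, and $|g_t(x,a)|\le B'$ for all $t,x,a$. Assume moreover: 3. with $\phi_\infty(a)=g_\infty(X,a)+\mathbf 1[A=a]\,(Y-g_\infty(X,a))/\pi_\infty(X,a)$, the matrix with entries $E_{P_\infty}[(\phi_\infty(i)-\mu(i))(\phi_\infty(j)-\mu(j))]$ is invertible, where $P_\infty$ is the law of $(X,A,Y)$ with $X\sim P_X$, $A\sim\pi_\infty(X,\cdot)$, $Y\sim P_{Y|A,X}$. **Algorithm.** Let $\phi_t(a)=g_t(X_t,a)+\mathbf 1[A_t=a]\,(Y_t-g_t(X_t,a))/\pi_t(X_t,a)$ and $\hat\mu_t(a)=\frac1t\sum_{i\le t}\phi_i(a)$ (with $\hat\mu_0=0$), and for $w\in\mathbb R^K$ let $\hat\sigma_t^2(w)=\frac1t\sum_{i\le t}\big(\sum_b w(b)(\phi_i(b)-\hat\mu_i(b))\big)^2$. Fix $\rho>0$ and $w_0^a\in\Delta(a)$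 for every $a\in[K]$. The weights $w_t^a\in\Delta(a)$ are measurable functions of $H_{t-1}$. If $t\geq 2$, $\hat\mu_{t-1}(a)<\max_b\hat\mu_{t-1}(b)$ and $\frac1{t-1}\sum_{i<t}(\phi_i(b)-\hat\mu_i(b))^2>0$ for all $b$, then $w_t^a$ maximizes $\sum_b w(b)\hat\mu_{t-1}(b)/\hat\sigma_{t-1}(w)$ over $w\in\Delta(a)$ (if $\hat\sigma_{t-1}$ vanishes somewhere on $\Delta(a)$, any choice in $\Delta(a)$ is allowed); otherwise $w_t^a=w_0^a$. Put $$\hat\psi_t(a)=\frac1t\sum_{i\le t}\sum_b w_i^a(b)\phi_i(b),\qquad \hat\sigma_t^2(a)=\frac1t\sum_{i\le t}\Big(\sum_b w_i^a(b)(\phi_i(b)-\hat\mu_i(b))\Big)^2,$$ $$L_t^a(\alpha)=\hat\psi_t(a)-\sqrt{\frac{2\,(t\hat\sigma_t^2(a)\rho^2+1)}{t^2\rho^2}\,\log\Big(1+\frac{\sqrt{t\hat\sigma_t^2(a)\rho^2+1}}{2\alpha}\Big)} .$$ For a burn-in time $t_0$, let $C_t(t_0,\alpha)$ be the set of arms $a$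 with $L_i^a(\alpha)\le0$ for all $i\ge1$ with $t_0\le i\le t$, and let $\tau_{t_0}\in\{0,1,\dots,\infty\}$ be the first $t\geq 0$ at which $C_t(t_0,\alpha)$ has at most one element. **Theorem.** Let burn-in times $t_0(\alpha)\in\{0,1,2,\dots\}$ satisfy $t_0(\alpha)\to\infty$ and $t_0(\alpha)/\log(1/\alpha)\to0$ as $\alpha\to0^+$. Let $\sigma_\infty^2(w)=E_{P_\infty}\big[\big(\sum_b w(b)(\phi_\infty(b)-\mu(b))\big)^2\big]$. For every $a\ne a^*$ the limiting signal-to-noise ratio $\sum_b w(b)\mu(b)/\sigma_\infty(w)$ has a unique maximizer $w_\infty^a$ over $\Delta(a)$, and with $$\Gamma_1=\Big(\min_{a\ne a^*}\frac{\sum_b w_\infty^a(b)\mu(b)}{\sigma_\infty(w_\infty^a)}\Big)^{-2}$$ the following limits exist and satisfy $$\lim_{\alpha\to0^+}\frac{E[\tau_{t_0(\alpha)}]}{\log(1/\alpha)}\le2\Gamma_1,\qquad P\Big(\lim_{\alpha\to0^+}\frac{\tau_{t_0(\alpha)}}{\log(1/\alpha)}\ \text{exists and is}\ \le2\Gamma_1\Big)=1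 .$$ -/

import Mathlib

open MeasureTheory ProbabilityTheory Filter Topology
open scoped ENNReal

namespace BAI

/-! Contextual best arm identification with `K` arms (indexed by `Fin K`) and contexts in `𝒳`.
Rounds are indexed from `0`: index `n` stands for round `n + 1`. -/

/-- One observation: (context, arm, outcome). -/
abbrev Obs (𝒳 : Type*) (K : ℕ) := 𝒳 × Fin K × ℝ

/-- The history consisting of the first `n` observations of a trajectory. -/
def hist {𝒳 : Type*} {K : ℕ} (o : ℕ → Obs 𝒳 K) (n : ℕ) : Fin n → Obs 𝒳 K := fun i => o i

/-- The trajectory of observations produced by contexts `X`, arms `A`, outcomes `Y`. -/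
def traj {Ω 𝒳 : Type*} {K : ℕ} (X : ℕ → Ω → 𝒳) (A : ℕ → Ω → Fin K) (Y : ℕ → Ω → ℝ)
    (ω : Ω) : ℕ → Obs 𝒳 K := fun n => (X n ω, A n ω, Y n ω)

/-- The sequential data-generating process. In each round, given the history, the context has law
`PX`; given history and context, the arm has law `pol n`; given history, context and arm, the
outcome has law `Q (x, a)`, the fixed conditional law of `Y` given `X = x`, `A = a`. -/
structure IsBanditProcess {Ω 𝒳 : Type*} [MeasurableSpace Ω] [MeasurableSpace 𝒳] {K : ℕ}
    (P : Measure Ω) (PX : Measure 𝒳) (Q : Kernel (𝒳 × Fin K) ℝ)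
    (pol : ∀ n : ℕ, Kernel ((Fin n → Obs 𝒳 K) × 𝒳) (Fin K))
    (X : ℕ → Ω → 𝒳) (A : ℕ → Ω → Fin K) (Y : ℕ → Ω → ℝ) : Prop where
  measurable_context : ∀ n, Measurable (X n)
  measurable_arm : ∀ n, Measurable (A n)
  measurable_outcome : ∀ n, Measurable (Y n)
  law_context : ∀ n, HasCondDistrib (X n) (fun ω => hist (traj X A Y ω) n)
    (Kernel.const _ PX) P
  law_arm : ∀ n, HasCondDistrib (A n) (fun ω => (hist (traj X A Y ω) n, X n ω)) (pol n) P
  law_outcome : ∀ n, HasCondDistrib (Y n) (fun ω => ((hist (traj X A Y ω) n, X n ω), A n ω))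
    (Q.comap (fun p : ((Fin n → Obs 𝒳 K) × 𝒳) × Fin K => (p.1.2, p.2)) (by fun_prop)) P

section Instance

variable {𝒳 : Type*} [MeasurableSpace 𝒳] {K : ℕ}

/-- Conditional mean `g(x, a)` of the outcome. -/
noncomputable def condMean (Q : Kernel (𝒳 × Fin K) ℝ) (x : 𝒳) (a : Fin K) : ℝ :=
  ∫ y, y ∂(Q (x, a))

/-- Conditional variance `v(x, a)` of the outcome. -/
noncomputable def condVar (Q : Kernel (𝒳 × Fin K) ℝ) (x : 𝒳) (a : Fin K) : ℝ :=
  ∫ y, (y - condMean Q x a) ^ 2 ∂(Q (x, a))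

/-- Mean `μ(a)` of arm `a`. -/
noncomputable def armMean (PX : Measure 𝒳) (Q : Kernel (𝒳 × Fin K) ℝ) (a : Fin K) : ℝ :=
  ∫ x, condMean Q x a ∂PX

/-- The vectors with `a`-th entry `-1` whose other entries form a probability vector. -/
def Delta (a : Fin K) : Set (Fin K → ℝ) :=
  {w | w a = -1 ∧ (∀ b, b ≠ a → 0 ≤ w b) ∧ ∑ b ∈ Finset.univ.erase a, w b = 1}

/-- The law `P_∞` of (context, arm, outcome) when arms are drawn from the limiting policy. -/
noncomputable def limLaw (PX : Measure 𝒳) (Q : Kernel (𝒳 × Fin K) ℝ)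
    (polInf : Kernel 𝒳 (Fin K)) : Measure (Obs 𝒳 K) :=
  PX ⊗ₘ (polInf ⊗ₖ Q)

/-- The limiting score `φ_∞(a)`. -/
noncomputable def limScore (polInf : Kernel 𝒳 (Fin K)) (gInf : 𝒳 → Fin K → ℝ) (z : Obs 𝒳 K)
    (a : Fin K) : ℝ :=
  gInf z.1 a + (if z.2.1 = a then z.2.2 - gInf z.1 a else 0) / (polInf z.1).real {a}

/-- The limiting covariance matrix `Σ_∞`. -/
noncomputable def limCov (PX : Measure 𝒳) (Q : Kernel (𝒳 × Fin K) ℝ)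
    (polInf : Kernel 𝒳 (Fin K)) (gInf : 𝒳 → Fin K → ℝ) : Matrix (Fin K) (Fin K) ℝ :=
  Matrix.of fun i j => ∫ z, (limScore polInf gInf z i - armMean PX Q i) *
    (limScore polInf gInf z j - armMean PX Q j) ∂(limLaw PX Q polInf)

/-- The limiting variance `σ_∞²(w)`. -/
noncomputable def limVar (PX : Measure 𝒳) (Q : Kernel (𝒳 × Fin K) ℝ)
    (polInf : Kernel 𝒳 (Fin K)) (gInf : 𝒳 → Fin K → ℝ) (w : Fin K → ℝ) : ℝ :=
  ∫ z, (∑ b, w b * (limScore polInf gInf z b - armMean PX Q b)) ^ 2 ∂(limLaw PX Q polInf)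

/-- The limiting signal-to-noise ratio `∑ w(b) μ(b) / σ_∞(w)`. -/
noncomputable def limSNR (PX : Measure 𝒳) (Q : Kernel (𝒳 × Fin K) ℝ)
    (polInf : Kernel 𝒳 (Fin K)) (gInf : 𝒳 → Fin K → ℝ) (w : Fin K → ℝ) : ℝ :=
  (∑ b, w b * armMean PX Q b) / √(limVar PX Q polInf gInf w)

/-- `Γ₁`: the minimum over suboptimal arms of the limiting SNR of `wInf a`, to the power `-2`. -/
noncomputable def Gamma₁ (PX : Measure 𝒳) (Q : Kernel (𝒳 × Fin K) ℝ)
    (polInf : Kernel 𝒳 (Fin K)) (gInf : 𝒳 → Fin K → ℝ) (aStar : Fin K)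
    (wInf : Fin K → Fin K → ℝ) : ℝ :=
  (⨅ a : {a : Fin K // a ≠ aStar}, limSNR PX Q polInf gInf (wInf a)) ^ (-2 : ℤ)

/-- The score `φ(a)` in round `n + 1`, for a trajectory `o`. -/
noncomputable def score (pol : ∀ n : ℕ, Kernel ((Fin n → Obs 𝒳 K) × 𝒳) (Fin K))
    (reg : ∀ n : ℕ, (Fin n → Obs 𝒳 K) → 𝒳 → Fin K → ℝ) (o : ℕ → Obs 𝒳 K) (n : ℕ)
    (a : Fin K) : ℝ :=
  reg n (hist o n) (o n).1 a +
    (if (o n).2.1 = a then (o n).2.2 - reg n (hist o n) (o n).1 a else 0) /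
      (pol n (hist o n, (o n).1)).real {a}

end Instance

section Statistics

variable {K : ℕ}

/-! Statistics of a realized sequence of scores `φ n b` (round `n + 1`, arm `b`) and of a realized
sequence of weights `w n` (used in round `n + 1`), after `t` rounds. -/

/-- Running mean `μ̂_t(b)`. It is `0` for `t = 0`. -/
noncomputable def runMean (φ : ℕ → Fin K → ℝ) (t : ℕ) (b : Fin K) : ℝ :=
  (∑ i ∈ Finset.range t, φ i b) / t

/-- Running variance of the scores of arm `b` over `t` rounds, each score centred at the running
mean that includes it. -/
noncomputable def armVar (φ : ℕ → Fin K → ℝ) (t : ℕ) (b : Fin K) : ℝ :=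
  (∑ i ∈ Finset.range t, (φ i b - runMean φ (i + 1) b) ^ 2) / t

/-- `σ̂_t²(w)` for a fixed vector `w`. -/
noncomputable def fixedVar (φ : ℕ → Fin K → ℝ) (t : ℕ) (w : Fin K → ℝ) : ℝ :=
  (∑ i ∈ Finset.range t, (∑ b, w b * (φ i b - runMean φ (i + 1) b)) ^ 2) / t

/-- The empirical signal-to-noise ratio of a fixed vector `w` after `t` rounds. -/
noncomputable def empSNR (φ : ℕ → Fin K → ℝ) (t : ℕ) (w : Fin K → ℝ) : ℝ :=
  (∑ b, w b * runMean φ t b) / √(fixedVar φ t w)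

/-- The test process `ψ̂_t` with weights `w`. -/
noncomputable def testProcess (φ : ℕ → Fin K → ℝ) (w : ℕ → Fin K → ℝ) (t : ℕ) : ℝ :=
  (∑ i ∈ Finset.range t, ∑ b, w i b * φ i b) / t

/-- The variance estimate `σ̂_t²` of the test process with weights `w`. -/
noncomputable def testVar (φ : ℕ → Fin K → ℝ) (w : ℕ → Fin K → ℝ) (t : ℕ) : ℝ :=
  (∑ i ∈ Finset.range t, (∑ b, w i b * (φ i b - runMean φ (i + 1) b)) ^ 2) / t

/-- The anytime-valid boundary `ℓ_{t,α,ρ}(x)`, meaningful for `t ≥ 1` and `x > 0`. -/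
noncomputable def ell (t : ℕ) (α ρ x : ℝ) : ℝ :=
  (√t)⁻¹ * √(2 * (ρ ^ 2 + 1 / (t * x ^ 2)) / ρ ^ 2 *
    Real.log (1 + √(t * x ^ 2 * ρ ^ 2 + 1) / (2 * α)))

/-- The margin `x * ℓ_{t,α,ρ}(x)`, in the form that extends it continuously to `x = 0`. -/
noncomputable def margin (t : ℕ) (α ρ x : ℝ) : ℝ :=
  √(2 * (t * x ^ 2 * ρ ^ 2 + 1) / (t ^ 2 * ρ ^ 2) *
    Real.log (1 + √(t * x ^ 2 * ρ ^ 2 + 1) / (2 * α)))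

theorem margin_eq_mul_ell {t : ℕ} (ht : 1 ≤ t) {α ρ x : ℝ} (hρ : 0 < ρ) (hx : 0 < x) :
    margin t α ρ x = x * ell t α ρ x := by
  have ht' : (0 : ℝ) < t := by exact_mod_cast ht
  have h1 : x * (√(t : ℝ))⁻¹ = √(x ^ 2 / t) := by
    rw [Real.sqrt_div (sq_nonneg x), Real.sqrt_sq hx.le, div_eq_mul_inv]
  unfold margin ell
  rw [← mul_assoc, h1, ← Real.sqrt_mul (by positivity)]
  congr 1
  rw [← mul_assoc]
  congr 1
  field_simp

/-- The lower confidence bound `L_t`: test process minus margin. -/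
noncomputable def lowerBound (φ : ℕ → Fin K → ℝ) (w : ℕ → Fin K → ℝ) (α ρ : ℝ) (t : ℕ) : ℝ :=
  testProcess φ w t - margin t α ρ √(testVar φ w t)

/-- The confidence set `C_t`: the arms whose lower bound has never been positive at a round
`i ≥ 1` with `t₀ ≤ i ≤ t`. Here `w n a` is the weight vector of arm `a` in round `n + 1`. -/
def confSet (φ : ℕ → Fin K → ℝ) (w : ℕ → Fin K → Fin K → ℝ) (α ρ : ℝ) (t₀ t : ℕ) :
    Set (Fin K) :=
  {a | ∀ i, 1 ≤ i → t₀ ≤ i → i ≤ t → lowerBound φ (fun n => w n a) α ρ i ≤ 0}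

/-- The number of samples taken by the algorithm before `C_t` has at most one element
(`⊤` if that never happens). -/
noncomputable def stopTime (φ : ℕ → Fin K → ℝ) (w : ℕ → Fin K → Fin K → ℝ) (α ρ : ℝ)
    (t₀ : ℕ) : ℕ∞ :=
  ⨅ (t : ℕ) (_ : (confSet φ w α ρ t₀ t).ncard ≤ 1), (t : ℕ∞)

/-- The SNR-maximizing weight rule. All weight vectors lie in `Delta a`. In round `n + 1`, using the
statistics of the first `n` rounds: if arm `a` is not an empirical maximizer and all empirical arm
variances are positive, then `w n a` maximizes the empirical SNR over `Delta a`; otherwise it is the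
default `w₀ a`. When some `v ∈ Delta a` has zero empirical variance, so that the SNR is not defined
on all of `Delta a`, any choice in `Delta a` is allowed in the first case. -/
def IsSNRWeights (φ : ℕ → Fin K → ℝ) (w₀ : Fin K → Fin K → ℝ)
    (w : ℕ → Fin K → Fin K → ℝ) : Prop :=
  ∀ (n : ℕ) (a : Fin K), w n a ∈ Delta a ∧
    (((∃ b, runMean φ n a < runMean φ n b) ∧ ∀ b, 0 < armVar φ n b) →
      (∀ v ∈ Delta a, 0 < fixedVar φ n v) → IsMaxOn (empSNR φ n) (Delta a) (w n a)) ∧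
    (¬((∃ b, runMean φ n a < runMean φ n b) ∧ ∀ b, 0 < armVar φ n b) → w n a = w₀ a)

end Statistics

end BAI

/-! Given the history, one round has the law `limLaw` of a frozen policy, and inverse-probability
weighting makes every score conditionally unbiased whatever regression function is used
(`IsRegular.integral_limScore`). Scores, products of centred scores and weighted scores are
therefore conditional means plus bounded martingale differences. Their conditional covariances
converge, because $L^2$ convergence of policies and regressions gives almost everywhere convergence
along subsequences and the scores are bounded (`tendsto_limCov`).

Outcome noise alone keeps the covariances nondegenerate: `IsRegular.le_limVar` bounds every variance
below by $w(b)^2E[v(X,b)]$. This gives positive definiteness in the limit, and the same bound in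
every round. Strict convexity of the square root of the quadratic form then gives uniqueness of the
SNR maximizer (`existsUnique_isMaxOn_snr`), and compactness of `Delta a` gives convergence of the
empirical maximizers to it (`tendsto_of_isMaxOn_snr`).

On almost every path the test process of a suboptimal arm has limits $\psi>0$ and $S>0$ for its mean
and variance. The margin behaves like $\sqrt{2S\log(1/\alpha)/t}$, so the arm is rejected near
$t=(2S/\psi^2)\log(1/\alpha)$. The optimal arm has negative drift and is not rejected after a fixed
time. Burn-in hides the initial fluctuations but is negligible against $\log(1/\alpha)$. The slowest
suboptimal arm decides, so the normalized stopping time converges to exactly $2\Gamma_1$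
(`tendsto_stopTime`).

For expectations the convergence must be dominated. Azuma's inequality gives an integrable random
time $T$ after which all averages are close to their conditional means (`exists_time_abs_sum_le`). A
deterministic argument on paths then bounds the stopping time by $t_0+M\log(1/\alpha)+MT$
(`exists_stopTime_le`), with $M$ crude but independent of $\alpha$. Dominated convergence finishes
the proof. -/

namespace BAI

set_option linter.unusedSectionVars false

/-! ### One round under a fixed policy: unbiasedness, variance lower bound, covariance -/

section OneRound

variable {𝒳 : Type*} [MeasurableSpace 𝒳] {K : ℕ}

/-- Boundedness of a policy `p` away from zero, of a regression function `g`, and of outcomes. -/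
structure IsRegular (PX : Measure 𝒳) (Q : Kernel (𝒳 × Fin K) ℝ) (κ Bg B : ℝ)
    (p : Kernel 𝒳 (Fin K)) (g : 𝒳 → Fin K → ℝ) : Prop where
  measurable_reg : ∀ a, Measurable fun x => g x a
  pol : ∀ᵐ x ∂PX, ∀ a, 0 < (p x).real {a} ∧ 1 / (p x).real {a} ≤ κ
  reg : ∀ᵐ x ∂PX, ∀ a, |g x a| ≤ Bg
  outcome : ∀ᵐ x ∂PX, ∀ a, ∀ᵐ y ∂Q (x, a), |y| ≤ B

/-- The uniform bound on scores. -/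
def scoreBound (κ Bg B : ℝ) : ℝ := Bg + κ * (B + Bg)

theorem abs_score_le {κ Bg B q g y : ℝ} {c : Prop} [Decidable c] (hq : 0 < q) (hκ : 1 / q ≤ κ)
    (hg : |g| ≤ Bg) (hy : |y| ≤ B) :
    |g + (if c then y - g else 0) / q| ≤ scoreBound κ Bg B := by
  have h0 : 0 ≤ 1 / q := by positivity
  have h1 : |(if c then y - g else 0)| ≤ B + Bg := by
    split_ifs
    · exact (abs_sub y g).trans (add_le_add hy hg)
    · simpa using add_nonneg ((abs_nonneg _).trans hy) ((abs_nonneg _).trans hg)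
  have h2 : |(if c then y - g else 0) / q| ≤ κ * (B + Bg) := by
    rw [div_eq_mul_one_div, abs_mul, abs_of_nonneg h0, mul_comm]
    exact mul_le_mul hκ h1 (abs_nonneg _) (h0.trans hκ)
  exact (abs_add_le _ _).trans (add_le_add hg h2)

theorem measurable_real_singleton (p : Kernel 𝒳 (Fin K)) [IsMarkovKernel p] (a : Fin K) :
    Measurable fun x => (p x).real {a} :=
  (p.measurable_coe (measurableSet_singleton a)).ennreal_toReal

theorem measurable_limScore (p : Kernel 𝒳 (Fin K)) [IsMarkovKernel p] {g : 𝒳 → Fin K → ℝ}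
    (hg : ∀ a, Measurable fun x => g x a) (a : Fin K) :
    Measurable fun z : Obs 𝒳 K => limScore p g z a := by
  have h1 : Measurable fun z : Obs 𝒳 K => g z.1 a := (hg a).comp measurable_fst
  have h2 : Measurable fun z : Obs 𝒳 K => (p z.1).real {a} :=
    (measurable_real_singleton p a).comp measurable_fst
  have h3 : MeasurableSet {z : Obs 𝒳 K | z.2.1 = a} :=
    measurable_snd.fst (measurableSet_singleton a)
  unfold limScore
  exact h1.add ((Measurable.ite h3 (measurable_snd.snd.sub h1) measurable_const).div h2)

variable {PX : Measure 𝒳} [IsProbabilityMeasure PX] {Q : Kernel (𝒳 × Fin K) ℝ} [IsMarkovKernel Q]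

theorem ae_limLaw {p : Kernel 𝒳 (Fin K)} [IsMarkovKernel p] {S : Obs 𝒳 K → Prop}
    (hS : MeasurableSet {z | S z}) (h : ∀ᵐ x ∂PX, ∀ a, ∀ᵐ y ∂Q (x, a), S (x, a, y)) :
    ∀ᵐ z ∂limLaw PX Q p, S z := by
  refine Measure.ae_compProd_of_ae_ae hS ?_
  filter_upwards [h] with x hx
  refine Kernel.ae_compProd_of_ae_ae (p := fun b => S (x, b)) (measurable_prodMk_left hS) ?_
  exact Eventually.of_forall hx

theorem integral_limLaw {p : Kernel 𝒳 (Fin K)} [IsMarkovKernel p] {F : Obs 𝒳 K → ℝ}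
    (hF : Integrable F (limLaw PX Q p)) :
    ∫ z, F z ∂limLaw PX Q p =
      ∫ x, ∑ a, (p x).real {a} * ∫ y, F (x, a, y) ∂Q (x, a) ∂PX := by
  unfold limLaw at hF ⊢
  rw [Measure.integral_compProd hF]
  refine integral_congr_ae ?_
  have h := ((Measure.integrable_compProd_iff hF.1).1 hF).1
  filter_upwards [h] with x hx
  rw [ProbabilityTheory.integral_compProd hx, integral_fintype]
  · simp
  · exact Integrable.of_finite

instance (p : Kernel 𝒳 (Fin K)) [IsMarkovKernel p] : IsProbabilityMeasure (limLaw PX Q p) := by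
  unfold limLaw; infer_instance

variable {κ Bg B : ℝ} {p : Kernel 𝒳 (Fin K)} [IsMarkovKernel p] {g : 𝒳 → Fin K → ℝ}

theorem IsRegular.abs_limScore_le (h : IsRegular PX Q κ Bg B p g) :
    ∀ᵐ z ∂limLaw PX Q p, ∀ a, |limScore p g z a| ≤ scoreBound κ Bg B := by
  rw [ae_all_iff]
  intro b
  refine ae_limLaw (measurableSet_le (measurable_limScore p h.measurable_reg b).abs
    measurable_const) ?_
  filter_upwards [h.pol, h.reg, h.outcome] with x h1 h2 h3 a
  filter_upwards [h3 a] with y hy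
  exact abs_score_le (h1 b).1 (h1 b).2 (h2 b) hy

theorem IsRegular.integrable_outcome (h : IsRegular PX Q κ Bg B p g) :
    ∀ᵐ x ∂PX, ∀ a, Integrable (fun y => y) (Q (x, a)) := by
  filter_upwards [h.outcome] with x hx a
  exact Integrable.of_bound (by fun_prop) B (hx a)

theorem abs_condMean_le {x : 𝒳} {a : Fin K} (h : ∀ᵐ y ∂Q (x, a), |y| ≤ B) :
    |condMean Q x a| ≤ B := by
  have := norm_integral_le_of_norm_le_const (μ := Q (x, a)) (f := fun y => y) (C := B) h
  simpa [condMean] using this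

/-- Bias–variance decomposition: the second moment equals `v ^ 2 * condVar Q x a` plus the square of
the mean `u + v * condMean Q x a`, which is discarded. -/
theorem integral_affine_sq {x : 𝒳} {a : Fin K} (h : ∀ᵐ y ∂Q (x, a), |y| ≤ B) (u v : ℝ) :
    v ^ 2 * condVar Q x a ≤ ∫ y, (u + v * y) ^ 2 ∂Q (x, a) := by
  have hi : Integrable (fun y => y) (Q (x, a)) := Integrable.of_bound (by fun_prop) B h
  have hi2 : Integrable (fun y => (y - condMean Q x a) ^ 2) (Q (x, a)) := by
    refine Integrable.of_bound (by fun_prop) ((B + B) ^ 2) ?_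
    filter_upwards [h] with y hy
    rw [Real.norm_eq_abs, abs_pow]
    exact pow_le_pow_left₀ (abs_nonneg _)
      ((abs_sub _ _).trans (add_le_add hy (abs_condMean_le h))) 2
  have e : ∀ y, (u + v * y) ^ 2 = v ^ 2 * (y - condMean Q x a) ^ 2 +
      (2 * v * (u + v * condMean Q x a) * (y - condMean Q x a) +
        (u + v * condMean Q x a) ^ 2) := fun y => by ring
  rw [integral_congr_ae (Eventually.of_forall e)]
  have hi3 : Integrable (fun y => y - condMean Q x a) (Q (x, a)) :=
    hi.sub (integrable_const _)
  have hi4 : Integrable (fun y => 2 * v * (u + v * condMean Q x a) * (y - condMean Q x a) +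
      (u + v * condMean Q x a) ^ 2) (Q (x, a)) := (hi3.const_mul _).add (integrable_const _)
  rw [integral_add (hi2.const_mul _) hi4, integral_add (hi3.const_mul _) (integrable_const _), integral_const_mul, integral_const_mul,
    integral_sub hi (integrable_const _)]
  have : ∫ y, y ∂Q (x, a) = condMean Q x a := rfl
  simp only [integral_const, probReal_univ, one_smul, this, sub_self, mul_zero, zero_add]
  unfold condVar
  nlinarith [sq_nonneg (u + v * condMean Q x a)]

theorem measurable_condVar (Q : Kernel (𝒳 × Fin K) ℝ) [IsMarkovKernel Q] (a : Fin K) :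
    Measurable fun x => condVar Q x a := by
  have h0 : StronglyMeasurable fun q : 𝒳 × Fin K => ∫ y, y ∂Q q :=
    StronglyMeasurable.integral_kernel_prod_right' (κ := Q)
      (f := fun r : (𝒳 × Fin K) × ℝ => r.2) measurable_snd.stronglyMeasurable
  have h : StronglyMeasurable fun q : 𝒳 × Fin K => ∫ y, (y - ∫ y, y ∂Q q) ^ 2 ∂Q q :=
    StronglyMeasurable.integral_kernel_prod_right' (κ := Q)
      (f := fun r : (𝒳 × Fin K) × ℝ => (r.2 - ∫ y, y ∂Q r.1) ^ 2)
      ((measurable_snd.sub (h0.measurable.comp measurable_fst)).pow_const 2).stronglyMeasurable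
  exact h.measurable.comp (measurable_id.prodMk measurable_const)

theorem condVar_nonneg (x : 𝒳) (a : Fin K) : 0 ≤ condVar Q x a :=
  integral_nonneg fun _ => sq_nonneg _

theorem integrable_condVar (hQ : ∀ᵐ x ∂PX, ∀ a, ∀ᵐ y ∂Q (x, a), |y| ≤ B) (a : Fin K) :
    Integrable (fun x => condVar Q x a) PX := by
  refine Integrable.of_bound (measurable_condVar Q a).aestronglyMeasurable ((B + B) ^ 2) ?_
  filter_upwards [hQ] with x hx
  have := norm_integral_le_of_norm_le_const (μ := Q (x, a))
    (f := fun y => (y - condMean Q x a) ^ 2) (C := (B + B) ^ 2) (by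
    filter_upwards [hx a] with y hy
    rw [Real.norm_eq_abs, abs_pow]
    exact pow_le_pow_left₀ (abs_nonneg _)
      ((abs_sub _ _).trans (add_le_add hy (abs_condMean_le (hx a)))) 2)
  simpa [condVar] using this

theorem integral_condVar_pos (hQ : ∀ᵐ x ∂PX, ∀ a, ∀ᵐ y ∂Q (x, a), |y| ≤ B)
    (hvar : ∀ x a, 0 < condVar Q x a) (a : Fin K) : 0 < ∫ x, condVar Q x a ∂PX := by
  rw [integral_pos_iff_support_of_nonneg (fun x => (hvar x a).le) (integrable_condVar hQ a)]
  have : Function.support (fun x => condVar Q x a) = Set.univ :=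
    Set.eq_univ_of_forall fun x => (hvar x a).ne'
  simp [this]

theorem IsRegular.integrable_limScore (h : IsRegular PX Q κ Bg B p g) (b : Fin K) :
    Integrable (fun z => limScore p g z b) (limLaw PX Q p) := by
  refine Integrable.of_bound (measurable_limScore p h.measurable_reg b).aestronglyMeasurable
    (scoreBound κ Bg B) ?_
  filter_upwards [h.abs_limScore_le] with z hz using hz b

/-- The correction term is nonzero only when arm `b` is drawn, and the probability of that event
cancels the division by the propensity. What remains is the mean of $Y-g$, which turns `g x b` into
`condMean Q x b`, so an incorrect regression function causes no bias. -/
theorem IsRegular.integral_limScore (h : IsRegular PX Q κ Bg B p g) (b : Fin K) :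
    ∫ z, limScore p g z b ∂limLaw PX Q p = armMean PX Q b := by
  rw [integral_limLaw (h.integrable_limScore b)]
  refine integral_congr_ae ?_
  filter_upwards [h.pol, h.integrable_outcome] with x h1 h2
  have hsum : ∑ a, (p x).real {a} = 1 := by
    simp
  have e : ∀ a, ∫ y, limScore p g (x, a, y) b ∂Q (x, a) =
      g x b + (if a = b then condMean Q x b - g x b else 0) / (p x).real {b} := by
    intro a
    unfold limScore
    by_cases hab : a = b
    · subst hab
      simp only [if_true]
      have hi : Integrable (fun y => y - g x a) (Q (x, a)) := (h2 a).sub (integrable_const _)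
      rw [integral_add (integrable_const _) (hi.div_const _), integral_div, integral_sub (h2 a) (integrable_const _)]
      simp [condMean]
    · simp [hab]
  simp_rw [e, mul_add, Finset.sum_add_distrib, ← Finset.sum_mul, hsum]
  rw [Finset.sum_eq_single b]
  · have := (h1 b).1.ne'
    simp only [if_true]
    field_simp
    ring
  · intro a _ hab
    simp [hab]
  · simp

/-- Keep only the event that arm `b` is drawn. There the linear statistic is affine in the outcome
with slope `w b / p(b)`, so its second moment is at least `(w b / p(b)) ^ 2` times the outcome
variance. Multiplying by the probability `p(b) ≤ 1` of the event leaves one division by `p(b)`,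
which only helps. The bound does not depend on the policy or the regression, so it serves all rounds
at once. -/
theorem IsRegular.le_limVar (h : IsRegular PX Q κ Bg B p g) (w : Fin K → ℝ) (b : Fin K) :
    w b ^ 2 * ∫ x, condVar Q x b ∂PX ≤ limVar PX Q p g w := by
  have hm : Measurable fun z : Obs 𝒳 K =>
      (∑ c, w c * (limScore p g z c - armMean PX Q c)) ^ 2 :=
    (Finset.measurable_sum _ fun c _ =>
      ((measurable_limScore p h.measurable_reg c).sub_const _).const_mul _).pow_const 2
  have hi : Integrable (fun z : Obs 𝒳 K =>
      (∑ c, w c * (limScore p g z c - armMean PX Q c)) ^ 2) (limLaw PX Q p) := by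
    refine Integrable.of_bound hm.aestronglyMeasurable
      ((∑ c, |w c| * (scoreBound κ Bg B + |armMean PX Q c|)) ^ 2) ?_
    filter_upwards [h.abs_limScore_le] with z hz
    rw [Real.norm_eq_abs, abs_pow]
    refine pow_le_pow_left₀ (abs_nonneg _) ((Finset.abs_sum_le_sum_abs _ _).trans
      (Finset.sum_le_sum fun c _ => ?_)) 2
    rw [abs_mul]
    exact mul_le_mul_of_nonneg_left ((abs_sub _ _).trans (add_le_add (hz c) le_rfl))
      (abs_nonneg _)
  have h2 : limVar PX Q p g w = _ := integral_limLaw hi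
  have hi2 : Integrable (fun x => ∑ a, (p x).real {a} * ∫ y,
      (∑ c, w c * (limScore p g (x, a, y) c - armMean PX Q c)) ^ 2 ∂Q (x, a)) PX := by
    have h3 := (Measure.integrable_compProd_iff hi.1).1 hi
    have h4 : Integrable (fun x => ∫ b, (∑ c, w c * (limScore p g (x, b) c -
        armMean PX Q c)) ^ 2 ∂(p ⊗ₖ Q) x) PX :=
      Integrable.integral_compProd (κ := Kernel.const Unit PX)
        (η := Kernel.prodMkLeft Unit (p ⊗ₖ Q)) (a := ()) hi
    refine h4.congr ?_
    filter_upwards [h3.1] with x hx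
    rw [ProbabilityTheory.integral_compProd hx, integral_fintype]
    · simp
    · exact Integrable.of_finite
  rw [h2, ← integral_const_mul]
  refine integral_mono_ae ((integrable_condVar h.outcome b).const_mul _) hi2 ?_
  filter_upwards [h.pol, h.outcome] with x h1 h3
  have hp1 : (p x).real {b} ≤ 1 := measureReal_le_one
  have hp0 := (h1 b).1
  have hle := Finset.single_le_sum (f := fun a => (p x).real {a} * ∫ y,
      (∑ c, w c * (limScore p g (x, a, y) c - armMean PX Q c)) ^ 2 ∂Q (x, a))
      (fun a _ => mul_nonneg measureReal_nonneg (integral_nonneg fun _ => sq_nonneg _))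
      (Finset.mem_univ b)
  refine le_trans ?_ hle
  have e : ∀ y, (∑ c, w c * (limScore p g (x, b, y) c - armMean PX Q c)) ^ 2 =
      ((∑ c, w c * (g x c - armMean PX Q c) - w b * g x b / (p x).real {b}) +
        (w b / (p x).real {b}) * y) ^ 2 := by
    intro y
    congr 1
    have : ∀ c, w c * (limScore p g (x, b, y) c - armMean PX Q c) =
        w c * (g x c - armMean PX Q c) +
          (if b = c then w b * (y - g x b) / (p x).real {b} else 0) := by
      intro c
      unfold limScore
      by_cases hc : b = c
      · subst hc; simp only [if_true]; ring
      · simp [hc]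
    rw [Finset.sum_congr rfl fun c _ => this c, Finset.sum_add_distrib, Finset.sum_ite_eq]
    simp only [Finset.mem_univ, if_true]
    ring
  simp only [e]
  refine le_trans ?_ (mul_le_mul_of_nonneg_left (integral_affine_sq (h3 b) _ _) hp0.le)
  have e2 : (p x).real {b} * ((w b / (p x).real {b}) ^ 2 * condVar Q x b) =
      (w b ^ 2 * condVar Q x b) / (p x).real {b} := by
    field_simp
  rw [e2, le_div_iff₀ hp0]
  exact mul_le_of_le_one_right (mul_nonneg (sq_nonneg _) (condVar_nonneg x b)) hp1

/-- The integrand of the covariance matrix. -/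
noncomputable def covScore (PX : Measure 𝒳) (Q : Kernel (𝒳 × Fin K) ℝ) (p : Kernel 𝒳 (Fin K))
    (g : 𝒳 → Fin K → ℝ) (b c : Fin K) (z : Obs 𝒳 K) : ℝ :=
  (limScore p g z b - armMean PX Q b) * (limScore p g z c - armMean PX Q c)

theorem measurable_covScore (hg : ∀ a, Measurable fun x => g x a) (b c : Fin K) :
    Measurable (covScore PX Q p g b c) :=
  ((measurable_limScore p hg b).sub_const _).mul ((measurable_limScore p hg c).sub_const _)

theorem IsRegular.abs_armMean_le (h : IsRegular PX Q κ Bg B p g) (b : Fin K) :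
    |armMean PX Q b| ≤ scoreBound κ Bg B := by
  rw [← h.integral_limScore b]
  have := norm_integral_le_of_norm_le_const (μ := limLaw PX Q p)
    (f := fun z => limScore p g z b) (C := scoreBound κ Bg B)
    (h.abs_limScore_le.mono fun z hz => hz b)
  simpa using this

theorem abs_mul_sub_le {r u v m n : ℝ} (hu : |u| ≤ r) (hm : |m| ≤ r) (hv : |v| ≤ r)
    (hn : |n| ≤ r) : |(u - m) * (v - n)| ≤ (2 * r) ^ 2 := by
  rw [abs_mul, sq, two_mul]
  have h0 : 0 ≤ r := (abs_nonneg _).trans hu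
  exact mul_le_mul ((abs_sub _ _).trans (add_le_add hu hm))
    ((abs_sub _ _).trans (add_le_add hv hn)) (abs_nonneg _) (by linarith)

theorem IsRegular.abs_covScore_le (h : IsRegular PX Q κ Bg B p g) :
    ∀ᵐ z ∂limLaw PX Q p, ∀ b c, |covScore PX Q p g b c z| ≤ (2 * scoreBound κ Bg B) ^ 2 := by
  filter_upwards [h.abs_limScore_le] with z hz b c
  exact abs_mul_sub_le (hz b) (h.abs_armMean_le b) (hz c) (h.abs_armMean_le c)

theorem IsRegular.integrable_covScore (h : IsRegular PX Q κ Bg B p g) (b c : Fin K) :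
    Integrable (covScore PX Q p g b c) (limLaw PX Q p) := by
  refine Integrable.of_bound (measurable_covScore h.measurable_reg b c).aestronglyMeasurable
    ((2 * scoreBound κ Bg B) ^ 2) ?_
  filter_upwards [h.abs_covScore_le] with z hz using hz b c

theorem IsRegular.limVar_eq (h : IsRegular PX Q κ Bg B p g) (w : Fin K → ℝ) :
    limVar PX Q p g w = ∑ b, ∑ c, w b * w c * limCov PX Q p g b c := by
  have e : ∀ z, (∑ b, w b * (limScore p g z b - armMean PX Q b)) ^ 2 =
      ∑ b, ∑ c, w b * w c * covScore PX Q p g b c z := by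
    intro z
    rw [sq, Finset.sum_mul_sum]
    refine Finset.sum_congr rfl fun b _ => Finset.sum_congr rfl fun c _ => ?_
    unfold covScore
    ring
  unfold limVar
  simp only [e]
  rw [integral_finsetSum _ fun b _ => integrable_finsetSum _ fun c _ =>
    (h.integrable_covScore b c).const_mul _]
  refine Finset.sum_congr rfl fun b _ => ?_
  rw [integral_finsetSum _ fun c _ => (h.integrable_covScore b c).const_mul _]
  refine Finset.sum_congr rfl fun c _ => ?_
  rw [integral_const_mul]
  rfl

/-- Continuity of the limiting covariance under pointwise convergence of policy and regression. -/
theorem tendsto_limCov_of_ae {p' : ℕ → Kernel 𝒳 (Fin K)} [∀ n, IsMarkovKernel (p' n)]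
    {g' : ℕ → 𝒳 → Fin K → ℝ} (h' : ∀ n, IsRegular PX Q κ Bg B (p' n) (g' n))
    (h : IsRegular PX Q κ Bg B p g)
    (hp : ∀ᵐ x ∂PX, ∀ a, Tendsto (fun n => (p' n x).real {a}) atTop (𝓝 ((p x).real {a})))
    (hg : ∀ᵐ x ∂PX, ∀ a, Tendsto (fun n => g' n x a) atTop (𝓝 (g x a))) (b c : Fin K) :
    Tendsto (fun n => limCov PX Q (p' n) (g' n) b c) atTop (𝓝 (limCov PX Q p g b c)) := by
  have e : ∀ n, limCov PX Q (p' n) (g' n) b c = _ := fun n =>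
    integral_limLaw ((h' n).integrable_covScore b c)
  have e' : limCov PX Q p g b c = _ := integral_limLaw (h.integrable_covScore b c)
  rw [e']
  simp only [e]
  set R := (2 * scoreBound κ Bg B) ^ 2
  have hR : 0 ≤ R := sq_nonneg _
  have hb : ∀ (p₁ : Kernel 𝒳 (Fin K)) [IsMarkovKernel p₁] (g₁ : 𝒳 → Fin K → ℝ),
      IsRegular PX Q κ Bg B p₁ g₁ →
      ∀ᵐ x ∂PX, ∀ a, ∀ᵐ y ∂Q (x, a), |covScore PX Q p₁ g₁ b c (x, a, y)| ≤ R := by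
    intro p₁ _ g₁ hr
    filter_upwards [hr.pol, hr.reg, hr.outcome] with x h1 h2 h3 a
    filter_upwards [h3 a] with y hy
    exact abs_mul_sub_le (abs_score_le (h1 b).1 (h1 b).2 (h2 b) hy) (hr.abs_armMean_le b)
      (abs_score_le (h1 c).1 (h1 c).2 (h2 c) hy) (hr.abs_armMean_le c)
  have hb' := ae_all_iff.2 fun n => hb (p' n) (g' n) (h' n)
  have hmy : ∀ (p₁ : Kernel 𝒳 (Fin K)) [IsMarkovKernel p₁] (g₁ : 𝒳 → Fin K → ℝ),
      IsRegular PX Q κ Bg B p₁ g₁ → ∀ x a,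
      Measurable fun y => covScore PX Q p₁ g₁ b c (x, a, y) := by
    intro p₁ _ g₁ hr x a
    exact (measurable_covScore hr.measurable_reg b c).comp
      (measurable_const.prodMk (measurable_const.prodMk measurable_id))
  -- Dominated convergence is used twice: over contexts here, and over outcomes for a fixed context
  -- and arm below. Division by the propensity passes to the limit because the limiting propensity
  -- is positive.
  refine tendsto_integral_of_dominated_convergence (fun _ => ∑ _a : Fin K, 1 * R) ?_
    (integrable_const _) ?_ ?_
  · intro n
    refine (Finset.measurable_sum _ fun a _ => (measurable_real_singleton (p' n) a).mul ?_)
      |>.aestronglyMeasurable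
    have hs : StronglyMeasurable fun q : 𝒳 × Fin K =>
        ∫ y, covScore PX Q (p' n) (g' n) b c (q.1, q.2, y) ∂Q q :=
      StronglyMeasurable.integral_kernel_prod_right' (κ := Q)
        (f := fun r : (𝒳 × Fin K) × ℝ => covScore PX Q (p' n) (g' n) b c (r.1.1, r.1.2, r.2))
        ((measurable_covScore (h' n).measurable_reg b c).comp (by fun_prop)).stronglyMeasurable
    exact hs.measurable.comp (measurable_id.prodMk measurable_const)
  · intro n
    filter_upwards [hb (p' n) (g' n) (h' n)] with x hx
    refine (norm_sum_le _ _).trans (Finset.sum_le_sum fun a _ => ?_)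
    rw [norm_mul]
    refine mul_le_mul ?_ ?_ (norm_nonneg _) zero_le_one
    · rw [Real.norm_eq_abs, abs_of_nonneg measureReal_nonneg]
      exact measureReal_le_one
    · have := norm_integral_le_of_norm_le_const (μ := Q (x, a))
        (f := fun y => covScore PX Q (p' n) (g' n) b c (x, a, y)) (C := R) (hx a)
      rw [probReal_univ, mul_one] at this
      exact this
  · filter_upwards [hb', hp, hg, h.pol] with x h1 h2 h3 h4
    refine tendsto_finsetSum _ fun a _ => (h2 a).mul ?_
    refine tendsto_integral_of_dominated_convergence (fun _ => R)
      (fun n => (hmy _ _ (h' n) x a).aestronglyMeasurable) (integrable_const _)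
      (fun n => h1 n a) (Eventually.of_forall fun y => ?_)
    have hs : ∀ d, Tendsto (fun n => limScore (p' n) (g' n) (x, a, y) d) atTop
        (𝓝 (limScore p g (x, a, y) d)) := by
      intro d
      unfold limScore
      refine (h3 d).add (Tendsto.div ?_ (h2 d) (h4 d).1.ne')
      dsimp only
      split_ifs
      · exact (h3 d).const_sub y
      · exact tendsto_const_nhds
    exact ((hs b).sub_const _).mul ((hs c).sub_const _)

end OneRound

/-! ### From $L^2$ convergence of policies and regressions to convergence of covariances -/

section Continuity

/-- A finite family of sequences that converge in `L²` converges almost everywhere along a common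
subsequence. -/
theorem exists_subseq_ae_tendsto {𝒳 ι : Type*} [MeasurableSpace 𝒳] [Fintype ι]
    {μ : Measure 𝒳} {f : ℕ → ι → 𝒳 → ℝ} {f' : ι → 𝒳 → ℝ}
    (hf : ∀ n i, Measurable (f n i)) (hf' : ∀ i, Measurable (f' i))
    (h : ∀ i, Tendsto (fun n => eLpNorm (fun x => f n i x - f' i x) 2 μ) atTop (𝓝 0)) :
    ∃ ns : ℕ → ℕ, StrictMono ns ∧
      ∀ᵐ x ∂μ, ∀ i, Tendsto (fun n => f (ns n) i x) atTop (𝓝 (f' i x)) := by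
  have hm : ∀ n i, Measurable fun x => |f n i x - f' i x| := fun n i =>
    ((hf n i).sub (hf' i)).abs
  -- Summing the absolute errors reduces the finite family to one sequence, so a single subsequence
  -- works for all indices.
  have h1 : Tendsto (fun n => eLpNorm (∑ i, fun x => |f n i x - f' i x|) 2 μ) atTop (𝓝 0) := by
    have h2 : Tendsto (fun n => ∑ i, eLpNorm (fun x => f n i x - f' i x) 2 μ) atTop (𝓝 0) := by
      simpa using tendsto_finsetSum (Finset.univ : Finset ι) fun i _ => h i
    refine tendsto_of_tendsto_of_tendsto_of_le_of_le tendsto_const_nhds h2 (fun _ => zero_le)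
      fun n => ?_
    refine (eLpNorm_sum_le (fun i _ => (hm n i).aestronglyMeasurable) (by norm_num)).trans ?_
    refine Finset.sum_le_sum fun i _ => ?_
    exact (eLpNorm_norm (fun x => f n i x - f' i x)).le
  have h3 := tendstoInMeasure_of_tendsto_eLpNorm (μ := μ) (p := 2) (l := atTop)
    (f := fun n => ∑ i, fun x => |f n i x - f' i x|) (g := fun _ => 0) (by norm_num)
    (fun n => Finset.aestronglyMeasurable_sum _ fun i _ => (hm n i).aestronglyMeasurable)
    measurable_const.aestronglyMeasurable (by
      refine h1.congr fun n => ?_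
      congr 1
      ext x
      simp)
  obtain ⟨ns, hns, hae⟩ := h3.exists_seq_tendsto_ae
  refine ⟨ns, hns, ?_⟩
  filter_upwards [hae] with x hx i
  rw [tendsto_iff_dist_tendsto_zero]
  refine squeeze_zero (fun _ => dist_nonneg) (fun n => ?_) hx
  rw [Real.dist_eq, Finset.sum_apply]
  exact Finset.single_le_sum (f := fun i => |f (ns n) i x - f' i x|) (fun _ _ => abs_nonneg _)
    (Finset.mem_univ i)

variable {𝒳 : Type*} [MeasurableSpace 𝒳] {K : ℕ}
  {PX : Measure 𝒳} [IsProbabilityMeasure PX] {Q : Kernel (𝒳 × Fin K) ℝ} [IsMarkovKernel Q]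
  {κ Bg B : ℝ} {p : Kernel 𝒳 (Fin K)} [IsMarkovKernel p] {g : 𝒳 → Fin K → ℝ}
  {p' : ℕ → Kernel 𝒳 (Fin K)} [∀ n, IsMarkovKernel (p' n)] {g' : ℕ → 𝒳 → Fin K → ℝ}

theorem exists_subseq_policy_regression (h' : ∀ n, IsRegular PX Q κ Bg B (p' n) (g' n))
    (hgm : ∀ a, Measurable fun x => g x a)
    (hp : ∀ a, Tendsto (fun n => eLpNorm (fun x => (p' n x).real {a} - (p x).real {a}) 2 PX)
      atTop (𝓝 0))
    (hg : ∀ a, Tendsto (fun n => eLpNorm (fun x => g' n x a - g x a) 2 PX) atTop (𝓝 0)) :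
    ∃ ns : ℕ → ℕ, StrictMono ns ∧
      (∀ᵐ x ∂PX, ∀ a, Tendsto (fun n => (p' (ns n) x).real {a}) atTop (𝓝 ((p x).real {a}))) ∧
      ∀ᵐ x ∂PX, ∀ a, Tendsto (fun n => g' (ns n) x a) atTop (𝓝 (g x a)) := by
  obtain ⟨ns, hns, h⟩ := exists_subseq_ae_tendsto (μ := PX) (ι := Fin K ⊕ Fin K)
    (f := fun n => Sum.elim (fun a x => (p' n x).real {a}) (fun a x => g' n x a))
    (f' := Sum.elim (fun a x => (p x).real {a}) (fun a x => g x a))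
    (by
      rintro n (a | a)
      · exact measurable_real_singleton (p' n) a
      · exact (h' n).measurable_reg a)
    (by
      rintro (a | a)
      · exact measurable_real_singleton p a
      · exact hgm a)
    (by
      rintro (a | a)
      · exact hp a
      · exact hg a)
  refine ⟨ns, hns, ?_, ?_⟩
  · filter_upwards [h] with x hx a using hx (Sum.inl a)
  · filter_upwards [h] with x hx a using hx (Sum.inr a)

/-- The pointwise bounds are closed conditions once `1 / q ≤ κ` is read as `1 / κ ≤ q`. They
therefore survive almost everywhere limits along a subsequence. -/
theorem IsRegular.of_tendsto (h' : ∀ n, IsRegular PX Q κ Bg B (p' n) (g' n))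
    (hgm : ∀ a, Measurable fun x => g x a)
    (hp : ∀ a, Tendsto (fun n => eLpNorm (fun x => (p' n x).real {a} - (p x).real {a}) 2 PX)
      atTop (𝓝 0))
    (hg : ∀ a, Tendsto (fun n => eLpNorm (fun x => g' n x a - g x a) 2 PX) atTop (𝓝 0)) :
    IsRegular PX Q κ Bg B p g := by
  obtain ⟨ns, -, h1, h2⟩ := exists_subseq_policy_regression h' hgm hp hg
  refine ⟨hgm, ?_, ?_, (h' 0).outcome⟩
  · filter_upwards [h1, ae_all_iff.2 fun n => (h' n).pol] with x hx hn a
    have hκ : 0 < κ := (one_div_pos.2 (hn 0 a).1).trans_le (hn 0 a).2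
    have hle : 1 / κ ≤ (p x).real {a} := by
      refine ge_of_tendsto (hx a) (Eventually.of_forall fun n => ?_)
      exact (one_div_le hκ (hn _ a).1).2 (hn _ a).2
    have hpos : 0 < (p x).real {a} := (one_div_pos.2 hκ).trans_le hle
    exact ⟨hpos, (one_div_le hpos hκ).2 hle⟩
  · filter_upwards [h2, ae_all_iff.2 fun n => (h' n).reg] with x hx hn a
    exact le_of_tendsto (hx a).abs (Eventually.of_forall fun n => hn _ a)

/-- Almost everywhere convergence is available only along subsequences. This suffices because the
limit is the same for each of them. -/
theorem tendsto_limCov (h' : ∀ n, IsRegular PX Q κ Bg B (p' n) (g' n))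
    (hgm : ∀ a, Measurable fun x => g x a)
    (hp : ∀ a, Tendsto (fun n => eLpNorm (fun x => (p' n x).real {a} - (p x).real {a}) 2 PX)
      atTop (𝓝 0))
    (hg : ∀ a, Tendsto (fun n => eLpNorm (fun x => g' n x a - g x a) 2 PX) atTop (𝓝 0))
    (b c : Fin K) :
    Tendsto (fun n => limCov PX Q (p' n) (g' n) b c) atTop (𝓝 (limCov PX Q p g b c)) := by
  refine tendsto_of_subseq_tendsto fun ms hms => ?_
  obtain ⟨ns, -, h1, h2⟩ := exists_subseq_policy_regression (p := p) (p' := fun n => p' (ms n))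
    (g' := fun n => g' (ms n)) (fun n => h' (ms n)) hgm
    (fun a => (hp a).comp hms) (fun a => (hg a).comp hms)
  exact ⟨ns, tendsto_limCov_of_ae (p' := fun n => p' (ms (ns n)))
    (g' := fun n => g' (ms (ns n))) (fun n => h' _) (IsRegular.of_tendsto h' hgm hp hg) h1 h2 b c⟩

end Continuity

/-! ### Azuma's inequality and an integrable time after which averages are small -/

section Azuma

/-- On `[-c, c]` the convex exponential lies below its chord. The chord is affine in `d`, so its
linear part disappears when a centred increment is integrated. -/
theorem exp_mul_le_cosh_add {c d : ℝ} (hc : 0 < c) (hd : |d| ≤ c) (l : ℝ) :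
    Real.exp (l * d) ≤ Real.cosh (l * c) + d / c * Real.sinh (l * c) := by
  obtain ⟨h1, h2⟩ := abs_le.1 hd
  have e : (1 + d / c) / 2 * (l * c) + (1 - d / c) / 2 * (-(l * c)) = l * d := by
    field_simp
    ring
  have hd1 : -1 ≤ d / c := by rw [le_div_iff₀ hc]; linarith
  have hd2 : d / c ≤ 1 := by rw [div_le_iff₀ hc]; linarith
  have h := convexOn_exp.2 (Set.mem_univ (l * c)) (Set.mem_univ (-(l * c)))
    (show 0 ≤ (1 + d / c) / 2 by linarith) (show 0 ≤ (1 - d / c) / 2 by linarith) (by ring)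
  simp only [smul_eq_mul] at h
  rw [e] at h
  rw [Real.cosh_eq, Real.sinh_eq]
  linarith

variable {Ω : Type*} [MeasurableSpace Ω] {P : Measure Ω} [IsProbabilityMeasure P]

theorem ae_abs_sum_le {D : ℕ → Ω → ℝ} {c : ℝ} (hb : ∀ᵐ ω ∂P, ∀ n, |D n ω| ≤ c) (n : ℕ) :
    ∀ᵐ ω ∂P, |∑ i ∈ Finset.range n, D i ω| ≤ n * c := by
  filter_upwards [hb] with ω hω
  refine (Finset.abs_sum_le_sum_abs _ _).trans ((Finset.sum_le_sum fun i _ => hω i).trans ?_)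
  simp

theorem integrable_exp_sum {D : ℕ → Ω → ℝ} {c : ℝ} (hm : ∀ n, Measurable (D n))
    (hb : ∀ᵐ ω ∂P, ∀ n, |D n ω| ≤ c) (n : ℕ) (l : ℝ) :
    Integrable (fun ω => Real.exp (l * ∑ i ∈ Finset.range n, D i ω)) P := by
  refine Integrable.of_bound ((Finset.measurable_sum _ fun i _ => hm i).const_mul
    l).exp.aestronglyMeasurable (Real.exp (|l| * (n * c))) ?_
  filter_upwards [ae_abs_sum_le hb n] with ω hω
  rw [Real.norm_eq_abs, Real.abs_exp, Real.exp_le_exp]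
  refine (le_abs_self _).trans ?_
  rw [abs_mul]
  exact mul_le_mul_of_nonneg_left hω (abs_nonneg _)

/-- The only consequence of the martingale property that is needed is `h0`: each increment is
orthogonal to the exponentials of the preceding sum. Each round then costs a factor `cosh (l * c)`,
which is at most `exp ((l * c) ^ 2 / 2)`. -/
theorem integral_exp_sum_le {D : ℕ → Ω → ℝ} {c : ℝ} (hc : 0 < c) (hm : ∀ n, Measurable (D n))
    (hb : ∀ᵐ ω ∂P, ∀ n, |D n ω| ≤ c)
    (h0 : ∀ n l, ∫ ω, Real.exp (l * ∑ i ∈ Finset.range n, D i ω) * D n ω ∂P = 0) (n : ℕ) (l : ℝ) :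
    ∫ ω, Real.exp (l * ∑ i ∈ Finset.range n, D i ω) ∂P ≤ Real.exp (n * ((l * c) ^ 2 / 2)) := by
  induction n with
  | zero => simp
  | succ n ih =>
    have hi := integrable_exp_sum (P := P) hm hb n l
    have hi2 : Integrable (fun ω => Real.exp (l * ∑ i ∈ Finset.range n, D i ω) * D n ω) P := by
      refine hi.mul_bdd (c := c) (hm n).aestronglyMeasurable ?_
      filter_upwards [hb] with ω hω using hω n
    calc ∫ ω, Real.exp (l * ∑ i ∈ Finset.range (n + 1), D i ω) ∂P
        ≤ ∫ ω, (Real.cosh (l * c) * Real.exp (l * ∑ i ∈ Finset.range n, D i ω) +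
          Real.sinh (l * c) / c * (Real.exp (l * ∑ i ∈ Finset.range n, D i ω) * D n ω)) ∂P := by
          refine integral_mono_ae (integrable_exp_sum hm hb (n + 1) l)
            ((hi.const_mul _).add (hi2.const_mul _)) ?_
          filter_upwards [hb] with ω hω
          rw [Finset.sum_range_succ, mul_add, Real.exp_add]
          refine (mul_le_mul_of_nonneg_left (exp_mul_le_cosh_add hc (hω n) l)
            (Real.exp_pos _).le).trans_eq ?_
          ring
      _ = Real.cosh (l * c) * ∫ ω, Real.exp (l * ∑ i ∈ Finset.range n, D i ω) ∂P := by
          rw [integral_add (hi.const_mul _) (hi2.const_mul _), integral_const_mul,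
            integral_const_mul, h0, mul_zero, add_zero]
      _ ≤ Real.exp ((l * c) ^ 2 / 2) * Real.exp (n * ((l * c) ^ 2 / 2)) :=
          mul_le_mul (Real.cosh_le_exp_half_sq _) ih (integral_nonneg fun _ => (Real.exp_pos _).le)
            (Real.exp_pos _).le
      _ = Real.exp ((n + 1 : ℕ) * ((l * c) ^ 2 / 2)) := by
          rw [← Real.exp_add]
          congr 1
          push_cast
          ring

theorem measure_sum_ge_le {D : ℕ → Ω → ℝ} {c : ℝ} (hc : 0 < c) (hm : ∀ n, Measurable (D n))
    (hb : ∀ᵐ ω ∂P, ∀ n, |D n ω| ≤ c)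
    (h0 : ∀ n l, ∫ ω, Real.exp (l * ∑ i ∈ Finset.range n, D i ω) * D n ω ∂P = 0) (n : ℕ)
    {ε : ℝ} (hε : 0 < ε) :
    P.real {ω | n * ε ≤ ∑ i ∈ Finset.range n, D i ω} ≤ Real.exp (-(ε ^ 2 / (2 * c ^ 2))) ^ n := by
  -- The parameter `ε / c ^ 2` minimizes the Chernoff exponent `-l * ε + (l * c) ^ 2 / 2`.
  have h := measure_ge_le_exp_mul_mgf (μ := P) (X := fun ω => ∑ i ∈ Finset.range n, D i ω)
    (n * ε) (t := ε / c ^ 2) (by positivity) (integrable_exp_sum hm hb n _)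
  refine h.trans ?_
  unfold mgf
  refine (mul_le_mul_of_nonneg_left (integral_exp_sum_le hc hm hb h0 n _)
    (Real.exp_pos _).le).trans_eq ?_
  rw [← Real.exp_add, ← Real.exp_nat_mul]
  congr 1
  field_simp
  ring

theorem measure_abs_sum_ge_le {D : ℕ → Ω → ℝ} {c : ℝ} (hc : 0 < c) (hm : ∀ n, Measurable (D n))
    (hb : ∀ᵐ ω ∂P, ∀ n, |D n ω| ≤ c)
    (h0 : ∀ n l, ∫ ω, Real.exp (l * ∑ i ∈ Finset.range n, D i ω) * D n ω ∂P = 0) (n : ℕ)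
    {ε : ℝ} (hε : 0 < ε) :
    P.real {ω | n * ε ≤ |∑ i ∈ Finset.range n, D i ω|} ≤
      2 * Real.exp (-(ε ^ 2 / (2 * c ^ 2))) ^ n := by
  have h1 := measure_sum_ge_le hc hm hb h0 n hε
  have h2 := measure_sum_ge_le (P := P) (D := fun i ω => -D i ω) hc (fun i => (hm i).neg)
    (by simpa using hb) (fun n l => by
      have := h0 n (-l)
      simp only [Finset.sum_neg_distrib, mul_neg, integral_neg, neg_eq_zero]
      simpa using this) n hε
  have h3 : {ω | n * ε ≤ |∑ i ∈ Finset.range n, D i ω|} ⊆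
      {ω | n * ε ≤ ∑ i ∈ Finset.range n, D i ω} ∪ {ω | n * ε ≤ ∑ i ∈ Finset.range n, -D i ω} := by
    intro ω hω
    simp only [Set.mem_ofPred_eq, Set.mem_union, Finset.sum_neg_distrib] at hω ⊢
    exact le_abs.1 hω
  calc _ ≤ _ := measureReal_mono h3
    _ ≤ _ := measureReal_union_le _ _
    _ ≤ _ := by linarith

/-- After an integrable random time, the averages of finitely many bounded martingale difference
sequences are at most `ε`. -/
theorem exists_time_abs_sum_le {ι : Type*} [Fintype ι] {D : ι → ℕ → Ω → ℝ} {c : ℝ} (hc : 0 < c)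
    (hm : ∀ j n, Measurable (D j n)) (hb : ∀ j, ∀ᵐ ω ∂P, ∀ n, |D j n ω| ≤ c)
    (h0 : ∀ j n l, ∫ ω, Real.exp (l * ∑ i ∈ Finset.range n, D j i ω) * D j n ω ∂P = 0)
    {ε : ℝ} (hε : 0 < ε) :
    ∃ T : Ω → ℝ≥0∞, Measurable T ∧ ∫⁻ ω, T ω ∂P ≠ ∞ ∧
      ∀ ω (n : ℕ) j, T ω ≤ n → |∑ i ∈ Finset.range n, D j i ω| ≤ n * ε := by
  set S : ι → ℕ → Set Ω := fun j n => {ω | n * ε ≤ |∑ i ∈ Finset.range n, D j i ω|} with hS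
  have hSm : ∀ j n, MeasurableSet (S j n) := fun j n =>
    measurableSet_le measurable_const (Finset.measurable_sum _ fun i _ => hm j i).abs
  have hTm : ∀ (n : ℕ) j, Measurable ((S j n).indicator fun _ => ((n + 1 : ℕ) : ℝ≥0∞)) :=
    fun n j => measurable_const.indicator (hSm j n)
  -- Each bad event at time `n` contributes `n + 1` to `T`. Hence `T ω ≤ n` excludes a bad event at
  -- `n`, and the expectation of `T` is a series of the form $\sum (n+1)r^n$ with $r<1$.
  refine ⟨fun ω => ∑' n : ℕ, ∑ j, (S j n).indicator (fun _ => ((n + 1 : ℕ) : ℝ≥0∞)) ω,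
    Measurable.tsum fun n => Finset.measurable_sum _ fun j _ => hTm n j, ?_, ?_⟩
  · rw [lintegral_tsum fun n => (Finset.measurable_sum _ fun j _ => hTm n j).aemeasurable]
    set r := Real.exp (-(ε ^ 2 / (2 * c ^ 2))) with hr
    have hr0 : 0 ≤ r := (Real.exp_pos _).le
    have hr1 : r < 1 := by
      rw [hr, Real.exp_lt_one_iff]
      have : 0 < ε ^ 2 / (2 * c ^ 2) := by positivity
      linarith
    have hsum : Summable fun n : ℕ => (n + 1 : ℝ) * (Fintype.card ι * (2 * r ^ n)) := by
      have h1 := (summable_pow_mul_geometric_of_norm_lt_one 1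
        (by rwa [Real.norm_eq_abs, abs_of_nonneg hr0]) : Summable fun n : ℕ => (n : ℝ) ^ 1 * r ^ n)
      have h2 := summable_geometric_of_lt_one hr0 hr1
      refine ((h1.add h2).mul_left (Fintype.card ι * 2 : ℝ)).congr fun n => ?_
      ring
    refine ne_top_of_le_ne_top hsum.tsum_ofReal_ne_top (ENNReal.tsum_le_tsum fun n => ?_)
    rw [lintegral_finsetSum _ fun j _ => hTm n j]
    have hle : ∀ j, ∫⁻ ω, (S j n).indicator (fun _ => ((n + 1 : ℕ) : ℝ≥0∞)) ω ∂P ≤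
        ENNReal.ofReal ((n + 1 : ℝ) * (2 * r ^ n)) := by
      intro j
      rw [lintegral_indicator_const (hSm j n), ENNReal.ofReal_mul (by positivity)]
      refine mul_le_mul' ?_ ?_
      · rw [← ENNReal.ofReal_natCast]
        push_cast
        exact le_rfl
      · rw [← ofReal_measureReal]
        exact ENNReal.ofReal_le_ofReal (measure_abs_sum_ge_le hc (hm j) (hb j) (h0 j) n hε)
    refine (Finset.sum_le_sum fun j _ => hle j).trans_eq ?_
    rw [Finset.sum_const, Finset.card_univ, nsmul_eq_mul, ← ENNReal.ofReal_natCast,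
      ← ENNReal.ofReal_mul (by positivity)]
    congr 1
    ring
  · intro ω n j hn
    by_contra hlt
    have hmem : ω ∈ S j n := (not_le.1 hlt).le
    have h1 : ((n + 1 : ℕ) : ℝ≥0∞) ≤
        ∑ j, (S j n).indicator (fun _ => ((n + 1 : ℕ) : ℝ≥0∞)) ω := by
      refine le_trans ?_ (Finset.single_le_sum (f := fun j => (S j n).indicator
        (fun _ => ((n + 1 : ℕ) : ℝ≥0∞)) ω) (fun _ _ => zero_le) (Finset.mem_univ j))
      simp [hmem]
    have h2 := (h1.trans (ENNReal.le_tsum (f := fun n : ℕ => ∑ j, (S j n).indicator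
      (fun _ => ((n + 1 : ℕ) : ℝ≥0∞)) ω) n)).trans hn
    exact absurd (Nat.cast_le.1 h2) (by omega)

theorem ae_tendsto_average_zero {D : ℕ → Ω → ℝ} {c : ℝ} (hc : 0 < c)
    (hm : ∀ n, Measurable (D n)) (hb : ∀ᵐ ω ∂P, ∀ n, |D n ω| ≤ c)
    (h0 : ∀ n l, ∫ ω, Real.exp (l * ∑ i ∈ Finset.range n, D i ω) * D n ω ∂P = 0) :
    ∀ᵐ ω ∂P, Tendsto (fun n : ℕ => (∑ i ∈ Finset.range n, D i ω) / n) atTop (𝓝 0) := by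
  choose T hTm hTi hT using fun k : ℕ => exists_time_abs_sum_le (ι := Unit) (D := fun _ => D) hc
    (fun _ => hm) (fun _ => hb) (fun _ => h0) (Nat.one_div_pos_of_nat (α := ℝ) (n := k))
  have hfin : ∀ᵐ ω ∂P, ∀ k, T k ω < ∞ := ae_all_iff.2 fun k => ae_lt_top (hTm k) (hTi k)
  filter_upwards [hfin] with ω hω
  rw [Metric.tendsto_atTop]
  intro ε hε
  obtain ⟨k, hk⟩ := exists_nat_one_div_lt hε
  obtain ⟨N, hN⟩ := ENNReal.exists_nat_gt (hω k).ne
  refine ⟨N + 1, fun n hn => ?_⟩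
  have hn0 : (0 : ℝ) < n := by exact_mod_cast (by omega : 0 < n)
  have h := hT k ω n () (hN.le.trans (by exact_mod_cast (by omega : N ≤ n)))
  rw [Real.dist_eq, sub_zero, abs_div, abs_of_pos hn0, div_lt_iff₀ hn0, mul_comm]
  exact h.trans_lt (by gcongr)

end Azuma

/-! ### Conditional law of a round and martingale differences of the bandit process -/

section BanditProcess

variable {Ω 𝒳 : Type*} [MeasurableSpace Ω] [MeasurableSpace 𝒳] {K : ℕ}
  {P : Measure Ω} [IsProbabilityMeasure P] {PX : Measure 𝒳} [IsProbabilityMeasure PX]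
  {Q : Kernel (𝒳 × Fin K) ℝ} [IsMarkovKernel Q]
  {pol : ∀ n : ℕ, Kernel ((Fin n → Obs 𝒳 K) × 𝒳) (Fin K)} [∀ n, IsMarkovKernel (pol n)]
  {X : ℕ → Ω → 𝒳} {A : ℕ → Ω → Fin K} {Y : ℕ → Ω → ℝ}

/-- The conditional law of an observation given the history. -/
noncomputable def stepKernel (PX : Measure 𝒳) (Q : Kernel (𝒳 × Fin K) ℝ)
    (pol : ∀ n : ℕ, Kernel ((Fin n → Obs 𝒳 K) × 𝒳) (Fin K)) (n : ℕ) :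
    Kernel (Fin n → Obs 𝒳 K) (Obs 𝒳 K) :=
  Kernel.const _ PX ⊗ₖ (pol n ⊗ₖ
    Q.comap (fun p : ((Fin n → Obs 𝒳 K) × 𝒳) × Fin K => (p.1.2, p.2)) (by fun_prop))

instance (n : ℕ) : IsMarkovKernel (stepKernel PX Q pol n) := by
  unfold stepKernel; infer_instance

/-- This lets every result about one round with a fixed policy be applied conditionally on the
history. -/
theorem stepKernel_apply (n : ℕ) (h : Fin n → Obs 𝒳 K) :
    stepKernel PX Q pol n h = limLaw PX Q ((pol n).sectR h) := by
  unfold stepKernel limLaw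
  rw [Kernel.compProd_apply_eq_compProd_sectR, Kernel.const_apply]
  congr 1
  ext x : 1
  rw [Kernel.sectR_apply, Kernel.compProd_apply_eq_compProd_sectR,
    Kernel.compProd_apply_eq_compProd_sectR]
  rfl

theorem IsBanditProcess.measurable_traj (hd : IsBanditProcess P PX Q pol X A Y) (n : ℕ) :
    Measurable fun ω => traj X A Y ω n :=
  (hd.measurable_context n).prodMk ((hd.measurable_arm n).prodMk (hd.measurable_outcome n))

theorem IsBanditProcess.measurable_hist (hd : IsBanditProcess P PX Q pol X A Y) (n : ℕ) :
    Measurable fun ω => hist (traj X A Y ω) n :=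
  measurable_pi_lambda _ fun i => hd.measurable_traj i

/-- Chains the conditional laws of context, arm and outcome into one disintegration. All later
conditioning on the past goes through this identity. -/
theorem IsBanditProcess.map_hist_traj (hd : IsBanditProcess P PX Q pol X A Y) (n : ℕ) :
    P.map (fun ω => (hist (traj X A Y ω) n, traj X A Y ω n)) =
      P.map (fun ω => hist (traj X A Y ω) n) ⊗ₘ stepKernel PX Q pol n := by
  have h1 := (hd.law_context n).map_eq
  have h2 := (hd.law_arm n).map_eq
  have h3 := (hd.law_outcome n).map_eq
  rw [h2, h1] at h3
  unfold stepKernel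
  rw [← Measure.compProd_assoc', ← Measure.compProd_assoc', ← h3,
    Measure.map_map (by fun_prop) (by fun_prop), Measure.map_map (by fun_prop)]
  · rfl
  · exact ((((hd.measurable_hist n).prodMk (hd.measurable_context n)).prodMk
      (hd.measurable_arm n)).prodMk (hd.measurable_outcome n))

theorem IsBanditProcess.ae_step (hd : IsBanditProcess P PX Q pol X A Y) (n : ℕ)
    {S : (Fin n → Obs 𝒳 K) × Obs 𝒳 K → Prop} (hS : MeasurableSet {q | S q})
    (h : ∀ᵐ ω ∂P, S (hist (traj X A Y ω) n, traj X A Y ω n)) :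
    ∀ᵐ ω ∂P, ∀ᵐ z ∂stepKernel PX Q pol n (hist (traj X A Y ω) n), S (hist (traj X A Y ω) n, z) := by
  have hm := (hd.measurable_hist n).prodMk (hd.measurable_traj n)
  have h1 : ∀ᵐ q ∂P.map (fun ω => (hist (traj X A Y ω) n, traj X A Y ω n)), S q :=
    (ae_map_iff hm.aemeasurable hS).2 h
  rw [hd.map_hist_traj] at h1
  exact ae_of_ae_map (hd.measurable_hist n).aemeasurable (Measure.ae_ae_of_ae_compProd h1)

theorem IsBanditProcess.integral_step (hd : IsBanditProcess P PX Q pol X A Y) (n : ℕ)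
    {F : (Fin n → Obs 𝒳 K) × Obs 𝒳 K → ℝ} (hF : Measurable F)
    (hi : Integrable (fun ω => F (hist (traj X A Y ω) n, traj X A Y ω n)) P) :
    ∫ ω, F (hist (traj X A Y ω) n, traj X A Y ω n) ∂P =
      ∫ ω, ∫ z, F (hist (traj X A Y ω) n, z) ∂stepKernel PX Q pol n (hist (traj X A Y ω) n) ∂P := by
  have hm := (hd.measurable_hist n).prodMk (hd.measurable_traj n)
  have h1 : ∫ ω, F (hist (traj X A Y ω) n, traj X A Y ω n) ∂P =
      ∫ q, F q ∂P.map (fun ω => (hist (traj X A Y ω) n, traj X A Y ω n)) :=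
    (integral_map hm.aemeasurable hF.aestronglyMeasurable).symm
  have hi' : Integrable F (P.map (fun ω => (hist (traj X A Y ω) n, traj X A Y ω n))) :=
    (integrable_map_measure hF.aestronglyMeasurable hm.aemeasurable).2 hi
  rw [h1]
  rw [hd.map_hist_traj] at hi' ⊢
  rw [Measure.integral_compProd hi', integral_map (hd.measurable_hist n).aemeasurable]
  exact (hF.stronglyMeasurable.integral_kernel_prod_right').aestronglyMeasurable

/-- The deviation of a statistic of round `n + 1` from its conditional mean. -/
noncomputable def mdiff (PX : Measure 𝒳) (Q : Kernel (𝒳 × Fin K) ℝ)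
    (pol : ∀ n : ℕ, Kernel ((Fin n → Obs 𝒳 K) × 𝒳) (Fin K))
    (F : ∀ n : ℕ, (Fin n → Obs 𝒳 K) × Obs 𝒳 K → ℝ) (n : ℕ) (o : ℕ → Obs 𝒳 K) : ℝ :=
  F n (hist o n, o n) - ∫ z, F n (hist o n, z) ∂stepKernel PX Q pol n (hist o n)

variable {F : ∀ n : ℕ, (Fin n → Obs 𝒳 K) × Obs 𝒳 K → ℝ}

theorem measurable_integral_step (hF : ∀ n, Measurable (F n)) (n : ℕ) :
    Measurable fun h => ∫ z, F n (h, z) ∂stepKernel PX Q pol n h :=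
  (hF n).stronglyMeasurable.integral_kernel_prod_right'.measurable

theorem measurable_mdiff_pair (hF : ∀ n, Measurable (F n)) (n : ℕ) :
    Measurable fun q : (Fin n → Obs 𝒳 K) × Obs 𝒳 K =>
      F n q - ∫ z, F n (q.1, z) ∂stepKernel PX Q pol n q.1 :=
  (hF n).sub ((measurable_integral_step hF n).comp measurable_fst)

theorem IsBanditProcess.measurable_mdiff (hd : IsBanditProcess P PX Q pol X A Y)
    (hF : ∀ n, Measurable (F n)) (n : ℕ) :
    Measurable fun ω => mdiff PX Q pol F n (traj X A Y ω) :=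
  (measurable_mdiff_pair (PX := PX) (Q := Q) (pol := pol) hF n).comp
    ((hd.measurable_hist n).prodMk (hd.measurable_traj n))

theorem IsBanditProcess.ae_bound_step (hd : IsBanditProcess P PX Q pol X A Y)
    (hF : ∀ n, Measurable (F n)) {c : ℝ}
    (hb : ∀ᵐ ω ∂P, ∀ n, |F n (hist (traj X A Y ω) n, traj X A Y ω n)| ≤ c) :
    ∀ᵐ ω ∂P, ∀ n, ∀ᵐ z ∂stepKernel PX Q pol n (hist (traj X A Y ω) n),
      |F n (hist (traj X A Y ω) n, z)| ≤ c := by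
  rw [ae_all_iff] at hb ⊢
  exact fun n => hd.ae_step n (S := fun q => |F n q| ≤ c)
    (measurableSet_le (hF n).abs measurable_const) (hb n)

theorem IsBanditProcess.abs_mdiff_le (hd : IsBanditProcess P PX Q pol X A Y)
    (hF : ∀ n, Measurable (F n)) {c : ℝ}
    (hb : ∀ᵐ ω ∂P, ∀ n, |F n (hist (traj X A Y ω) n, traj X A Y ω n)| ≤ c) :
    ∀ᵐ ω ∂P, ∀ n, |mdiff PX Q pol F n (traj X A Y ω)| ≤ 2 * c := by
  filter_upwards [hb, hd.ae_bound_step hF hb] with ω h1 h2 n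
  have h3 := norm_integral_le_of_norm_le_const
    (f := fun z => F n (hist (traj X A Y ω) n, z)) (C := c) (h2 n)
  rw [probReal_univ, mul_one] at h3
  rw [two_mul]
  exact (abs_sub _ _).trans (add_le_add (h1 n) h3)

/-- The exponential depends only on the history, so it factors out of the conditional integral, and
the centred increment integrates to zero. This is the orthogonality that the Azuma bounds require.
-/
theorem IsBanditProcess.integral_exp_sum_mul_mdiff (hd : IsBanditProcess P PX Q pol X A Y)
    (hF : ∀ n, Measurable (F n)) {c : ℝ}
    (hb : ∀ᵐ ω ∂P, ∀ n, |F n (hist (traj X A Y ω) n, traj X A Y ω n)| ≤ c) (n : ℕ) (l : ℝ) :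
    ∫ ω, Real.exp (l * ∑ i ∈ Finset.range n, mdiff PX Q pol F i (traj X A Y ω)) *
      mdiff PX Q pol F n (traj X A Y ω) ∂P = 0 := by
  have hpair : ∀ i : Fin n, Measurable fun h : Fin n → Obs 𝒳 K =>
      ((fun j : Fin i => h (Fin.castLE i.2.le j)), h i) := fun i => by fun_prop
  -- The exponential of the past sum, written as a function of the finite history; shorter histories
  -- are restrictions along `Fin.castLE`.
  set G : (Fin n → Obs 𝒳 K) → ℝ := fun h => Real.exp (l * ∑ i : Fin n,
    (F i ((fun j : Fin i => h (Fin.castLE i.2.le j)), h i) -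
      ∫ z, F i ((fun j : Fin i => h (Fin.castLE i.2.le j)), z)
        ∂stepKernel PX Q pol i (fun j : Fin i => h (Fin.castLE i.2.le j)))) with hG
  have hterm : ∀ i : Fin n, Measurable fun h : Fin n → Obs 𝒳 K =>
      F i ((fun j : Fin i => h (Fin.castLE i.2.le j)), h i) -
        ∫ z, F i ((fun j : Fin i => h (Fin.castLE i.2.le j)), z)
          ∂stepKernel PX Q pol i (fun j : Fin i => h (Fin.castLE i.2.le j)) := fun i =>
    (measurable_mdiff_pair (PX := PX) (Q := Q) (pol := pol) hF (i : ℕ)).comp (hpair i)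
  have hGm : Measurable G :=
    ((Finset.measurable_sum Finset.univ fun i _ => hterm i).const_mul l).exp
  have hGeq : ∀ ω, Real.exp (l * ∑ i ∈ Finset.range n, mdiff PX Q pol F i (traj X A Y ω)) =
      G (hist (traj X A Y ω) n) := by
    intro ω
    rw [hG, Finset.sum_range]
    rfl
  have hmm := hd.measurable_mdiff (PX := PX) (Q := Q) hF
  have hbm := hd.abs_mdiff_le hF hb
  have hint : Integrable (fun ω => G (hist (traj X A Y ω) n) *
      mdiff PX Q pol F n (traj X A Y ω)) P := by
    simp only [← hGeq]
    refine (integrable_exp_sum hmm hbm n l).mul_bdd (c := 2 * c) (hmm n).aestronglyMeasurable ?_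
    filter_upwards [hbm] with ω hω using hω n
  simp only [hGeq]
  refine (hd.integral_step n (F := fun q => G q.1 *
    (F n q - ∫ z, F n (q.1, z) ∂stepKernel PX Q pol n q.1))
    ((hGm.comp measurable_fst).mul (measurable_mdiff_pair hF n)) hint).trans ?_
  refine integral_eq_zero_of_ae ?_
  filter_upwards [hd.ae_bound_step hF hb] with ω hω
  have hi : Integrable (fun z => F n (hist (traj X A Y ω) n, z))
      (stepKernel PX Q pol n (hist (traj X A Y ω) n)) :=
    Integrable.of_bound ((hF n).comp measurable_prodMk_left).aestronglyMeasurable c (hω n)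
  simp only [Pi.zero_apply]
  rw [integral_const_mul, integral_sub hi (integrable_const _)]
  simp

theorem IsBanditProcess.exists_time (hd : IsBanditProcess P PX Q pol X A Y)
    {ι : Type*} [Fintype ι] {F : ι → ∀ n : ℕ, (Fin n → Obs 𝒳 K) × Obs 𝒳 K → ℝ}
    (hF : ∀ j n, Measurable (F j n)) {c : ℝ} (hc : 0 < c)
    (hb : ∀ j, ∀ᵐ ω ∂P, ∀ n, |F j n (hist (traj X A Y ω) n, traj X A Y ω n)| ≤ c)
    {ε : ℝ} (hε : 0 < ε) :
    ∃ T : Ω → ℝ≥0∞, Measurable T ∧ ∫⁻ ω, T ω ∂P ≠ ∞ ∧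
      ∀ ω (n : ℕ) j, T ω ≤ n →
        |∑ i ∈ Finset.range n, mdiff PX Q pol (F j) i (traj X A Y ω)| ≤ n * ε :=
  exists_time_abs_sum_le (c := 2 * c) (D := fun j n ω => mdiff PX Q pol (F j) n (traj X A Y ω))
    (by positivity) (fun j => hd.measurable_mdiff (hF j)) (fun j => hd.abs_mdiff_le (hF j) (hb j))
    (fun j => hd.integral_exp_sum_mul_mdiff (hF j) (hb j)) hε

theorem IsBanditProcess.ae_tendsto_average (hd : IsBanditProcess P PX Q pol X A Y)
    (hF : ∀ n, Measurable (F n)) {c : ℝ} (hc : 0 < c)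
    (hb : ∀ᵐ ω ∂P, ∀ n, |F n (hist (traj X A Y ω) n, traj X A Y ω n)| ≤ c) :
    ∀ᵐ ω ∂P, Tendsto (fun n : ℕ => (∑ i ∈ Finset.range n, mdiff PX Q pol F i (traj X A Y ω)) / n)
      atTop (𝓝 0) :=
  ae_tendsto_average_zero (c := 2 * c) (by positivity) (hd.measurable_mdiff hF)
    (hd.abs_mdiff_le hF hb) (hd.integral_exp_sum_mul_mdiff hF hb)

/-- Transfers the bound from observed outcomes to the kernel `Q`. The first round is enough: its
policy gives every arm positive mass, so an almost sure statement about the drawn arm holds for each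
arm. -/
theorem IsBanditProcess.ae_outcome (hd : IsBanditProcess P PX Q pol X A Y) {B : ℝ}
    (hB : ∀ᵐ ω ∂P, ∀ n, |Y n ω| < B)
    (hpos : ∀ᵐ ω ∂P, ∀ n x a, 0 < (pol n (hist (traj X A Y ω) n, x)).real {a}) :
    ∀ᵐ x ∂PX, ∀ a, ∀ᵐ y ∂Q (x, a), |y| ≤ B := by
  have h1 := hd.ae_step 0 (S := fun q => |q.2.2.2| ≤ B)
    (measurableSet_le (by fun_prop) measurable_const) (hB.mono fun ω h => (h 0).le)
  obtain ⟨ω, h2, h3⟩ := (h1.and hpos).exists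
  rw [stepKernel_apply] at h2
  filter_upwards [Measure.ae_ae_of_ae_compProd h2] with x hx a
  have h4 := Kernel.ae_ae_of_ae_compProd hx
  rw [ae_iff_of_countable] at h4
  refine h4 a fun h0 => (h3 0 x a).ne' ?_
  rw [Kernel.sectR_apply] at h0
  simp [measureReal_def, h0]

end BanditProcess

/-! ### Cesàro averages -/

section Averages

theorem tendsto_average {u : ℕ → ℝ} {l : ℝ} (h : Tendsto u atTop (𝓝 l)) :
    Tendsto (fun n : ℕ => (∑ i ∈ Finset.range n, u i) / n) atTop (𝓝 l) :=
  h.cesaro.congr fun n => by rw [div_eq_inv_mul]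

theorem tendsto_average_of_sub {u v : ℕ → ℝ} {l : ℝ} (h : Tendsto (fun n => u n - v n) atTop (𝓝 0))
    (hv : Tendsto (fun n : ℕ => (∑ i ∈ Finset.range n, v i) / n) atTop (𝓝 l)) :
    Tendsto (fun n : ℕ => (∑ i ∈ Finset.range n, u i) / n) atTop (𝓝 l) := by
  have := (tendsto_average h).add hv
  rw [zero_add] at this
  refine this.congr fun n => ?_
  rw [← add_div, ← Finset.sum_add_distrib]
  simp

theorem tendsto_average_of_average_sub {u v : ℕ → ℝ} {l : ℝ}
    (h : Tendsto (fun n : ℕ => (∑ i ∈ Finset.range n, (u i - v i)) / n) atTop (𝓝 0))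
    (hv : Tendsto v atTop (𝓝 l)) :
    Tendsto (fun n : ℕ => (∑ i ∈ Finset.range n, u i) / n) atTop (𝓝 l) := by
  have := h.add (tendsto_average hv)
  rw [zero_add] at this
  refine this.congr fun n => ?_
  rw [← add_div, ← Finset.sum_add_distrib]
  simp

theorem tendsto_mul_zero_of_bounded {u v : ℕ → ℝ} {r : ℝ} (hu : Tendsto u atTop (𝓝 0))
    (hv : ∀ n, |v n| ≤ r) : Tendsto (fun n => u n * v n) atTop (𝓝 0) := by
  refine squeeze_zero_norm (a := fun n => |u n| * r) (fun n => ?_) ?_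
  · rw [norm_mul]
    exact mul_le_mul_of_nonneg_left (hv n) (abs_nonneg _)
  · simpa using hu.abs.mul_const r

end Averages

/-! ### Maximization of signal-to-noise ratios over `Delta a` -/

section Quadratic

variable {K : ℕ}

/-- The quadratic form of a matrix. -/
def quad (C : Fin K → Fin K → ℝ) (w : Fin K → ℝ) : ℝ := ∑ b, ∑ c, w b * w c * C b c

/-- The ratio of a linear form to the root of a quadratic form. -/
noncomputable def snr (C : Fin K → Fin K → ℝ) (m w : Fin K → ℝ) : ℝ :=
  (∑ b, w b * m b) / √(quad C w)

theorem sq_sum_eq_quad (w d : Fin K → ℝ) :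
    (∑ b, w b * d b) ^ 2 = quad (fun b c => d b * d c) w := by
  unfold quad
  rw [sq, Finset.sum_mul_sum]
  refine Finset.sum_congr rfl fun b _ => Finset.sum_congr rfl fun c _ => by ring

theorem quad_smul (C : Fin K → Fin K → ℝ) (r : ℝ) (w : Fin K → ℝ) :
    quad C (fun b => r * w b) = r ^ 2 * quad C w := by
  unfold quad
  rw [Finset.mul_sum]
  refine Finset.sum_congr rfl fun b _ => ?_
  rw [Finset.mul_sum]
  exact Finset.sum_congr rfl fun c _ => by ring

theorem quad_parallelogram (C : Fin K → Fin K → ℝ) (v w : Fin K → ℝ) :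
    quad C (fun b => v b + w b) + quad C (fun b => v b - w b) = 2 * quad C v + 2 * quad C w := by
  unfold quad
  simp only [Finset.mul_sum, ← Finset.sum_add_distrib]
  exact Finset.sum_congr rfl fun b _ => Finset.sum_congr rfl fun c _ => by ring

theorem tendsto_quad {ι : Type*} {l : Filter ι} {C : ι → Fin K → Fin K → ℝ}
    {C' : Fin K → Fin K → ℝ} {w : ι → Fin K → ℝ} {w' : Fin K → ℝ}
    (hC : ∀ b c, Tendsto (fun n => C n b c) l (𝓝 (C' b c)))
    (hw : ∀ b, Tendsto (fun n => w n b) l (𝓝 (w' b))) :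
    Tendsto (fun n => quad (C n) (w n)) l (𝓝 (quad C' w')) :=
  tendsto_finsetSum _ fun b _ => tendsto_finsetSum _ fun c _ => ((hw b).mul (hw c)).mul (hC b c)

theorem tendsto_snr {ι : Type*} {l : Filter ι} {C : ι → Fin K → Fin K → ℝ}
    {C' : Fin K → Fin K → ℝ} {m : ι → Fin K → ℝ} {m' : Fin K → ℝ} {w : ι → Fin K → ℝ}
    {w' : Fin K → ℝ} (hC : ∀ b c, Tendsto (fun n => C n b c) l (𝓝 (C' b c)))
    (hm : ∀ b, Tendsto (fun n => m n b) l (𝓝 (m' b)))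
    (hw : ∀ b, Tendsto (fun n => w n b) l (𝓝 (w' b))) (h0 : 0 < quad C' w') :
    Tendsto (fun n => snr (C n) (m n) (w n)) l (𝓝 (snr C' m' w')) :=
  Tendsto.div (tendsto_finsetSum _ fun b _ => (hw b).mul (hm b)) (tendsto_quad hC hw).sqrt
    (Real.sqrt_pos.2 h0).ne'

theorem abs_le_one_of_mem_Delta {a : Fin K} {w : Fin K → ℝ} (hw : w ∈ Delta a) (b : Fin K) :
    |w b| ≤ 1 := by
  obtain ⟨h1, h2, h3⟩ := hw
  by_cases hb : b = a
  · rw [hb, h1]; simp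
  · rw [abs_of_nonneg (h2 b hb), ← h3]
    exact Finset.single_le_sum (f := w) (fun c hc => h2 c (Finset.ne_of_mem_erase hc))
      (Finset.mem_erase.2 ⟨hb, Finset.mem_univ b⟩)

theorem isCompact_Delta (a : Fin K) : IsCompact (Delta a) := by
  refine IsCompact.of_isClosed_subset (isCompact_Icc (a := fun _ : Fin K => (-1 : ℝ))
    (b := fun _ => 1)) ?_ ?_
  · have h1 : IsClosed {w : Fin K → ℝ | w a = -1} :=
      isClosed_eq (continuous_apply a) continuous_const
    have h2 : IsClosed {w : Fin K → ℝ | ∀ b, b ≠ a → 0 ≤ w b} := by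
      simp only [Set.ofPred_forall]
      exact isClosed_iInter fun b => isClosed_iInter fun _ =>
        isClosed_le continuous_const (continuous_apply b)
    have h3 : IsClosed {w : Fin K → ℝ | ∑ b ∈ Finset.univ.erase a, w b = 1} :=
      isClosed_eq (by fun_prop) continuous_const
    exact h1.inter (h2.inter h3)
  · intro w hw
    exact ⟨fun b => (abs_le.1 (abs_le_one_of_mem_Delta hw b)).1,
      fun b => (abs_le.1 (abs_le_one_of_mem_Delta hw b)).2⟩

/-- The contrast between two arms. -/
def contrast (a b : Fin K) : Fin K → ℝ := fun c => if c = a then -1 else if c = b then 1 else 0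

theorem contrast_mem_Delta {a b : Fin K} (h : b ≠ a) : contrast a b ∈ Delta a := by
  refine ⟨by simp [contrast], fun c hc => ?_, ?_⟩
  · simp only [contrast, hc, if_false]
    split_ifs <;> norm_num
  · rw [Finset.sum_eq_single b]
    · simp [contrast, h]
    · intro c hc hcb
      simp [contrast, Finset.ne_of_mem_erase hc, hcb]
    · simp [h]

theorem sum_contrast_mul {a b : Fin K} (h : b ≠ a) (m : Fin K → ℝ) :
    ∑ c, contrast a b c * m c = m b - m a := by
  have : ∀ c, contrast a b c * m c = (if c = b then m c else 0) - (if c = a then m c else 0) := by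
    intro c
    unfold contrast
    by_cases h1 : c = a
    · subst h1; simp [Ne.symm h]
    · simp [h1]
  simp only [this, Finset.sum_sub_distrib, Finset.sum_ite_eq', Finset.mem_univ, if_true]

theorem ne_zero_of_mem_Delta {a : Fin K} {w : Fin K → ℝ} (hw : w ∈ Delta a) : w ≠ 0 := by
  rintro rfl
  have := hw.1
  simp at this

/-- The signal-to-noise ratio has a unique maximizer. -/
theorem existsUnique_isMaxOn_snr {C : Fin K → Fin K → ℝ} {m : Fin K → ℝ} {a a' : Fin K}
    (hC : ∀ w, w ≠ 0 → 0 < quad C w) (ha : m a < m a') :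
    ∃ u, ∀ v, (v ∈ Delta a ∧ IsMaxOn (snr C m) (Delta a) v) ↔ v = u := by
  have hne : a' ≠ a := by rintro rfl; exact lt_irrefl _ ha
  have hpos : ∀ w ∈ Delta a, 0 < quad C w := fun w hw => hC w (ne_zero_of_mem_Delta hw)
  have hcont : ContinuousOn (snr C m) (Delta a) := by
    intro w hw
    exact tendsto_snr (fun _ _ => tendsto_const_nhds) (fun _ => tendsto_const_nhds)
      (fun b => ((continuous_apply b).tendsto w).mono_left nhdsWithin_le_nhds) (hpos w hw)
  obtain ⟨u, hu, hmax⟩ := (isCompact_Delta a).exists_isMaxOn ⟨_, contrast_mem_Delta hne⟩ hcont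
  refine ⟨u, fun v => ⟨fun hv => ?_, fun hv => hv ▸ ⟨hu, hmax⟩⟩⟩
  obtain ⟨hv, hvmax⟩ := hv
  set s := √(quad C u) with hs
  set s' := √(quad C v) with hs'
  have hs0 : 0 < s := Real.sqrt_pos.2 (hpos u hu)
  have hs0' : 0 < s' := Real.sqrt_pos.2 (hpos v hv)
  have hsq : s ^ 2 = quad C u := Real.sq_sqrt (hpos u hu).le
  have hsq' : s' ^ 2 = quad C v := Real.sq_sqrt (hpos v hv).le
  have hr : 0 < snr C m u := by
    refine lt_of_lt_of_le ?_ (hmax (contrast_mem_Delta hne))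
    unfold snr
    rw [sum_contrast_mul hne]
    exact div_pos (sub_pos.2 ha) (Real.sqrt_pos.2 (hpos _ (contrast_mem_Delta hne)))
  have heq : snr C m v = snr C m u := le_antisymm (hmax hv) (hvmax hu)
  set r := snr C m u with hrdef
  have hlu : ∑ b, u b * m b = r * s := by
    exact (div_mul_cancel₀ _ hs0.ne').symm
  have hlv : ∑ b, v b * m b = r * s' := by
    rw [← heq]
    exact (div_mul_cancel₀ _ hs0'.ne').symm
  -- If the normalized maximizers are parallel, the common entry `-1` at `a` forces `s' = s`, hence
  -- equality. Otherwise the parallelogram identity is strict, and a point between them has a larger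
  -- ratio.
  by_cases hpar : (fun b => s' * u b - s * v b) = 0
  · have h1 : ∀ b, s' * u b = s * v b := fun b => sub_eq_zero.1 (congrFun hpar b)
    have h2 := h1 a
    rw [hu.1, hv.1] at h2
    have h3 : s' = s := by linarith
    funext b
    have := h1 b
    rw [h3] at this
    exact (mul_left_cancel₀ hs0.ne' this).symm
  · exfalso
    have hq := quad_parallelogram C (fun b => s' * u b) (fun b => s * v b)
    rw [quad_smul, quad_smul, ← hsq, ← hsq'] at hq
    have hq0 := hC _ hpar
    have hlt : quad C (fun b => s' * u b + s * v b) < (2 * s * s') ^ 2 := by nlinarith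
    have hsum : 0 < s + s' := by positivity
    -- The convex combination in which `u` and `v`, weighted by `s'` and `s`, contribute vectors of
    -- equal length `s * s'`. Its numerator is `r` times the sum of these lengths, up to
    -- normalization, while its standard deviation is strictly smaller than that sum.
    set z : Fin K → ℝ := fun b => (s + s')⁻¹ * (s' * u b + s * v b) with hz
    have hzΔ : z ∈ Delta a := by
      refine ⟨?_, fun b hb => ?_, ?_⟩
      · simp only [hz, hu.1, hv.1]; field_simp; ring
      · have := hu.2.1 b hb
        have := hv.2.1 b hb
        simp only [hz]; positivity
      · simp only [hz, ← Finset.mul_sum, Finset.sum_add_distrib, hu.2.2, hv.2.2]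
        field_simp; ring
    have hzq : quad C z = ((s + s')⁻¹) ^ 2 * quad C (fun b => s' * u b + s * v b) :=
      quad_smul _ _ _
    have hzl : ∑ b, z b * m b = (s + s')⁻¹ * (2 * r * s * s') := by
      have : ∀ b, z b * m b = (s + s')⁻¹ * (s' * (u b * m b) + s * (v b * m b)) := fun b => by
        simp only [hz]; ring
      simp only [this, ← Finset.mul_sum, Finset.sum_add_distrib, hlu, hlv]
      ring
    have hzpos := hpos z hzΔ
    have hlt2 : √(quad C z) < (s + s')⁻¹ * (2 * s * s') := by
      rw [Real.sqrt_lt' (by positivity), hzq, mul_pow]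
      exact mul_lt_mul_of_pos_left hlt (by positivity)
    have hle : snr C m z ≤ r := hmax hzΔ
    unfold snr at hle
    rw [div_le_iff₀ (Real.sqrt_pos.2 hzpos), hzl] at hle
    nlinarith [mul_lt_mul_of_pos_left hlt2 hr]

/-- Maximizers of converging signal-to-noise ratios converge to the unique maximizer of the
limit. -/
theorem tendsto_of_isMaxOn_snr {C : ℕ → Fin K → Fin K → ℝ} {C' : Fin K → Fin K → ℝ}
    {m : ℕ → Fin K → ℝ} {m' : Fin K → ℝ} {a : Fin K} {w : ℕ → Fin K → ℝ} {u : Fin K → ℝ}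
    (hC : ∀ b c, Tendsto (fun n => C n b c) atTop (𝓝 (C' b c)))
    (hm : ∀ b, Tendsto (fun n => m n b) atTop (𝓝 (m' b)))
    (hpos : ∀ v, v ≠ 0 → 0 < quad C' v) (hw : ∀ n, w n ∈ Delta a)
    (hmax : ∀ᶠ n in atTop, IsMaxOn (snr (C n) (m n)) (Delta a) (w n))
    (hu : ∀ v, (v ∈ Delta a ∧ IsMaxOn (snr C' m') (Delta a) v) → v = u) :
    Tendsto w atTop (𝓝 u) := by
  refine tendsto_of_subseq_tendsto fun ns hns => ?_
  obtain ⟨v, hv, φ, hφ, hlim⟩ := (isCompact_Delta a).tendsto_subseq fun n => hw (ns n)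
  refine ⟨φ, ?_⟩
  have hto : Tendsto (fun n => ns (φ n)) atTop atTop := hns.comp hφ.tendsto_atTop
  have hvmax : IsMaxOn (snr C' m') (Delta a) v := by
    intro x hx
    have h1 : Tendsto (fun n => snr (C (ns (φ n))) (m (ns (φ n))) x) atTop (𝓝 (snr C' m' x)) :=
      tendsto_snr (fun b c => (hC b c).comp hto) (fun b => (hm b).comp hto)
        (fun _ => tendsto_const_nhds) (hpos x (ne_zero_of_mem_Delta hx))
    have h2 : Tendsto (fun n => snr (C (ns (φ n))) (m (ns (φ n))) (w (ns (φ n)))) atTop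
        (𝓝 (snr C' m' v)) :=
      tendsto_snr (fun b c => (hC b c).comp hto) (fun b => (hm b).comp hto)
        (fun b => ((continuous_apply b).tendsto v).comp hlim)
        (hpos v (ne_zero_of_mem_Delta hv))
    refine le_of_tendsto_of_tendsto h1 h2 ?_
    filter_upwards [hto.eventually hmax] with n hn using hn hx
  rw [← hu v ⟨hv, hvmax⟩]
  exact hlim

end Quadratic

/-! ### Limits of the empirical statistics along a single path -/

section Paths

variable {K : ℕ}

/-- The empirical covariance of scores centred at running means. -/
noncomputable def empCov (φ : ℕ → Fin K → ℝ) (t : ℕ) (b c : Fin K) : ℝ :=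
  (∑ i ∈ Finset.range t, (φ i b - runMean φ (i + 1) b) * (φ i c - runMean φ (i + 1) c)) / t

theorem fixedVar_eq_quad (φ : ℕ → Fin K → ℝ) (t : ℕ) (w : Fin K → ℝ) :
    fixedVar φ t w = quad (empCov φ t) w := by
  unfold fixedVar empCov
  simp only [sq_sum_eq_quad, quad]
  rw [Finset.sum_comm, Finset.sum_div]
  refine Finset.sum_congr rfl fun b _ => ?_
  rw [Finset.sum_comm, Finset.sum_div]
  refine Finset.sum_congr rfl fun c _ => ?_
  rw [← Finset.mul_sum, mul_div_assoc]

theorem empSNR_eq_snr (φ : ℕ → Fin K → ℝ) (t : ℕ) :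
    empSNR φ t = snr (empCov φ t) (runMean φ t) := by
  funext w
  unfold empSNR snr
  rw [fixedVar_eq_quad]

theorem armVar_eq_empCov (φ : ℕ → Fin K → ℝ) (t : ℕ) (b : Fin K) :
    armVar φ t b = empCov φ t b b := by
  unfold armVar empCov
  simp only [sq]

theorem quad_single (C : Fin K → Fin K → ℝ) (b : Fin K) : quad C (Pi.single b 1) = C b b := by
  unfold quad
  simp [Pi.single_apply]

variable {φ : ℕ → Fin K → ℝ} {m : Fin K → ℝ} {R : ℝ}

theorem abs_runMean_le (hφ : ∀ i b, |φ i b| ≤ R) (hR : 0 ≤ R) (t : ℕ) (b : Fin K) :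
    |runMean φ t b| ≤ R := by
  unfold runMean
  rcases Nat.eq_zero_or_pos t with rfl | ht
  · simpa using hR
  · have ht' : (0 : ℝ) < t := by exact_mod_cast ht
    rw [abs_div, abs_of_pos ht', div_le_iff₀ ht', mul_comm]
    refine (Finset.abs_sum_le_sum_abs _ _).trans ((Finset.sum_le_sum fun i _ => hφ i b).trans ?_)
    simp

theorem abs_sub_runMean_le (hφ : ∀ i b, |φ i b| ≤ R) (hR : 0 ≤ R) (t i : ℕ) (b : Fin K) :
    |φ i b - runMean φ t b| ≤ 2 * R := by
  rw [two_mul]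
  exact (abs_sub _ _).trans (add_le_add (hφ i b) (abs_runMean_le hφ hR t b))

/-- Centring at running means instead of true means changes each product by a vanishing factor times
a bounded one, hence changes the average by a null sequence. -/
theorem tendsto_empCov (hφ : ∀ i b, |φ i b| ≤ R) (hR : 0 ≤ R) (hmR : ∀ b, |m b| ≤ R)
    (hm : ∀ b, Tendsto (fun t => runMean φ t b) atTop (𝓝 (m b))) {C : ℕ → Fin K → Fin K → ℝ}
    {C' : Fin K → Fin K → ℝ}
    (hC : ∀ b c, Tendsto (fun n : ℕ => (∑ i ∈ Finset.range n,
      ((φ i b - m b) * (φ i c - m c) - C i b c)) / n) atTop (𝓝 0))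
    (hC' : ∀ b c, Tendsto (fun n => C n b c) atTop (𝓝 (C' b c))) (b c : Fin K) :
    Tendsto (fun t => empCov φ t b c) atTop (𝓝 (C' b c)) := by
  refine tendsto_average_of_sub ?_ (tendsto_average_of_average_sub (hC b c) (hC' b c))
  have h1 : ∀ b, Tendsto (fun i => m b - runMean φ (i + 1) b) atTop (𝓝 0) := fun b => by
    have := ((tendsto_add_atTop_iff_nat 1).2 (hm b)).const_sub (m b)
    rwa [sub_self] at this
  have h2 := (tendsto_mul_zero_of_bounded (h1 b)
    (fun i => abs_sub_runMean_le hφ hR (i + 1) i c)).add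
    (tendsto_mul_zero_of_bounded (h1 c) (v := fun i => φ i b - m b) (r := R + R)
      (fun i => (abs_sub _ _).trans (add_le_add (hφ i b) (hmR b))))
  rw [add_zero] at h2
  refine h2.congr fun i => ?_
  ring

theorem tendsto_testProcess (hφ : ∀ i b, |φ i b| ≤ R)
    (hm : ∀ b, Tendsto (fun t => runMean φ t b) atTop (𝓝 (m b))) {w : ℕ → Fin K → ℝ}
    {u : Fin K → ℝ} (hw : Tendsto w atTop (𝓝 u)) :
    Tendsto (fun t => testProcess φ w t) atTop (𝓝 (∑ b, u b * m b)) := by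
  refine tendsto_average_of_sub (v := fun i => ∑ b, u b * φ i b) ?_ ?_
  · have h1 : ∀ b, Tendsto (fun i => (w i b - u b) * φ i b) atTop (𝓝 0) := fun b => by
      refine tendsto_mul_zero_of_bounded ?_ fun i => hφ i b
      have := (((continuous_apply b).tendsto u).comp hw).sub_const (u b)
      rwa [sub_self] at this
    have h2 := tendsto_finsetSum (Finset.univ : Finset (Fin K)) fun b _ => h1 b
    rw [Finset.sum_const_zero] at h2
    refine h2.congr fun i => ?_
    rw [← Finset.sum_sub_distrib]
    exact Finset.sum_congr rfl fun b _ => by ring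
  · refine (tendsto_finsetSum (Finset.univ : Finset (Fin K)) fun b _ =>
      (hm b).const_mul (u b)).congr fun t => ?_
    rw [Finset.sum_comm, Finset.sum_div]
    refine Finset.sum_congr rfl fun b _ => ?_
    rw [← Finset.mul_sum, mul_div_assoc]
    rfl

/-- The adaptive weights may be replaced by their limit because the residuals are bounded. The
average is then `fixedVar` at the limiting weight, a quadratic form of the empirical covariance. -/
theorem tendsto_testVar (hφ : ∀ i b, |φ i b| ≤ R) (hR : 0 ≤ R) {C : Fin K → Fin K → ℝ}
    (hC : ∀ b c, Tendsto (fun t => empCov φ t b c) atTop (𝓝 (C b c))) {w : ℕ → Fin K → ℝ}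
    {u : Fin K → ℝ} (hw : Tendsto w atTop (𝓝 u)) :
    Tendsto (fun t => testVar φ w t) atTop (𝓝 (quad C u)) := by
  refine tendsto_average_of_sub
    (v := fun i => (∑ b, u b * (φ i b - runMean φ (i + 1) b)) ^ 2) ?_ ?_
  · have hwb : ∀ b, Tendsto (fun i => w i b) atTop (𝓝 (u b)) := fun b =>
      ((continuous_apply b).tendsto u).comp hw
    have h1 : ∀ b c, Tendsto (fun i => (w i b * w i c - u b * u c) *
        ((φ i b - runMean φ (i + 1) b) * (φ i c - runMean φ (i + 1) c))) atTop (𝓝 0) := by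
      intro b c
      refine tendsto_mul_zero_of_bounded (r := (2 * R) * (2 * R)) ?_ fun i => ?_
      · have := ((hwb b).mul (hwb c)).sub_const (u b * u c)
        rwa [sub_self] at this
      · rw [abs_mul]
        exact mul_le_mul (abs_sub_runMean_le hφ hR _ _ _) (abs_sub_runMean_le hφ hR _ _ _)
          (abs_nonneg _) (by linarith)
    have h2 := tendsto_finsetSum (Finset.univ : Finset (Fin K)) fun b _ =>
      tendsto_finsetSum (Finset.univ : Finset (Fin K)) fun c _ => h1 b c
    simp only [Finset.sum_const_zero] at h2
    refine h2.congr fun i => ?_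
    rw [sq_sum_eq_quad, sq_sum_eq_quad]
    unfold quad
    simp only [← Finset.sum_sub_distrib]
    exact Finset.sum_congr rfl fun b _ => Finset.sum_congr rfl fun c _ => by ring
  · have := tendsto_quad hC (fun b => tendsto_const_nhds (x := u b))
    refine this.congr fun t => ?_
    rw [← fixedVar_eq_quad]
    rfl

end Paths

/-! ### Size of the margin relative to `log (1 / α)` -/

section Margin

theorem tendsto_log_one_div : Tendsto (fun α : ℝ => Real.log (1 / α)) (𝓝[>] 0) atTop := by
  simpa only [one_div, Function.comp_def] using Real.tendsto_log_atTop.comp tendsto_inv_nhdsGT_zero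

/-- The margin is below `r` once the sample size exceeds a multiple of `log (1 / α)`. -/
theorem exists_margin_lt {S r c ρ : ℝ} (hρ : 0 < ρ) (hr : 0 < r) (hS : 0 ≤ S) (hc : 0 < c)
    (h : 2 * S < c * r ^ 2) :
    ∃ n₀ : ℕ, ∀ n : ℕ, n₀ ≤ n → ∀ α : ℝ, 0 < α → α ≤ 1 → c * Real.log (1 / α) ≤ n →
      ∀ x : ℝ, x ^ 2 ≤ S → margin n α ρ x < r := by
  have hinv : Tendsto (fun n : ℕ => (n : ℝ)⁻¹) atTop (𝓝 0) := tendsto_inv_atTop_nhds_zero_nat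
  -- The displayed quantity bounds the squared margin uniformly in `α`: `1 / c` bounds `log (1 / α)
  -- / n`, and the square root is what is left of the logarithm after division by `n`. The crude
  -- estimate `log (1 + s) ≤ s` is harmless, since `s` is of order at most `√n`.
  have h1 : Tendsto (fun n : ℕ => (2 * S + 2 / ρ ^ 2 * (n : ℝ)⁻¹) *
      (1 / c + √(S * ρ ^ 2 * (n : ℝ)⁻¹ + ((n : ℝ)⁻¹) ^ 2))) atTop
      (𝓝 ((2 * S + 2 / ρ ^ 2 * 0) * (1 / c + √(S * ρ ^ 2 * 0 + 0 ^ 2)))) :=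
    ((hinv.const_mul _).const_add _).mul
      ((((hinv.const_mul _).add (hinv.pow 2)).sqrt).const_add _)
  have h2 : (2 * S + 2 / ρ ^ 2 * 0) * (1 / c + √(S * ρ ^ 2 * 0 + 0 ^ 2)) < r ^ 2 := by
    simp only [mul_zero, add_zero, ne_eq, OfNat.ofNat_ne_zero, not_false_eq_true, zero_pow,
      Real.sqrt_zero]
    rw [mul_one_div, div_lt_iff₀ hc]
    linarith
  obtain ⟨N, hN⟩ := eventually_atTop.1 (h1.eventually (gt_mem_nhds h2))
  refine ⟨N + 1, fun n hn α hα hα1 hcn x hx => ?_⟩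
  have hn0 : (0 : ℝ) < n := by exact_mod_cast (by omega : 0 < n)
  unfold margin
  rw [Real.sqrt_lt' hr]
  refine lt_of_le_of_lt ?_ (hN n (by omega))
  have hL : 0 ≤ Real.log (1 / α) := Real.log_nonneg (by rw [le_div_iff₀ hα]; linarith)
  set s := √(n * x ^ 2 * ρ ^ 2 + 1) with hs
  have hs0 : 0 ≤ s := Real.sqrt_nonneg _
  have hle : (n : ℝ) * x ^ 2 * ρ ^ 2 + 1 ≤ n * S * ρ ^ 2 + 1 := by gcongr
  have hlog : Real.log (1 + s / (2 * α)) ≤ Real.log (1 / α) + √(n * S * ρ ^ 2 + 1) := by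
    have e1 : 1 + s / (2 * α) ≤ 1 / α * (1 + s) := by
      rw [mul_add, mul_one]
      refine add_le_add ?_ ?_
      · rw [le_div_iff₀ hα]; linarith
      · rw [one_div, ← div_eq_inv_mul]
        exact div_le_div_of_nonneg_left hs0 hα (by linarith)
    calc Real.log (1 + s / (2 * α)) ≤ Real.log (1 / α * (1 + s)) :=
          Real.log_le_log (by positivity) e1
      _ = Real.log (1 / α) + Real.log (1 + s) := Real.log_mul (by positivity) (by positivity)
      _ ≤ Real.log (1 / α) + s := by
          have := Real.log_le_sub_one_of_pos (show 0 < 1 + s by positivity)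
          linarith
      _ ≤ _ := by
          have : s ≤ √(n * S * ρ ^ 2 + 1) := Real.sqrt_le_sqrt hle
          linarith
  have hsq : √(S * ρ ^ 2 * (n : ℝ)⁻¹ + ((n : ℝ)⁻¹) ^ 2) = √(n * S * ρ ^ 2 + 1) / n := by
    rw [eq_div_iff hn0.ne', ← Real.sqrt_sq hn0.le, ← Real.sqrt_mul (by positivity),
      Real.sqrt_sq hn0.le]
    congr 1
    field_simp
  rw [hsq]
  have hlog0 : 0 ≤ Real.log (1 + s / (2 * α)) := Real.log_nonneg (by
    have : 0 ≤ s / (2 * α) := by positivity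
    linarith)
  calc 2 * (n * x ^ 2 * ρ ^ 2 + 1) / (n ^ 2 * ρ ^ 2) * Real.log (1 + s / (2 * α))
      ≤ 2 * (n * S * ρ ^ 2 + 1) / (n ^ 2 * ρ ^ 2) *
        (Real.log (1 / α) + √(n * S * ρ ^ 2 + 1)) := by gcongr
    _ = (2 * S + 2 / ρ ^ 2 * (n : ℝ)⁻¹) *
        (Real.log (1 / α) / n + √(n * S * ρ ^ 2 + 1) / n) := by field_simp
    _ ≤ _ := by
        refine mul_le_mul_of_nonneg_left ?_ (by positivity)
        have : Real.log (1 / α) / n ≤ 1 / c := by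
          rw [div_le_div_iff₀ hn0 hc]
          linarith
        linarith

/-- Each `+ 1` is dropped: the root inside the logarithm is at least `1`, and the prefactor is at
least `2 * x ^ 2 / n`. To first order this matches the upper bound in `exists_margin_lt`. -/
theorem le_margin {n : ℕ} (hn : 1 ≤ n) {α ρ x r : ℝ} (hα : 0 < α) (hα2 : 2 * α ≤ 1) (hρ : 0 < ρ)
    (hr : n * r ^ 2 ≤ 2 * x ^ 2 * Real.log (1 / (2 * α))) : r ≤ margin n α ρ x := by
  have hn0 : (0 : ℝ) < n := by exact_mod_cast hn
  unfold margin
  refine Real.le_sqrt_of_sq_le ?_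
  have h1 : 0 ≤ Real.log (1 / (2 * α)) := Real.log_nonneg (by
    rw [le_div_iff₀ (by positivity)]; linarith)
  have h2 : Real.log (1 / (2 * α)) ≤ Real.log (1 + √(n * x ^ 2 * ρ ^ 2 + 1) / (2 * α)) := by
    refine Real.log_le_log (by positivity) ?_
    have : 1 ≤ √(n * x ^ 2 * ρ ^ 2 + 1) := by
      rw [Real.one_le_sqrt]
      have : 0 ≤ n * x ^ 2 * ρ ^ 2 := by positivity
      linarith
    have := div_le_div_of_nonneg_right this (show 0 ≤ 2 * α by positivity)
    linarith
  have h3 : 2 * x ^ 2 / n ≤ 2 * (n * x ^ 2 * ρ ^ 2 + 1) / (n ^ 2 * ρ ^ 2) := by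
    rw [div_le_div_iff₀ hn0 (by positivity)]
    have : 0 ≤ (n : ℝ) := hn0.le
    nlinarith
  calc r ^ 2 ≤ 2 * x ^ 2 / n * Real.log (1 / (2 * α)) := by
        rw [div_mul_eq_mul_div, le_div_iff₀ hn0]
        linarith
    _ ≤ _ := mul_le_mul h3 h2 h1 (by positivity)

end Margin

/-! ### Asymptotics of the stopping time along a path -/

section StopTime

variable {K : ℕ} {φ : ℕ → Fin K → ℝ} {w : ℕ → Fin K → Fin K → ℝ} {ρ : ℝ}

theorem stopTime_eq_top_or (α : ℝ) (t₀ : ℕ) : stopTime φ w α ρ t₀ = ⊤ ∨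
    ∃ t : ℕ, stopTime φ w α ρ t₀ = t ∧ (confSet φ w α ρ t₀ t).ncard ≤ 1 := by
  classical
  by_cases h : ∃ t, (confSet φ w α ρ t₀ t).ncard ≤ 1
  · refine Or.inr ⟨Nat.find h, le_antisymm (iInf₂_le (Nat.find h) (Nat.find_spec h)) ?_, Nat.find_spec h⟩
    exact le_iInf₂ fun t ht => by exact_mod_cast Nat.find_min' h ht
  · push Not at h
    left
    exact iInf₂_eq_top.2 fun t ht => absurd ht (not_le.2 (h t))

theorem stopTime_le_of_pos {α : ℝ} {t₀ n : ℕ} {a' : Fin K} (hn : 1 ≤ n) (hn' : t₀ ≤ n)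
    (h : ∀ a, a ≠ a' → 0 < lowerBound φ (fun i => w i a) α ρ n) :
    stopTime φ w α ρ t₀ ≤ n := by
  refine iInf₂_le _ ?_
  have hsub : confSet φ w α ρ t₀ n ⊆ {a'} := by
    intro a ha
    by_contra hne
    exact absurd (ha n hn hn' le_rfl) (not_le.2 (h a hne))
  exact (Set.ncard_le_ncard hsub (Set.finite_singleton _)).trans (Set.ncard_singleton _).le

/-- Two arms whose bounds have not yet become positive both remain in the confidence set, which
rules out stopping before `x`. -/
theorem le_stopTime_of_nonpos {α x : ℝ} {t₀ : ℕ} {a a' : Fin K} (hne : a ≠ a')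
    (h : ∀ i : ℕ, 1 ≤ i → t₀ ≤ i → (i : ℝ) < x → lowerBound φ (fun i => w i a) α ρ i ≤ 0 ∧
      lowerBound φ (fun i => w i a') α ρ i ≤ 0) :
    ENNReal.ofReal x ≤ (stopTime φ w α ρ t₀ : ℝ≥0∞) := by
  rcases stopTime_eq_top_or (φ := φ) (w := w) (ρ := ρ) α t₀ with h1 | ⟨t, h1, h2⟩
  · rw [h1]; simp
  · rw [h1]
    by_contra hlt
    have htx : (t : ℝ) < x := by
      rw [not_le] at hlt
      have := (ENNReal.lt_ofReal_iff_toReal_lt (by simp)).1 hlt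
      simpa using this
    have hsub : ({a, a'} : Set (Fin K)) ⊆ confSet φ w α ρ t₀ t := by
      have hi : ∀ i : ℕ, i ≤ t → (i : ℝ) < x := fun i hi =>
        lt_of_le_of_lt (by exact_mod_cast hi) htx
      rintro b (rfl | rfl)
      · exact fun i h3 h4 h5 => (h i h3 h4 (hi i h5)).1
      · exact fun i h3 h4 h5 => (h i h3 h4 (hi i h5)).2
    have := Set.ncard_le_ncard hsub (Set.toFinite _)
    rw [Set.ncard_pair hne] at this
    omega

/-- The asymptotics of the stopping time along a path on which the test processes converge. -/
theorem tendsto_stopTime (hρ : 0 < ρ) {t₀ : ℝ → ℕ} (ht₀ : Tendsto t₀ (𝓝[>] 0) atTop)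
    (ht₀' : Tendsto (fun α => (t₀ α : ℝ) / Real.log (1 / α)) (𝓝[>] 0) (𝓝 0))
    {a' a₀ : Fin K} {ψ S : Fin K → ℝ}
    (hψ : ∀ a, Tendsto (fun t => testProcess φ (fun i => w i a) t) atTop (𝓝 (ψ a)))
    (hS : ∀ a, Tendsto (fun t => testVar φ (fun i => w i a) t) atTop (𝓝 (S a)))
    (hneg : ψ a' < 0) (hpos : ∀ a, a ≠ a' → 0 < ψ a) (hSpos : ∀ a, a ≠ a' → 0 < S a)
    (ha₀ : a₀ ≠ a') {c : ℝ} (hc : ∀ a, a ≠ a' → 2 * S a ≤ c * ψ a ^ 2)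
    (hc₀ : 2 * S a₀ = c * ψ a₀ ^ 2) :
    Tendsto (fun α => (stopTime φ w α ρ (t₀ α) : ℝ≥0∞) / ENNReal.ofReal (Real.log (1 / α)))
      (𝓝[>] 0) (𝓝 (ENNReal.ofReal c)) := by
  have hc0 : 0 < c := by
    have h1 := hSpos a₀ ha₀
    have h2 := pow_pos (hpos a₀ ha₀) 2
    by_contra hle
    nlinarith
  have hLpos := tendsto_log_one_div.eventually_gt_atTop 0
  have hα0 : ∀ᶠ α : ℝ in 𝓝[>] 0, 0 < α := self_mem_nhdsWithin
  have hα1 : ∀ᶠ α : ℝ in 𝓝[>] 0, 2 * α ≤ 1 := by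
    have : ∀ᶠ α : ℝ in 𝓝 0, α < 1 / 2 := gt_mem_nhds (by norm_num)
    filter_upwards [this.filter_mono nhdsWithin_le_nhds] with α hα
    linarith
  refine tendsto_order.2 ⟨fun d hd => ?_, fun d hd => ?_⟩
  · obtain ⟨e, hde, hec⟩ := exists_between hd
    have he_top : e ≠ ∞ := (hec.trans_le le_top).ne
    have he0 : 0 < e.toReal := ENNReal.toReal_pos (zero_le.trans_lt hde).ne' he_top
    have hec' : e.toReal < c := (ENNReal.lt_ofReal_iff_toReal_lt he_top).1 hec
    set c₁ := e.toReal with hc₁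
    -- Since `c₁ < c`, the equality `hc₀` leaves room for errors `δ` in the mean and the variance of
    -- the slowest arm. The factor `1 - δ` pays for the difference `log 2` between `log (1 / α)` and
    -- `log (1 / (2 * α))`.
    have hδ : ∀ᶠ δ : ℝ in 𝓝[>] 0, c₁ * (ψ a₀ + δ) ^ 2 < 2 * (S a₀ - δ) * (1 - δ) ∧ δ < S a₀ ∧
        δ < 1 := by
      refine Filter.Eventually.filter_mono nhdsWithin_le_nhds ?_
      refine Filter.Eventually.and ?_ ((gt_mem_nhds (hSpos a₀ ha₀)).and
        (gt_mem_nhds zero_lt_one))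
      have hcont : Continuous fun δ : ℝ =>
          c₁ * (ψ a₀ + δ) ^ 2 - 2 * (S a₀ - δ) * (1 - δ) := by fun_prop
      have := hcont.tendsto 0
      have hlt : c₁ * (ψ a₀ + 0) ^ 2 - 2 * (S a₀ - 0) * (1 - 0) < 0 := by
        have := mul_lt_mul_of_pos_right hec' (pow_pos (hpos a₀ ha₀) 2)
        simp only [add_zero, sub_zero, mul_one]
        linarith
      filter_upwards [this.eventually (gt_mem_nhds hlt)] with δ hδ
      linarith
    obtain ⟨δ, ⟨hδ1, hδ2, hδ3⟩, hδ0⟩ := (hδ.and self_mem_nhdsWithin).exists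
    have hδ0 : 0 < δ := hδ0
    obtain ⟨N, hN⟩ := eventually_atTop.1 (((hψ a₀).eventually (gt_mem_nhds
      (show ψ a₀ < ψ a₀ + δ by linarith))).and (((hS a₀).eventually (lt_mem_nhds
      (show S a₀ - δ < S a₀ by linarith))).and ((hψ a').eventually (gt_mem_nhds hneg))))
    -- A burn-in of at least `N` ensures that no bound is inspected before the path has settled.
    -- Neither `a₀` nor `a'` can then be rejected before `c₁ * log (1 / α)`.
    filter_upwards [hLpos, hα0, hα1, ht₀.eventually_ge_atTop N,
      tendsto_log_one_div.eventually_ge_atTop (Real.log 2 / δ)] with α h1 h2 h3 h4 h5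
    refine hde.trans_le ?_
    rw [ENNReal.le_div_iff_mul_le (Or.inl (by simpa using h1)) (Or.inl ENNReal.ofReal_ne_top),
      ← ENNReal.ofReal_toReal he_top, ← ENNReal.ofReal_mul ENNReal.toReal_nonneg]
    refine le_stopTime_of_nonpos ha₀ fun i hi1 hi2 hi3 => ?_
    obtain ⟨g1, g2, g3⟩ := hN i (h4.trans hi2)
    refine ⟨?_, ?_⟩
    · unfold lowerBound
      rw [sub_nonpos]
      refine g1.le.trans (le_margin hi1 h2 h3 hρ ?_)
      have hSi : 0 ≤ testVar φ (fun i => w i a₀) i := by linarith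
      rw [Real.sq_sqrt hSi]
      have hlog : Real.log (1 / (2 * α)) = Real.log (1 / α) - Real.log 2 := by
        rw [← Real.log_div (by positivity) (by norm_num)]
        congr 1
        field_simp
      rw [div_le_iff₀ hδ0] at h5
      have h6 : (1 - δ) * Real.log (1 / α) ≤ Real.log (1 / (2 * α)) := by
        rw [hlog]; linarith
      calc (i : ℝ) * (ψ a₀ + δ) ^ 2 ≤ (c₁ * Real.log (1 / α)) * (ψ a₀ + δ) ^ 2 :=
            mul_le_mul_of_nonneg_right hi3.le (sq_nonneg _)
        _ = (c₁ * (ψ a₀ + δ) ^ 2) * Real.log (1 / α) := by ring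
        _ ≤ (2 * (S a₀ - δ) * (1 - δ)) * Real.log (1 / α) :=
            mul_le_mul_of_nonneg_right hδ1.le h1.le
        _ = 2 * (S a₀ - δ) * ((1 - δ) * Real.log (1 / α)) := by ring
        _ ≤ 2 * testVar φ (fun i => w i a₀) i * Real.log (1 / (2 * α)) := by
            refine mul_le_mul (by linarith) h6 ?_ (by linarith)
            exact mul_nonneg (by linarith) h1.le
    · unfold lowerBound
      have : 0 ≤ margin i α ρ √(testVar φ (fun i => w i a') i) := Real.sqrt_nonneg _
      linarith
  · obtain ⟨e, hce, hed⟩ := exists_between hd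
    have he_top : e ≠ ∞ := (hed.trans_le le_top).ne
    have hec' : c < e.toReal := (ENNReal.ofReal_lt_iff_lt_toReal hc0.le he_top).1 hce
    obtain ⟨c₂, hcc₂, hc₂e⟩ := exists_between hec'
    have hc₂0 : 0 < c₂ := hc0.trans hcc₂
    -- Conversely, any constant `c₂ > c` leaves a margin strictly below the mean of every suboptimal
    -- arm. The threshold `N` does not depend on `α`.
    have key : ∀ a, a ≠ a' → ∃ N : ℕ, ∀ n : ℕ, N ≤ n → ∀ α : ℝ, 0 < α → α ≤ 1 →
        c₂ * Real.log (1 / α) ≤ n → 0 < lowerBound φ (fun i => w i a) α ρ n := by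
      intro a ha
      have hδ : ∀ᶠ δ : ℝ in 𝓝[>] 0, 2 * (S a + δ) < c₂ * (ψ a - δ) ^ 2 ∧ δ < ψ a := by
        refine Filter.Eventually.filter_mono nhdsWithin_le_nhds ?_
        refine Filter.Eventually.and ?_ (gt_mem_nhds (hpos a ha))
        have hcont : Continuous fun δ : ℝ => 2 * (S a + δ) - c₂ * (ψ a - δ) ^ 2 := by fun_prop
        have := hcont.tendsto 0
        have hlt : 2 * (S a + 0) - c₂ * (ψ a - 0) ^ 2 < 0 := by
          have := mul_lt_mul_of_pos_right hcc₂ (pow_pos (hpos a ha) 2)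
          have := hc a ha
          simp only [add_zero, sub_zero]
          linarith
        filter_upwards [this.eventually (gt_mem_nhds hlt)] with δ hδ
        linarith
      obtain ⟨δ, ⟨hδ1, hδ2⟩, hδ0⟩ := (hδ.and self_mem_nhdsWithin).exists
      have hδ0 : 0 < δ := hδ0
      have hSa := hSpos a ha
      obtain ⟨n₀, hn₀⟩ := exists_margin_lt (S := S a + δ) (r := ψ a - δ) hρ (by linarith)
        (by linarith) hc₂0 hδ1
      obtain ⟨N, hN⟩ := eventually_atTop.1 (((hψ a).eventually (lt_mem_nhds
        (show ψ a - δ < ψ a by linarith))).and (((hS a).eventually (gt_mem_nhds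
        (show S a < S a + δ by linarith))).and ((hS a).eventually (lt_mem_nhds hSa))))
      refine ⟨max n₀ N, fun n hn α hα hα1 hL => ?_⟩
      obtain ⟨g1, g2, g3⟩ := hN n ((le_max_right _ _).trans hn)
      have := hn₀ n ((le_max_left _ _).trans hn) α hα hα1 hL
        √(testVar φ (fun i => w i a) n) (by rw [Real.sq_sqrt g3.le]; exact g2.le)
      unfold lowerBound
      linarith
    choose! N hN using key
    set N' := ∑ a, N a with hN'
    -- For small `α`, the time `⌈c₂ * log (1 / α)⌉₊` exceeds the burn-in and every threshold. The
    -- gap between `c₂` and `e` absorbs the rounding.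
    filter_upwards [hLpos, hα0, hα1, ht₀'.eventually (gt_mem_nhds hc₂0),
      tendsto_log_one_div.eventually_ge_atTop ((N' + 1) / c₂),
      tendsto_log_one_div.eventually_ge_atTop (1 / (e.toReal - c₂))] with α h1 h2 h3 h4 h5 h6
    refine lt_of_le_of_lt ?_ hed
    rw [div_lt_iff₀ h1] at h4
    rw [div_le_iff₀ hc₂0] at h5
    rw [div_le_iff₀ (by linarith)] at h6
    set n := ⌈c₂ * Real.log (1 / α)⌉₊ with hn
    have hle : c₂ * Real.log (1 / α) ≤ n := Nat.le_ceil _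
    have hlt : (n : ℝ) < c₂ * Real.log (1 / α) + 1 := Nat.ceil_lt_add_one (by positivity)
    have hnN : N' + 1 ≤ n := by
      have : ((N' + 1 : ℕ) : ℝ) ≤ n := by push_cast; linarith
      exact_mod_cast this
    have hst : stopTime φ w α ρ (t₀ α) ≤ n := by
      refine stopTime_le_of_pos (a' := a') (by omega) ?_ fun a ha => ?_
      · have : (t₀ α : ℝ) ≤ n := by linarith
        exact_mod_cast this
      · refine hN a ha n ?_ α h2 (by linarith) hle
        have : N a ≤ N' := Finset.single_le_sum (fun _ _ => Nat.zero_le _) (Finset.mem_univ a)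
        omega
    refine ENNReal.div_le_of_le_mul ?_
    rw [← ENNReal.ofReal_toReal he_top, ← ENNReal.ofReal_mul ENNReal.toReal_nonneg]
    have hst' : (stopTime φ w α ρ (t₀ α) : ℝ≥0∞) ≤ ((n : ℕ∞) : ℝ≥0∞) := by exact_mod_cast hst
    refine hst'.trans ?_
    rw [ENat.toENNReal_coe, ← ENNReal.ofReal_natCast]
    exact ENNReal.ofReal_le_ofReal (by linarith)

end StopTime

/-! ### A deterministic bound on the stopping time, for domination -/

section UniformBound

variable {K : ℕ}

/-- After time `T`, the averages of a path of scores are within `δ` of their conditional means. -/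
structure PathBounds (φ : ℕ → Fin K → ℝ) (w : ℕ → Fin K → Fin K → ℝ) (m : Fin K → ℝ)
    (C : ℕ → Fin K → Fin K → ℝ) (R v δ : ℝ) (T : ℕ) : Prop where
  score : ∀ i b, |φ i b| ≤ R
  mean : ∀ b, |m b| ≤ R
  weight : ∀ i a, w i a ∈ Delta a
  cov : ∀ i u b, u b ^ 2 * v ≤ quad (C i) u
  average_score : ∀ n b, T ≤ n → |∑ i ∈ Finset.range n, (φ i b - m b)| ≤ n * δ
  average_cov : ∀ n b c, T ≤ n →
    |∑ i ∈ Finset.range n, ((φ i b - m b) * (φ i c - m c) - C i b c)| ≤ n * δ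
  average_test : ∀ n a, T ≤ n →
    |∑ i ∈ Finset.range n, (∑ b, w i a b * φ i b - ∑ b, w i a b * m b)| ≤ n * δ

variable {φ : ℕ → Fin K → ℝ} {w : ℕ → Fin K → Fin K → ℝ} {w₀ : Fin K → Fin K → ℝ} {m : Fin K → ℝ}
  {C : ℕ → Fin K → Fin K → ℝ} {R v δ : ℝ} {T : ℕ}

theorem abs_sum_mul_le {u d : Fin K → ℝ} {r : ℝ} (hu : ∀ b, |u b| ≤ 1) (hd : ∀ b, |d b| ≤ r) :
    |∑ b, u b * d b| ≤ K * r := by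
  refine (Finset.abs_sum_le_sum_abs _ _).trans ((Finset.sum_le_sum fun b _ =>
    show |u b * d b| ≤ r from ?_).trans ?_)
  · rw [abs_mul]
    exact (mul_le_mul (hu b) (hd b) (abs_nonneg _) zero_le_one).trans_eq (one_mul r)
  · simp

theorem abs_quad_le {D : Fin K → Fin K → ℝ} {u : Fin K → ℝ} {r : ℝ} (hu : ∀ b, |u b| ≤ 1)
    (hD : ∀ b c, |D b c| ≤ r) : |quad D u| ≤ K ^ 2 * r := by
  have h : quad D u = ∑ b, u b * ∑ c, u c * D b c := by
    unfold quad
    refine Finset.sum_congr rfl fun b _ => ?_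
    rw [Finset.mul_sum]
    exact Finset.sum_congr rfl fun c _ => by ring
  rw [h, sq, mul_assoc]
  exact abs_sum_mul_le hu fun b => abs_sum_mul_le hu (hD b)

theorem PathBounds.bound_nonneg (h : PathBounds φ w m C R v δ T) (a : Fin K) : 0 ≤ R :=
  (abs_nonneg _).trans (h.mean a)

theorem PathBounds.abs_runMean_sub_le (h : PathBounds φ w m C R v δ T) {n : ℕ} (hn : 1 ≤ n)
    (hT : T ≤ n) (b : Fin K) : |runMean φ n b - m b| ≤ δ := by
  have hn0 : (0 : ℝ) < n := by exact_mod_cast hn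
  have h1 := h.average_score n b hT
  have h2 : runMean φ n b - m b = (∑ i ∈ Finset.range n, (φ i b - m b)) / n := by
    unfold runMean
    rw [Finset.sum_sub_distrib, Finset.sum_const, Finset.card_range, nsmul_eq_mul]
    field_simp
  rw [h2, abs_div, abs_of_pos hn0, div_le_iff₀ hn0]
  linarith

/-- From round `T` on, the running means are `δ`-accurate. Before that they are only bounded, which
costs at most `8 * R ^ 2` for each of the first `T` rounds. -/
theorem PathBounds.abs_sum_cov_sub_le (h : PathBounds φ w m C R v δ T) (hδ : 0 ≤ δ) {n : ℕ}
    (hT : T ≤ n) (b c : Fin K) :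
    |∑ i ∈ Finset.range n, ((φ i b - runMean φ (i + 1) b) * (φ i c - runMean φ (i + 1) c) -
      C i b c)| ≤ n * (δ * (1 + 4 * R)) + 8 * R ^ 2 * T := by
  have hR := h.bound_nonneg b
  set e : ℕ → ℝ := fun i => δ + if i < T then 2 * R else 0 with he
  have hx : ∀ i b, |m b - runMean φ (i + 1) b| ≤ e i := by
    intro i b
    by_cases hi : i < T
    · have h1 := (abs_sub (m b) (runMean φ (i + 1) b)).trans
        (add_le_add (h.mean b) (abs_runMean_le h.score hR (i + 1) b))
      simp only [he, hi, if_true]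
      linarith
    · rw [abs_sub_comm]
      simp only [he, hi, if_false, add_zero]
      exact h.abs_runMean_sub_le (by omega) (by omega) b
  have hdiff : ∀ i, |(φ i b - runMean φ (i + 1) b) * (φ i c - runMean φ (i + 1) c) -
      (φ i b - m b) * (φ i c - m c)| ≤ 4 * R * e i := by
    intro i
    have e1 : (φ i b - runMean φ (i + 1) b) * (φ i c - runMean φ (i + 1) c) -
        (φ i b - m b) * (φ i c - m c) = (m b - runMean φ (i + 1) b) *
          (φ i c - runMean φ (i + 1) c) + (m c - runMean φ (i + 1) c) * (φ i b - m b) := by ring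
    rw [e1]
    have h0 : 0 ≤ e i := (abs_nonneg _).trans (hx i b)
    have h1 : |(m b - runMean φ (i + 1) b) * (φ i c - runMean φ (i + 1) c)| ≤ e i * (2 * R) := by
      rw [abs_mul]
      exact mul_le_mul (hx i b) (abs_sub_runMean_le h.score hR _ _ _) (abs_nonneg _) h0
    have h2 : |(m c - runMean φ (i + 1) c) * (φ i b - m b)| ≤ e i * (R + R) := by
      rw [abs_mul]
      exact mul_le_mul (hx i c) ((abs_sub _ _).trans (add_le_add (h.score i b) (h.mean b)))
        (abs_nonneg _) h0
    refine (abs_add_le _ _).trans ((add_le_add h1 h2).trans_eq ?_)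
    ring
  have hsum_e : ∑ i ∈ Finset.range n, e i = n * δ + T * (2 * R) := by
    simp only [he, Finset.sum_add_distrib, Finset.sum_const, Finset.card_range, nsmul_eq_mul]
    congr 1
    rw [← Finset.sum_filter, Finset.sum_const, nsmul_eq_mul]
    congr 2
    have : (Finset.range n).filter (fun i => i < T) = Finset.range T := by
      ext i
      simp only [Finset.mem_filter, Finset.mem_range]
      omega
    rw [this, Finset.card_range]
  have hsplit : ∑ i ∈ Finset.range n, ((φ i b - runMean φ (i + 1) b) *
      (φ i c - runMean φ (i + 1) c) - C i b c) =
      ∑ i ∈ Finset.range n, ((φ i b - runMean φ (i + 1) b) * (φ i c - runMean φ (i + 1) c) -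
        (φ i b - m b) * (φ i c - m c)) +
      ∑ i ∈ Finset.range n, ((φ i b - m b) * (φ i c - m c) - C i b c) := by
    rw [← Finset.sum_add_distrib]
    exact Finset.sum_congr rfl fun i _ => by ring
  rw [hsplit]
  have h3 := (Finset.abs_sum_le_sum_abs _ _).trans
    (Finset.sum_le_sum fun i (_ : i ∈ Finset.range n) => hdiff i)
  rw [← Finset.mul_sum, hsum_e] at h3
  refine (abs_add_le _ _).trans ((add_le_add h3 (h.average_cov n b c hT)).trans_eq ?_)
  ring

/-- Conditional variances contribute at least `n * v`. Beyond time `N * T` the early rounds are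
diluted, so fluctuations and early errors each consume at most `n * v / 4`. -/
theorem PathBounds.le_fixedVar (h : PathBounds φ w m C R v δ T) (hδ : 0 ≤ δ) {N : ℕ}
    (hδv : K ^ 2 * (δ * (1 + 4 * R)) ≤ v / 4) (hN : K ^ 2 * (8 * R ^ 2) ≤ N * (v / 4))
    {n : ℕ} (hn : 1 ≤ n) (hT : T ≤ n) (hNT : N * T ≤ n) (hv : 0 < v) {u : Fin K → ℝ} {b : Fin K}
    (hu : ∀ b, |u b| ≤ 1) (hub : u b ^ 2 = 1) : v / 2 ≤ fixedVar φ n u := by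
  have hn0 : (0 : ℝ) < n := by exact_mod_cast hn
  set D : Fin K → Fin K → ℝ := fun b c => ∑ i ∈ Finset.range n,
    ((φ i b - runMean φ (i + 1) b) * (φ i c - runMean φ (i + 1) c) - C i b c) with hD
  have h1 : n * fixedVar φ n u = ∑ i ∈ Finset.range n, quad (C i) u + quad D u := by
    have h2 : quad D u = ∑ i ∈ Finset.range n, quad (fun b c =>
        (φ i b - runMean φ (i + 1) b) * (φ i c - runMean φ (i + 1) c) - C i b c) u := by
      simp only [hD, quad, Finset.mul_sum]
      rw [Finset.sum_comm]
      conv_rhs => rw [Finset.sum_comm]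
      rw [Finset.sum_comm]
      exact Finset.sum_congr rfl fun b _ => Finset.sum_comm
    rw [h2, ← Finset.sum_add_distrib]
    unfold fixedVar
    rw [mul_div_cancel₀ _ hn0.ne']
    refine Finset.sum_congr rfl fun i _ => ?_
    rw [sq_sum_eq_quad]
    simp only [quad, ← Finset.sum_add_distrib]
    exact Finset.sum_congr rfl fun b _ => Finset.sum_congr rfl fun c _ => by ring
  have h2 : (n : ℝ) * v ≤ ∑ i ∈ Finset.range n, quad (C i) u := by
    have : ∑ _i ∈ Finset.range n, v ≤ ∑ i ∈ Finset.range n, quad (C i) u :=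
      Finset.sum_le_sum fun i _ => by
        have := h.cov i u b
        rwa [hub, one_mul] at this
    simpa using this
  have h3 := (abs_le.1 (abs_quad_le hu fun b c => h.abs_sum_cov_sub_le hδ hT b c)).1
  have h4 : (N : ℝ) * T ≤ n := by exact_mod_cast hNT
  have hTr : (0 : ℝ) ≤ T := Nat.cast_nonneg _
  have h5 : K ^ 2 * (n * (δ * (1 + 4 * R)) + 8 * R ^ 2 * T) ≤ n * (v / 2) := by
    have h6 := mul_le_mul_of_nonneg_left hδv hn0.le
    have h7 := mul_le_mul_of_nonneg_right hN hTr
    have h8 := mul_le_mul_of_nonneg_right h4 (show 0 ≤ v / 4 by linarith)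
    nlinarith
  have h6 : (n : ℝ) * (v / 2) ≤ n * fixedVar φ n u := by
    rw [h1]
    linarith
  exact le_of_mul_le_mul_left h6 hn0

theorem fixedVar_contrast_le (hφ : ∀ i b, |φ i b| ≤ R) (hR : 0 ≤ R) (n : ℕ) {a b : Fin K}
    (hab : b ≠ a) : fixedVar φ n (contrast a b) ≤ (4 * R) ^ 2 := by
  unfold fixedVar
  refine div_le_of_le_mul₀ (Nat.cast_nonneg _) (sq_nonneg _) ?_
  have : ∀ i ∈ Finset.range n,
      (∑ c, contrast a b c * (φ i c - runMean φ (i + 1) c)) ^ 2 ≤ (4 * R) ^ 2 := by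
    intro i _
    rw [sum_contrast_mul hab, ← sq_abs]
    refine pow_le_pow_left₀ (abs_nonneg _) ((abs_sub _ _).trans ?_) 2
    have h1 := abs_sub_runMean_le hφ hR (i + 1) i b
    have h2 := abs_sub_runMean_le hφ hR (i + 1) i a
    linarith
  refine (Finset.sum_le_sum this).trans_eq ?_
  rw [Finset.sum_const, Finset.card_range, nsmul_eq_mul, mul_comm]

theorem testVar_le (hφ : ∀ i b, |φ i b| ≤ R) (hR : 0 ≤ R) (n : ℕ) {u : ℕ → Fin K → ℝ}
    (hu : ∀ i b, |u i b| ≤ 1) : testVar φ u n ≤ (K * (2 * R)) ^ 2 := by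
  unfold testVar
  refine div_le_of_le_mul₀ (Nat.cast_nonneg _) (sq_nonneg _) ?_
  have : ∀ i ∈ Finset.range n,
      (∑ b, u i b * (φ i b - runMean φ (i + 1) b)) ^ 2 ≤ (K * (2 * R)) ^ 2 := by
    intro i _
    rw [← sq_abs]
    exact pow_le_pow_left₀ (abs_nonneg _) (abs_sum_mul_le (hu i)
      fun b => abs_sub_runMean_le hφ hR (i + 1) i b) 2
  refine (Finset.sum_le_sum this).trans_eq ?_
  rw [Finset.sum_const, Finset.card_range, nsmul_eq_mul, mul_comm]

/-- The weights chosen by the algorithm separate the means uniformly. -/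
theorem PathBounds.le_sum_weight_mul_mean (h : PathBounds φ w m C R v δ T)
    (hw : IsSNRWeights φ w₀ w) {a a' : Fin K} {gap η : ℝ} (hgap : gap ≤ m a' - m a)
    (hR : 0 < R) (hv : 0 < v) (hδ : 0 ≤ δ) (hδgap : δ ≤ gap / 4) (hgap0 : 0 < gap)
    (hη : 2 * η ≤ gap / (8 * R) * √(v / 2)) (hδη : K * δ ≤ η) {N : ℕ}
    (hδv : K ^ 2 * (δ * (1 + 4 * R)) ≤ v / 4) (hN : K ^ 2 * (8 * R ^ 2) ≤ N * (v / 4))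
    {n : ℕ} (hn : 1 ≤ n) (hT : T ≤ n) (hNT : N * T ≤ n) :
    η ≤ ∑ b, w n a b * m b := by
  have hne : a' ≠ a := by
    rintro rfl
    linarith
  have hfix : ∀ {u : Fin K → ℝ} {b : Fin K}, (∀ b, |u b| ≤ 1) → u b ^ 2 = 1 →
      v / 2 ≤ fixedVar φ n u := fun hu hub => h.le_fixedVar hδ hδv hN hn hT hNT hv hu hub
  have hfixΔ : ∀ u ∈ Delta a, v / 2 ≤ fixedVar φ n u := fun u hu =>
    hfix (b := a) (abs_le_one_of_mem_Delta hu) (by rw [hu.1]; norm_num)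
  have hm1 := abs_le.1 (h.abs_runMean_sub_le hn hT a)
  have hm2 := abs_le.1 (h.abs_runMean_sub_le hn hT a')
  obtain ⟨-, hmax, -⟩ := hw n a
  have hmax := hmax ⟨⟨a', by linarith⟩, fun b => by
    have := hfix (u := Pi.single b 1) (b := b) (fun c => by
      by_cases hc : c = b
      · subst hc; simp
      · simp [hc]) (by simp)
    rw [fixedVar_eq_quad, quad_single, ← armVar_eq_empCov] at this
    linarith⟩ fun u hu => by linarith [hfixΔ u hu]
  have hle : empSNR φ n (contrast a a') ≤ empSNR φ n (w n a) := hmax (contrast_mem_Delta hne)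
  have hcpos := hfixΔ _ (contrast_mem_Delta hne)
  -- The contrast with the better arm is a competitor in the maximization: its empirical mean is at
  -- least `gap - 2 * δ ≥ gap / 2`, and its standard deviation is at most `4 * R`.
  have hc : gap / (8 * R) ≤ empSNR φ n (contrast a a') := by
    unfold empSNR
    rw [sum_contrast_mul hne, le_div_iff₀ (Real.sqrt_pos.2 (by linarith))]
    have h1 : √(fixedVar φ n (contrast a a')) ≤ 4 * R := by
      rw [Real.sqrt_le_left (by positivity)]
      exact fixedVar_contrast_le h.score hR.le n hne
    calc gap / (8 * R) * √(fixedVar φ n (contrast a a')) ≤ gap / (8 * R) * (4 * R) :=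
          mul_le_mul_of_nonneg_left h1 (by positivity)
      _ = gap / 2 := by field_simp; norm_num
      _ ≤ _ := by linarith
  have hwfix := hfixΔ _ (h.weight n a)
  have h2 := hc.trans hle
  unfold empSNR at h2
  rw [le_div_iff₀ (Real.sqrt_pos.2 (by linarith))] at h2
  -- The variance lower bound turns the SNR bound into an empirical mean of at least `2 * η`.
  -- Replacing empirical by true means costs at most `K * δ ≤ η`.
  have h3 : gap / (8 * R) * √(v / 2) ≤ gap / (8 * R) * √(fixedVar φ n (w n a)) :=
    mul_le_mul_of_nonneg_left (Real.sqrt_le_sqrt hwfix) (by positivity)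
  have h4 := (abs_le.1 (abs_sum_mul_le (abs_le_one_of_mem_Delta (h.weight n a))
    fun b => h.abs_runMean_sub_le hn hT b)).2
  have h5 : ∑ b, w n a b * (runMean φ n b - m b) =
      ∑ b, w n a b * runMean φ n b - ∑ b, w n a b * m b := by
    rw [← Finset.sum_sub_distrib]
    exact Finset.sum_congr rfl fun b _ => by ring
  rw [h5] at h4
  linarith

/-- A uniform lower bound on the test processes of suboptimal arms. -/
theorem PathBounds.le_testProcess (h : PathBounds φ w m C R v δ T)
    (hw : IsSNRWeights φ w₀ w) {a a' : Fin K} {gap η : ℝ} (hgap : gap ≤ m a' - m a)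
    (hR : 0 < R) (hv : 0 < v) (hδ : 0 ≤ δ) (hδgap : δ ≤ gap / 4) (hgap0 : 0 < gap) (hη0 : 0 < η)
    (hη : 2 * η ≤ gap / (8 * R) * √(v / 2)) (hδη : K * δ ≤ η) (hδη' : δ ≤ η / 4) {N N' : ℕ}
    (hδv : K ^ 2 * (δ * (1 + 4 * R)) ≤ v / 4) (hN : K ^ 2 * (8 * R ^ 2) ≤ N * (v / 4))
    (hN1 : 1 ≤ N) (hN' : N * (η + K * R) ≤ N' * (η / 4)) {n : ℕ} (hn : 1 ≤ n) (hT : T + 1 ≤ n)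
    (hNT : N' * (T + 1) ≤ n) : η / 2 ≤ testProcess φ (fun i => w i a) n := by
  have hn0 : (0 : ℝ) < n := by exact_mod_cast hn
  have hKR : 0 ≤ K * R := by positivity
  -- Before `N * (T + 1)` the weights are uncontrolled and the drift is only at least `-K * R`; the
  -- multiple `N'` dilutes this deficit to `η / 4` per round. Using `T + 1` keeps the controlled
  -- rounds at index at least `1` even if `T = 0`.
  have h1 : ∀ i, η - (if i < N * (T + 1) then η + K * R else 0) ≤ ∑ b, w i a b * m b := by
    intro i
    by_cases hi : i < N * (T + 1)
    · simp only [hi, if_true]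
      have := (abs_le.1 (abs_sum_mul_le (abs_le_one_of_mem_Delta (h.weight i a)) h.mean)).1
      linarith
    · simp only [hi, if_false, sub_zero]
      have hle : T + 1 ≤ N * (T + 1) := Nat.le_mul_of_pos_left _ hN1
      have hle' : N * T ≤ N * (T + 1) := Nat.mul_le_mul_left _ (Nat.le_succ T)
      exact h.le_sum_weight_mul_mean hw hgap hR hv hδ hδgap hgap0 hη hδη hδv hN
        (by omega) (by omega) (by omega)
  have h2 := Finset.sum_le_sum fun i (_ : i ∈ Finset.range n) => h1 i
  have h3 : ∑ i ∈ Finset.range n, (if i < N * (T + 1) then η + K * R else 0) ≤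
      (N * (T + 1) : ℕ) * (η + K * R) := by
    rw [← Finset.sum_filter, Finset.sum_const, nsmul_eq_mul]
    refine mul_le_mul_of_nonneg_right ?_ (by positivity)
    have : ((Finset.range n).filter (fun i => i < N * (T + 1))).card ≤ N * (T + 1) := by
      refine (Finset.card_le_card (t := Finset.range (N * (T + 1))) ?_).trans_eq
        (Finset.card_range _)
      intro i
      simp only [Finset.mem_filter, Finset.mem_range]
      omega
    exact_mod_cast this
  rw [Finset.sum_sub_distrib, Finset.sum_const, Finset.card_range, nsmul_eq_mul] at h2
  have h4 := (abs_le.1 (h.average_test n a (by omega))).1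
  rw [Finset.sum_sub_distrib] at h4
  have h5 : (N' : ℝ) * (T + 1) ≤ n := by exact_mod_cast hNT
  have h6 := mul_le_mul_of_nonneg_right hN' (show (0 : ℝ) ≤ T + 1 by positivity)
  have h7 := mul_le_mul_of_nonneg_right h5 (show 0 ≤ η / 4 by linarith)
  have h8 := mul_le_mul_of_nonneg_left hδη' hn0.le
  push_cast at h3
  unfold testProcess
  rw [le_div_iff₀ hn0]
  nlinarith

/-- The stopping time is at most a multiple of `log (1 / α)` plus a multiple of the time after which
all averages are close to their means. -/
theorem exists_stopTime_le {m : Fin K → ℝ} {a' : Fin K} (hopt : ∀ b, b ≠ a' → m b < m a') {R v ρ : ℝ}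
    (hR : 0 < R) (hv : 0 < v) (hρ : 0 < ρ) :
    ∃ δ > 0, ∃ M : ℕ, ∀ (φ : ℕ → Fin K → ℝ) (w : ℕ → Fin K → Fin K → ℝ) (w₀ : Fin K → Fin K → ℝ)
      (C : ℕ → Fin K → Fin K → ℝ) (T : ℕ), PathBounds φ w m C R v δ T → IsSNRWeights φ w₀ w →
      ∀ (α : ℝ) (t₀ : ℕ), 0 < α → 1 ≤ Real.log (1 / α) →
        (stopTime φ w α ρ t₀ : ℝ≥0∞) ≤ t₀ + M * ENNReal.ofReal (Real.log (1 / α)) + M * T := by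
  obtain ⟨gap, hgap0, hgap⟩ : ∃ gap > 0, ∀ b, b ≠ a' → gap ≤ m a' - m b := by
    have hsm : ∀ᶠ x : ℝ in 𝓝[>] 0, ∀ b, b ≠ a' → x ≤ m a' - m b := by
      refine eventually_all.2 fun b => ?_
      by_cases hb : b = a'
      · exact Eventually.of_forall fun x h => absurd hb h
      · filter_upwards [(ge_mem_nhds (sub_pos.2 (hopt b hb)) :
          ∀ᶠ x : ℝ in 𝓝 0, _).filter_mono nhdsWithin_le_nhds] with x hx _ using hx
    obtain ⟨x, hx, hx0⟩ := (hsm.and self_mem_nhdsWithin).exists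
    exact ⟨x, hx0, hx⟩
  set η := gap / (8 * R) * √(v / 2) / 2 with hη
  have hη0 : 0 < η := by
    have : 0 < √(v / 2) := Real.sqrt_pos.2 (by linarith)
    positivity
  obtain ⟨δ, ⟨h1, h2, h3, h4⟩, hδ0⟩ : ∃ δ : ℝ, (δ ≤ gap / 4 ∧ K * δ ≤ η ∧ δ ≤ η / 4 ∧
      K ^ 2 * (δ * (1 + 4 * R)) ≤ v / 4) ∧ 0 < δ := by
    have hsm : ∀ (r x : ℝ), 0 < x → ∀ᶠ δ : ℝ in 𝓝[>] 0, r * δ ≤ x := by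
      intro r x hx
      have hc : Tendsto (fun δ : ℝ => r * δ) (𝓝 0) (𝓝 (r * 0)) :=
        (continuous_const.mul continuous_id).tendsto 0
      rw [mul_zero] at hc
      exact (hc.eventually (ge_mem_nhds hx)).filter_mono nhdsWithin_le_nhds
    have hall := (hsm 1 (gap / 4) (by positivity)).and ((hsm K η hη0).and
      ((hsm 1 (η / 4) (by positivity)).and (hsm (K ^ 2 * (1 + 4 * R)) (v / 4) (by positivity))))
    obtain ⟨δ, ⟨g1, g2, g3, g4⟩, g0⟩ := (hall.and self_mem_nhdsWithin).exists
    exact ⟨δ, ⟨by linarith, g2, by linarith, by linarith⟩, g0⟩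
  obtain ⟨N₁, hN₁⟩ := exists_nat_ge (K ^ 2 * (8 * R ^ 2) / (v / 4))
  rw [div_le_iff₀ (by positivity)] at hN₁
  set N := N₁ + 1 with hNdef
  have hN : K ^ 2 * (8 * R ^ 2) ≤ N * (v / 4) := by
    rw [hNdef]; push_cast; linarith
  obtain ⟨N', hN'⟩ := exists_nat_ge (N * (η + K * R) / (η / 4))
  rw [div_le_iff₀ (by positivity)] at hN'
  set S := ((K : ℝ) * (2 * R)) ^ 2 with hS
  have hS0 : 0 ≤ S := sq_nonneg _
  -- `S` is a worst-case variance and `η / 2` a worst-case drift, so `c` is not sharp. It is used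
  -- only for domination.
  set c := 2 * S / (η / 2) ^ 2 + 1 with hc
  have hc0 : 0 < c := by positivity
  obtain ⟨n₀, hn₀⟩ := exists_margin_lt (S := S) (r := η / 2) (c := c) hρ (by positivity) hS0 hc0 (by
    rw [hc, add_mul, div_mul_cancel₀ _ (by positivity)]
    have : 0 < (η / 2) ^ 2 := by positivity
    linarith)
  obtain ⟨c', hc'⟩ := exists_nat_ge c
  refine ⟨δ, hδ0, c' + n₀ + N' + 3, fun φ w w₀ C T hp hw α t₀ hα hL => ?_⟩
  have hα1 : α ≤ 1 := by
    by_contra hlt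
    have : Real.log (1 / α) ≤ 0 := Real.log_nonpos (by positivity) (by
      rw [div_le_iff₀ hα]; linarith)
    linarith
  -- The sum meets all requirements at once: burn-in, small margin, and a test process above `η /
  -- 2`. Its constant terms are later absorbed using `1 ≤ log (1 / α)`.
  set n := t₀ + ⌈c * Real.log (1 / α)⌉₊ + n₀ + N' * (T + 1) + (T + 1) with hn
  have hceil : c * Real.log (1 / α) ≤ ⌈c * Real.log (1 / α)⌉₊ := Nat.le_ceil _
  have hceil' := Nat.ceil_lt_add_one (show 0 ≤ c * Real.log (1 / α) by positivity)
  have hcn : c * Real.log (1 / α) ≤ n := by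
    refine hceil.trans ?_
    exact_mod_cast (by omega : ⌈c * Real.log (1 / α)⌉₊ ≤ n)
  have hst : stopTime φ w α ρ t₀ ≤ n := by
    refine stopTime_le_of_pos (a' := a') (by omega) (by omega) fun a ha => ?_
    have ht := hp.le_testProcess hw (hgap a ha) hR hv hδ0.le h1 hgap0 hη0 (by rw [hη]; linarith)
      h2 h3 h4 hN (by omega) hN' (n := n) (by omega) (by omega) (by omega)
    have hvar : testVar φ (fun i => w i a) n ≤ S :=
      testVar_le hp.score hR.le n fun i b => abs_le_one_of_mem_Delta (hp.weight i a) b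
    have hvar0 : 0 ≤ testVar φ (fun i => w i a) n :=
      div_nonneg (Finset.sum_nonneg fun _ _ => sq_nonneg _) (Nat.cast_nonneg _)
    have := hn₀ n (by omega) α hα hα1 hcn √(testVar φ (fun i => w i a) n)
      (by rwa [Real.sq_sqrt hvar0])
    unfold lowerBound
    linarith
  have hst' : (stopTime φ w α ρ t₀ : ℝ≥0∞) ≤ ((n : ℕ∞) : ℝ≥0∞) := by exact_mod_cast hst
  refine hst'.trans ?_
  set M := c' + n₀ + N' + 3 with hM
  have hreal : (n : ℝ) ≤ t₀ + M * Real.log (1 / α) + M * T := by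
    rw [hn, hM]
    push_cast
    have hL0 : 0 ≤ Real.log (1 / α) := by linarith
    have g1 : c * Real.log (1 / α) ≤ c' * Real.log (1 / α) := mul_le_mul_of_nonneg_right hc' hL0
    have g2 : (n₀ + N' + 3 : ℝ) * 1 ≤ (n₀ + N' + 3) * Real.log (1 / α) :=
      mul_le_mul_of_nonneg_left hL (by positivity)
    have g3 : (0 : ℝ) ≤ (c' + n₀ + 2) * T := by positivity
    nlinarith
  rw [ENat.toENNReal_coe, ← ENNReal.ofReal_natCast]
  refine (ENNReal.ofReal_le_ofReal hreal).trans_eq ?_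
  have hL0 : 0 ≤ Real.log (1 / α) := by linarith
  rw [ENNReal.ofReal_add (by positivity) (by positivity), ENNReal.ofReal_add (by positivity)
    (by positivity), ENNReal.ofReal_mul (by positivity), ENNReal.ofReal_mul (by positivity)]
  simp only [ENNReal.ofReal_natCast]

end UniformBound

/-! ### Convergence of the weights chosen by the algorithm -/

section Weights

variable {K : ℕ}

theorem snr_pos_of_isMaxOn {C : Fin K → Fin K → ℝ} {m u : Fin K → ℝ} {a a' : Fin K}
    (hC : ∀ w, w ≠ 0 → 0 < quad C w) (ha : m a < m a') (hmax : IsMaxOn (snr C m) (Delta a) u) :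
    0 < snr C m u := by
  have hne : a' ≠ a := by rintro rfl; exact lt_irrefl _ ha
  refine lt_of_lt_of_le ?_ (hmax (contrast_mem_Delta hne))
  unfold snr
  rw [sum_contrast_mul hne]
  exact div_pos (sub_pos.2 ha)
    (Real.sqrt_pos.2 (hC _ (ne_zero_of_mem_Delta (contrast_mem_Delta hne))))

/-- A convex combination of smaller means lies below the best mean. This gives the optimal arm's
test process a negative limit, so it is not rejected late. -/
theorem sum_mul_neg_of_mem_Delta {m u : Fin K → ℝ} {a' : Fin K} (hu : u ∈ Delta a')
    (hopt : ∀ b, b ≠ a' → m b < m a') : ∑ b, u b * m b < 0 := by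
  obtain ⟨h1, h2, h3⟩ := hu
  rw [← Finset.add_sum_erase _ _ (Finset.mem_univ a'), h1]
  have hlt : ∑ b ∈ Finset.univ.erase a', u b * m b < ∑ b ∈ Finset.univ.erase a', u b * m a' := by
    refine Finset.sum_lt_sum (fun b hb => mul_le_mul_of_nonneg_left
      (hopt b (Finset.ne_of_mem_erase hb)).le (h2 b (Finset.ne_of_mem_erase hb))) ?_
    obtain ⟨b, hb, hb0⟩ := Finset.exists_ne_zero_of_sum_ne_zero
      (s := Finset.univ.erase a') (f := u) (by rw [h3]; norm_num)
    have hne := Finset.ne_of_mem_erase hb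
    exact ⟨b, hb, mul_lt_mul_of_pos_left (hopt b hne) (lt_of_le_of_ne (h2 b hne) hb0.symm)⟩
  rw [← Finset.sum_mul, h3] at hlt
  linarith

theorem exists_ne_of_mem_Delta {u : Fin K → ℝ} {a' : Fin K} (hu : u ∈ Delta a') :
    ∃ a, a ≠ a' := by
  obtain ⟨b, hb, -⟩ := Finset.exists_ne_zero_of_sum_ne_zero
    (s := Finset.univ.erase a') (f := u) (by rw [hu.2.2]; norm_num)
  exact ⟨b, Finset.ne_of_mem_erase hb⟩

/-- Entries of `Delta a` are bounded by `1`, so entrywise convergence of the matrices is uniform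
over it. Positivity on all of `Delta a` is needed because the rule prescribes a maximizer only in
that case. -/
theorem eventually_forall_quad_pos {C : ℕ → Fin K → Fin K → ℝ} {C' : Fin K → Fin K → ℝ} {v : ℝ}
    (hv : 0 < v) (hC : ∀ b c, Tendsto (fun n => C n b c) atTop (𝓝 (C' b c)))
    (hle : ∀ u b, u b ^ 2 * v ≤ quad C' u) :
    ∀ᶠ n in atTop, ∀ a, ∀ u ∈ Delta a, 0 < quad (C n) u := by
  set ε := v / (2 * (K ^ 2 + 1)) with hε
  have hε0 : 0 < ε := by positivity
  have h1 : ∀ᶠ n in atTop, ∀ b c, |C n b c - C' b c| ≤ ε := by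
    refine eventually_all.2 fun b => eventually_all.2 fun c => ?_
    have := ((hC b c).sub_const (C' b c)).abs
    rw [sub_self, abs_zero] at this
    exact this.eventually (ge_mem_nhds hε0)
  filter_upwards [h1] with n hn a u hu
  have h2 := (abs_le.1 (abs_quad_le (abs_le_one_of_mem_Delta hu) hn)).1
  have h3 : quad (fun b c => C n b c - C' b c) u = quad (C n) u - quad C' u := by
    unfold quad
    simp only [← Finset.sum_sub_distrib]
    exact Finset.sum_congr rfl fun b _ => Finset.sum_congr rfl fun c _ => by ring
  have h4 := hle u a
  rw [hu.1] at h4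
  have h5 : K ^ 2 * ε < v := by
    rw [hε, mul_div_assoc', div_lt_iff₀ (by positivity)]
    nlinarith [sq_nonneg (K : ℝ)]
  rw [h3] at h2
  linarith

variable {φ : ℕ → Fin K → ℝ} {w : ℕ → Fin K → Fin K → ℝ} {w₀ : Fin K → Fin K → ℝ} {m : Fin K → ℝ}
  {C' : Fin K → Fin K → ℝ} {v : ℝ}

theorem tendsto_weights (hw : IsSNRWeights φ w₀ w) (hv : 0 < v)
    (hm : ∀ b, Tendsto (fun t => runMean φ t b) atTop (𝓝 (m b)))
    (hC : ∀ b c, Tendsto (fun t => empCov φ t b c) atTop (𝓝 (C' b c)))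
    (hle : ∀ u b, u b ^ 2 * v ≤ quad C' u) (hpos : ∀ u, u ≠ 0 → 0 < quad C' u)
    {a a' : Fin K} (ha : m a < m a') {u : Fin K → ℝ}
    (hu : ∀ x, (x ∈ Delta a ∧ IsMaxOn (snr C' m) (Delta a) x) → x = u) :
    Tendsto (fun n => w n a) atTop (𝓝 u) := by
  refine tendsto_of_isMaxOn_snr hC hm hpos (fun n => (hw n a).1) ?_ hu
  have h2 : ∀ᶠ n in atTop, ∀ b, 0 < armVar φ n b := by
    refine eventually_all.2 fun b => ?_
    simp only [armVar_eq_empCov]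
    refine (hC b b).eventually (lt_mem_nhds ?_)
    have := hle (Pi.single b 1) b
    rw [quad_single] at this
    simp only [Pi.single_eq_same, one_pow, one_mul] at this
    linarith
  filter_upwards [(hm a).eventually_lt (hm a') ha, h2, eventually_forall_quad_pos hv hC hle]
    with n h3 h4 h5
  rw [← empSNR_eq_snr]
  refine (hw n a).2.1 ⟨⟨a', h3⟩, h4⟩ fun x hx => ?_
  rw [fixedVar_eq_quad]
  exact h5 a x hx

/-- The optimal arm is eventually an empirical maximizer, so its weights are eventually constant. -/
theorem tendsto_weights_default (hw : IsSNRWeights φ w₀ w)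
    (hm : ∀ b, Tendsto (fun t => runMean φ t b) atTop (𝓝 (m b))) {a' : Fin K}
    (hopt : ∀ b, b ≠ a' → m b < m a') : Tendsto (fun n => w n a') atTop (𝓝 (w₀ a')) := by
  have h1 : ∀ᶠ n in atTop, ∀ b, runMean φ n b ≤ runMean φ n a' := by
    refine eventually_all.2 fun b => ?_
    by_cases hb : b = a'
    · exact Eventually.of_forall fun n => by rw [hb]
    · exact ((hm b).eventually_lt (hm a') (hopt b hb)).mono fun n hn => hn.le
  refine tendsto_const_nhds.congr' ?_
  filter_upwards [h1] with n hn
  refine ((hw n a').2.2 ?_).symm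
  rintro ⟨⟨b, hb⟩, -⟩
  exact absurd hb (not_lt.2 (hn b))

end Weights

/-! ### Measurability of the stopping time -/

section Measurability

variable {Ω : Type*} [MeasurableSpace Ω] {K : ℕ} {φ : Ω → ℕ → Fin K → ℝ}
  {w : Ω → ℕ → Fin K → Fin K → ℝ}

theorem stopTime_toENNReal (φ : ℕ → Fin K → ℝ) (w : ℕ → Fin K → Fin K → ℝ) (α ρ : ℝ) (t₀ : ℕ)
    [∀ t, Decidable ((confSet φ w α ρ t₀ t).ncard ≤ 1)] :
    (stopTime φ w α ρ t₀ : ℝ≥0∞) =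
      ⨅ t : ℕ, if (confSet φ w α ρ t₀ t).ncard ≤ 1 then (t : ℝ≥0∞) else ∞ := by
  refine le_antisymm (le_iInf fun t => ?_) ?_
  · split_ifs with h
    · have h1 : stopTime φ w α ρ t₀ ≤ t := iInf₂_le t h
      have h2 : (stopTime φ w α ρ t₀ : ℝ≥0∞) ≤ ((t : ℕ∞) : ℝ≥0∞) := by exact_mod_cast h1
      simpa using h2
    · exact le_top
  · rcases stopTime_eq_top_or (φ := φ) (w := w) (ρ := ρ) α t₀ with h1 | ⟨t, h1, h2⟩
    · rw [h1]; simp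
    · rw [h1]
      refine (iInf_le _ t).trans ?_
      simp [h2]

theorem measurable_stopTime (hφ : ∀ n b, Measurable fun ω => φ ω n b)
    (hw : ∀ n a b, Measurable fun ω => w ω n a b) (α ρ : ℝ) (t₀ : ℕ) :
    Measurable fun ω => (stopTime (φ ω) (w ω) α ρ t₀ : ℝ≥0∞) := by
  classical
  have hrun : ∀ t b, Measurable fun ω => runMean (φ ω) t b := fun t b =>
    (Finset.measurable_sum _ fun i _ => hφ i b).div_const _
  have hlow : ∀ a t, Measurable fun ω => lowerBound (φ ω) (fun i => w ω i a) α ρ t := by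
    intro a t
    have h1 : Measurable fun ω => testProcess (φ ω) (fun i => w ω i a) t :=
      (Finset.measurable_sum _ fun i _ => Finset.measurable_sum _ fun b _ =>
        (hw i a b).mul (hφ i b)).div_const _
    have h2 : Measurable fun ω => testVar (φ ω) (fun i => w ω i a) t :=
      (Finset.measurable_sum _ fun i _ => (Finset.measurable_sum _ fun b _ =>
        (hw i a b).mul ((hφ i b).sub (hrun (i + 1) b))).pow_const 2).div_const _
    have h3 : Measurable fun x => margin t α ρ x := by
      unfold margin
      fun_prop
    exact h1.sub (h3.comp h2.sqrt)
  have hmem : ∀ a t, Measurable fun ω => a ∈ confSet (φ ω) (w ω) α ρ t₀ t := by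
    intro a t
    refine Measurable.forall fun i => Measurable.imp measurable_const (Measurable.imp
      measurable_const (Measurable.imp measurable_const ?_))
    exact measurableSet_setOfPred.1 (measurableSet_le (hlow a i) measurable_const)
  have hcard : ∀ t, MeasurableSet {ω | (confSet (φ ω) (w ω) α ρ t₀ t).ncard ≤ 1} := by
    intro t
    have hiff : ∀ ω, (confSet (φ ω) (w ω) α ρ t₀ t).ncard ≤ 1 ↔
        ∀ a ∈ confSet (φ ω) (w ω) α ρ t₀ t, ∀ b ∈ confSet (φ ω) (w ω) α ρ t₀ t, a = b :=
      fun ω => Set.ncard_le_one (Set.toFinite _)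
    simp only [hiff]
    refine measurableSet_setOfPred.2 (Measurable.forall fun a => (hmem a t).imp
      (Measurable.forall fun b => (hmem b t).imp measurable_const))
  simp only [stopTime_toENNReal]
  exact Measurable.iInf fun t => Measurable.ite (hcard t) measurable_const measurable_const

end Measurability

/-! ### The statistics of a round as martingale differences -/

section Scores

variable {Ω 𝒳 : Type*} [MeasurableSpace Ω] [MeasurableSpace 𝒳] {K : ℕ}

/-- The score as a function of the history and the current observation. -/
noncomputable def stepScore (pol : ∀ n : ℕ, Kernel ((Fin n → Obs 𝒳 K) × 𝒳) (Fin K))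
    (reg : ∀ n : ℕ, (Fin n → Obs 𝒳 K) → 𝒳 → Fin K → ℝ) (b : Fin K) (n : ℕ)
    (q : (Fin n → Obs 𝒳 K) × Obs 𝒳 K) : ℝ :=
  limScore ((pol n).sectR q.1) (reg n q.1) q.2 b

/-- The statistics whose averages control the algorithm: scores, products of centred scores, and
weighted scores. -/
noncomputable def stepStat (PX : Measure 𝒳) (Q : Kernel (𝒳 × Fin K) ℝ)
    (pol : ∀ n : ℕ, Kernel ((Fin n → Obs 𝒳 K) × 𝒳) (Fin K))
    (reg : ∀ n : ℕ, (Fin n → Obs 𝒳 K) → 𝒳 → Fin K → ℝ)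
    (w : ∀ n : ℕ, (Fin n → Obs 𝒳 K) → Fin K → Fin K → ℝ) :
    Fin K ⊕ (Fin K × Fin K) ⊕ Fin K → ∀ n : ℕ, (Fin n → Obs 𝒳 K) × Obs 𝒳 K → ℝ
  | .inl b, n, q => stepScore pol reg b n q
  | .inr (.inl (b, c)), n, q => (stepScore pol reg b n q - armMean PX Q b) *
      (stepScore pol reg c n q - armMean PX Q c)
  | .inr (.inr a), n, q => ∑ b, w n q.1 a b * stepScore pol reg b n q

variable {P : Measure Ω} [IsProbabilityMeasure P] {PX : Measure 𝒳} [IsProbabilityMeasure PX]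
  {Q : Kernel (𝒳 × Fin K) ℝ} [IsMarkovKernel Q]
  {pol : ∀ n : ℕ, Kernel ((Fin n → Obs 𝒳 K) × 𝒳) (Fin K)} [∀ n, IsMarkovKernel (pol n)]
  {X : ℕ → Ω → 𝒳} {A : ℕ → Ω → Fin K} {Y : ℕ → Ω → ℝ}
  {reg : ∀ n : ℕ, (Fin n → Obs 𝒳 K) → 𝒳 → Fin K → ℝ}
  {w : ∀ n : ℕ, (Fin n → Obs 𝒳 K) → Fin K → Fin K → ℝ}

theorem measurable_stepScore
    (hreg : ∀ n a, Measurable fun p : (Fin n → Obs 𝒳 K) × 𝒳 => reg n p.1 p.2 a)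
    (b : Fin K) (n : ℕ) : Measurable (stepScore pol reg b n) := by
  have hq : Measurable fun q : (Fin n → Obs 𝒳 K) × Obs 𝒳 K => (q.1, q.2.1) := by fun_prop
  have h1 : Measurable fun q : (Fin n → Obs 𝒳 K) × Obs 𝒳 K => reg n q.1 q.2.1 b :=
    (hreg n b).comp hq
  have h2 : Measurable fun q : (Fin n → Obs 𝒳 K) × Obs 𝒳 K => (pol n (q.1, q.2.1)).real {b} :=
    (measurable_real_singleton (pol n) b).comp hq
  have h3 : MeasurableSet {q : (Fin n → Obs 𝒳 K) × Obs 𝒳 K | q.2.2.1 = b} :=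
    measurable_snd.snd.fst (measurableSet_singleton b)
  have h4 : Measurable fun q : (Fin n → Obs 𝒳 K) × Obs 𝒳 K => q.2.2.2 := by fun_prop
  exact h1.add ((Measurable.ite h3 (h4.sub h1) measurable_const).div h2)

theorem measurable_stepStat
    (hreg : ∀ n a, Measurable fun p : (Fin n → Obs 𝒳 K) × 𝒳 => reg n p.1 p.2 a)
    (hw : ∀ n, Measurable (w n)) (j : Fin K ⊕ (Fin K × Fin K) ⊕ Fin K) (n : ℕ) :
    Measurable (stepStat PX Q pol reg w j n) := by
  have hs := fun b => measurable_stepScore (pol := pol) hreg b n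
  rcases j with b | ⟨b, c⟩ | a
  · exact hs b
  · exact ((hs b).sub_const _).mul ((hs c).sub_const _)
  · refine Finset.measurable_sum _ fun b _ => Measurable.mul ?_ (hs b)
    exact (measurable_pi_apply b).comp ((measurable_pi_apply a).comp ((hw n).comp measurable_fst))

theorem IsBanditProcess.measurable_score (hd : IsBanditProcess P PX Q pol X A Y)
    (hreg : ∀ n a, Measurable fun p : (Fin n → Obs 𝒳 K) × 𝒳 => reg n p.1 p.2 a) (n : ℕ)
    (b : Fin K) : Measurable fun ω => score pol reg (traj X A Y ω) n b :=
  (measurable_stepScore (pol := pol) hreg b n).comp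
    ((hd.measurable_hist n).prodMk (hd.measurable_traj n))

theorem IsBanditProcess.ae_isRegular (hd : IsBanditProcess P PX Q pol X A Y) {B κ Bg : ℝ}
    (hB : ∀ᵐ ω ∂P, ∀ n, |Y n ω| < B)
    (hκ : ∀ᵐ ω ∂P, ∀ n x a, 0 < (pol n (hist (traj X A Y ω) n, x)).real {a} ∧
      1 / (pol n (hist (traj X A Y ω) n, x)).real {a} ≤ κ)
    (hreg : ∀ n a, Measurable fun p : (Fin n → Obs 𝒳 K) × 𝒳 => reg n p.1 p.2 a)
    (hBg : ∀ᵐ ω ∂P, ∀ n x a, |reg n (hist (traj X A Y ω) n) x a| ≤ Bg) :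
    ∀ᵐ ω ∂P, ∀ n, IsRegular PX Q κ Bg B ((pol n).sectR (hist (traj X A Y ω) n))
      (reg n (hist (traj X A Y ω) n)) := by
  have hout := hd.ae_outcome hB (hκ.mono fun ω h n x a => (h n x a).1)
  filter_upwards [hκ, hBg] with ω h1 h2 n
  exact ⟨fun a => (hreg n a).comp measurable_prodMk_left, Eventually.of_forall fun x a => h1 n x a,
    Eventually.of_forall fun x a => h2 n x a, hout⟩

variable {κ Bg B : ℝ} {o : ℕ → Obs 𝒳 K}

theorem mdiff_score {n : ℕ}
    (h : IsRegular PX Q κ Bg B ((pol n).sectR (hist o n)) (reg n (hist o n))) (b : Fin K) :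
    mdiff PX Q pol (stepStat PX Q pol reg w (.inl b)) n o =
      score pol reg o n b - armMean PX Q b := by
  unfold mdiff
  rw [stepKernel_apply, ← h.integral_limScore b]
  rfl

theorem mdiff_cov (n : ℕ) (b c : Fin K) :
    mdiff PX Q pol (stepStat PX Q pol reg w (.inr (.inl (b, c)))) n o =
      (score pol reg o n b - armMean PX Q b) * (score pol reg o n c - armMean PX Q c) -
        limCov PX Q ((pol n).sectR (hist o n)) (reg n (hist o n)) b c := by
  unfold mdiff
  rw [stepKernel_apply]
  rfl

/-- The weights depend on the history only, so they factor out of the conditional mean and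
unbiasedness applies to each score. -/
theorem mdiff_weighted {n : ℕ}
    (h : IsRegular PX Q κ Bg B ((pol n).sectR (hist o n)) (reg n (hist o n))) (a : Fin K) :
    mdiff PX Q pol (stepStat PX Q pol reg w (.inr (.inr a))) n o =
      ∑ b, w n (hist o n) a b * score pol reg o n b -
        ∑ b, w n (hist o n) a b * armMean PX Q b := by
  unfold mdiff
  rw [stepKernel_apply]
  have h1 : ∫ z, stepStat PX Q pol reg w (.inr (.inr a)) n (hist o n, z)
      ∂limLaw PX Q ((pol n).sectR (hist o n)) =
      ∑ b, w n (hist o n) a b * armMean PX Q b := by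
    refine (integral_finsetSum _ fun b _ =>
      (h.integrable_limScore b).const_mul (w n (hist o n) a b)).trans ?_
    refine Finset.sum_congr rfl fun b _ => ?_
    rw [integral_const_mul, h.integral_limScore b]
  rw [h1]
  rfl

theorem abs_stepStat_le {R : ℝ} (hR : ∀ n b, |score pol reg o n b| ≤ R)
    (hm : ∀ b, |armMean PX Q b| ≤ R) (hw : ∀ n a, w n (hist o n) a ∈ Delta a)
    (j : Fin K ⊕ (Fin K × Fin K) ⊕ Fin K) (n : ℕ) :
    |stepStat PX Q pol reg w j n (hist o n, o n)| ≤ R + (2 * R) ^ 2 + K * R := by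
  have h0 : Fin K → 0 ≤ R := fun b => (abs_nonneg _).trans (hm b)
  rcases j with b | ⟨b, c⟩ | a
  · have h1 : |stepStat PX Q pol reg w (.inl b) n (hist o n, o n)| ≤ R := hR n b
    have := h0 b
    have : 0 ≤ (2 * R) ^ 2 + K * R := by positivity
    linarith
  · have h1 : |stepStat PX Q pol reg w (.inr (.inl (b, c))) n (hist o n, o n)| ≤ (2 * R) ^ 2 :=
      abs_mul_sub_le (hR n b) (hm b) (hR n c) (hm c)
    have := h0 b
    have : 0 ≤ R + K * R := by positivity
    linarith
  · have h1 : |stepStat PX Q pol reg w (.inr (.inr a)) n (hist o n, o n)| ≤ K * R :=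
      abs_sum_mul_le (abs_le_one_of_mem_Delta (hw n a)) (hR n)
    have := h0 a
    have : 0 ≤ R + (2 * R) ^ 2 := by positivity
    linarith

end Scores

/-! ### The limit on a typical path -/

section PathLimit

variable {𝒳 : Type*} [MeasurableSpace 𝒳] {K : ℕ} {PX : Measure 𝒳} [IsProbabilityMeasure PX]
  {Q : Kernel (𝒳 × Fin K) ℝ} [IsMarkovKernel Q] {κ Bg B v : ℝ}
  {p : Kernel 𝒳 (Fin K)} [IsMarkovKernel p] {g : 𝒳 → Fin K → ℝ}

theorem IsRegular.limSNR_eq (h : IsRegular PX Q κ Bg B p g) :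
    limSNR PX Q p g = snr (limCov PX Q p g) (armMean PX Q) := by
  funext w
  unfold limSNR snr
  rw [h.limVar_eq]
  rfl

theorem IsRegular.le_quad_limCov (h : IsRegular PX Q κ Bg B p g)
    (hv : ∀ b, v ≤ ∫ x, condVar Q x b ∂PX) (u : Fin K → ℝ) (b : Fin K) :
    u b ^ 2 * v ≤ quad (limCov PX Q p g) u :=
  (mul_le_mul_of_nonneg_left (hv b) (sq_nonneg _)).trans
    ((h.le_limVar u b).trans_eq (h.limVar_eq u))

theorem quad_pos_of_le {C : Fin K → Fin K → ℝ} (hv : 0 < v)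
    (hle : ∀ u b, u b ^ 2 * v ≤ quad C u) (u : Fin K → ℝ) (hu : u ≠ 0) : 0 < quad C u := by
  obtain ⟨b, hb⟩ := Function.ne_iff.1 hu
  have hb : u b ≠ 0 := hb
  exact (mul_pos (by positivity) hv).trans_le (hle u b)

/-- The limit of the normalized stopping time along a typical path. -/
theorem tendsto_stopTime_of_path {φ : ℕ → Fin K → ℝ} {w : ℕ → Fin K → Fin K → ℝ}
    {w₀ wInf : Fin K → Fin K → ℝ} {aStar : Fin K} {R ρ : ℝ} (h : IsRegular PX Q κ Bg B p g)
    (hopt : ∀ b, b ≠ aStar → armMean PX Q b < armMean PX Q aStar) (hv0 : 0 < v)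
    (hv : ∀ b, v ≤ ∫ x, condVar Q x b ∂PX) (hw₀ : w₀ aStar ∈ Delta aStar)
    (hwInf : wInf aStar = w₀ aStar)
    (hmax : ∀ a, a ≠ aStar → ∀ x : Fin K → ℝ,
      (x ∈ Delta a ∧ IsMaxOn (limSNR PX Q p g) (Delta a) x) ↔ x = wInf a)
    (hR : 0 ≤ R) (hφ : ∀ i b, |φ i b| ≤ R) (hmR : ∀ b, |armMean PX Q b| ≤ R)
    (hw : IsSNRWeights φ w₀ w) {C : ℕ → Fin K → Fin K → ℝ}
    (hmean : ∀ b, Tendsto (fun n : ℕ => (∑ i ∈ Finset.range n, (φ i b - armMean PX Q b)) / n)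
      atTop (𝓝 0))
    (hcov : ∀ b c, Tendsto (fun n : ℕ => (∑ i ∈ Finset.range n,
      ((φ i b - armMean PX Q b) * (φ i c - armMean PX Q c) - C i b c)) / n) atTop (𝓝 0))
    (hC : ∀ b c, Tendsto (fun n => C n b c) atTop (𝓝 (limCov PX Q p g b c)))
    (hρ : 0 < ρ) {t₀ : ℝ → ℕ} (ht₀ : Tendsto t₀ (𝓝[>] 0) atTop)
    (ht₀' : Tendsto (fun α => (t₀ α : ℝ) / Real.log (1 / α)) (𝓝[>] 0) (𝓝 0)) :
    Tendsto (fun α => (stopTime φ w α ρ (t₀ α) : ℝ≥0∞) / ENNReal.ofReal (Real.log (1 / α)))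
      (𝓝[>] 0) (𝓝 (ENNReal.ofReal (2 * Gamma₁ PX Q p g aStar wInf))) := by
  have hle := h.le_quad_limCov hv
  have hpos := quad_pos_of_le hv0 hle
  have hrun : ∀ b, Tendsto (fun t => runMean φ t b) atTop (𝓝 (armMean PX Q b)) := fun b =>
    tendsto_average_of_average_sub (hmean b) tendsto_const_nhds
  have hemp := tendsto_empCov hφ hR hmR hrun hcov hC
  rw [h.limSNR_eq] at hmax
  have hweights : ∀ a, Tendsto (fun n => w n a) atTop (𝓝 (wInf a)) := by
    intro a
    by_cases ha : a = aStar
    · rw [ha, hwInf]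
      exact tendsto_weights_default hw hrun hopt
    · exact tendsto_weights hw hv0 hrun hemp hle hpos (hopt a ha) fun x hx => (hmax a ha x).1 hx
  have hmemΔ : ∀ a, a ≠ aStar → wInf a ∈ Delta a := fun a ha => ((hmax a ha _).2 rfl).1
  have hsnr : ∀ a, a ≠ aStar → 0 < snr (limCov PX Q p g) (armMean PX Q) (wInf a) := fun a ha =>
    snr_pos_of_isMaxOn hpos (hopt a ha) ((hmax a ha _).2 rfl).2
  have hquad : ∀ a, a ≠ aStar → 0 < quad (limCov PX Q p g) (wInf a) := fun a ha =>
    hpos _ (ne_zero_of_mem_Delta (hmemΔ a ha))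
  have hψ : ∀ a, a ≠ aStar → 0 < ∑ b, wInf a b * armMean PX Q b := fun a ha =>
    (div_pos_iff_of_pos_right (Real.sqrt_pos.2 (hquad a ha))).1 (hsnr a ha)
  have : Nonempty {a : Fin K // a ≠ aStar} := by
    obtain ⟨a, ha⟩ := exists_ne_of_mem_Delta hw₀
    exact ⟨⟨a, ha⟩⟩
  -- The arm of smallest SNR is the bottleneck. Since $\psi^2=\mathrm{snr}^2\,S$, the constant
  -- $c=2/r^2$ satisfies $2S\le c\psi^2$ for every suboptimal arm, with equality at `a₀`.
  obtain ⟨⟨a₀, ha₀⟩, hmin⟩ := exists_eq_ciInf_of_finite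
    (f := fun a : {a : Fin K // a ≠ aStar} => limSNR PX Q p g (wInf a))
  set r := limSNR PX Q p g (wInf a₀) with hr
  have hΓ : Gamma₁ PX Q p g aStar wInf = r ^ (-2 : ℤ) := by
    unfold Gamma₁
    rw [← hmin]
  have hr0 : 0 < r := by rw [hr, h.limSNR_eq]; exact hsnr a₀ ha₀
  have hrle : ∀ a, a ≠ aStar → r ≤ snr (limCov PX Q p g) (armMean PX Q) (wInf a) := by
    intro a ha
    rw [hr, ← h.limSNR_eq]
    refine hmin.trans_le ?_
    exact ciInf_le (Set.finite_range _).bddBelow (⟨a, ha⟩ : {a : Fin K // a ≠ aStar})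
  have hsq : ∀ a, a ≠ aStar → (∑ b, wInf a b * armMean PX Q b) ^ 2 =
      snr (limCov PX Q p g) (armMean PX Q) (wInf a) ^ 2 * quad (limCov PX Q p g) (wInf a) := by
    intro a ha
    have h1 := hquad a ha
    unfold snr
    rw [div_pow, Real.sq_sqrt h1.le, div_mul_cancel₀ _ h1.ne']
  have hΓ2 : 2 * Gamma₁ PX Q p g aStar wInf = 2 / r ^ 2 := by
    rw [hΓ, zpow_neg, div_eq_mul_inv]
    norm_cast
  rw [hΓ2]
  refine tendsto_stopTime hρ ht₀ ht₀' (a' := aStar) (a₀ := a₀)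
    (fun a => tendsto_testProcess hφ hrun (hweights a))
    (fun a => tendsto_testVar hφ hR hemp (hweights a)) ?_ hψ hquad ha₀ ?_ ?_
  · rw [hwInf]
    exact sum_mul_neg_of_mem_Delta hw₀ hopt
  · intro a ha
    rw [hsq a ha, div_mul_eq_mul_div, le_div_iff₀ (by positivity)]
    have h1 := pow_le_pow_left₀ hr0.le (hrle a ha) 2
    have := mul_le_mul_of_nonneg_left h1 (hquad a ha).le
    linarith
  · rw [hsq a₀ ha₀, ← h.limSNR_eq, ← hr]
    field_simp

end PathLimit

end BAI

/-! ### The main theorem: almost sure limit and dominated convergence -/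

theorem theorem2 {Ω 𝒳 : Type*} [MeasurableSpace Ω] [MeasurableSpace 𝒳] {K : ℕ}
    (P : Measure Ω) [IsProbabilityMeasure P]
    -- the instance: law of contexts and conditional law of outcomes
    (PX : Measure 𝒳) [IsProbabilityMeasure PX]
    (Q : Kernel (𝒳 × Fin K) ℝ) [IsMarkovKernel Q]
    -- the sampling scheme and the data
    (pol : ∀ n : ℕ, Kernel ((Fin n → BAI.Obs 𝒳 K) × 𝒳) (Fin K)) [∀ n, IsMarkovKernel (pol n)]
    (X : ℕ → Ω → 𝒳) (A : ℕ → Ω → Fin K) (Y : ℕ → Ω → ℝ)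
    (hdata : BAI.IsBanditProcess P PX Q pol X A Y)
    -- unique optimal arm, nondegenerate variances, bounded outcomes
    (aStar : Fin K) (hopt : ∀ b, b ≠ aStar → BAI.armMean PX Q b < BAI.armMean PX Q aStar)
    (hvar : ∀ x a, 0 < BAI.condVar Q x a)
    (B : ℝ) (hB : ∀ᵐ ω ∂P, ∀ n, |Y n ω| < B)
    -- convergent sampling with strict positivity
    (polInf : Kernel 𝒳 (Fin K)) [IsMarkovKernel polInf]
    (hpol : ∀ᵐ ω ∂P, ∀ a, Tendsto (fun n => eLpNorm (fun x =>
      (pol n (BAI.hist (BAI.traj X A Y ω) n, x)).real {a} - (polInf x).real {a}) 2 PX) atTop (𝓝 0))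
    (κ : ℝ) (hκ : ∀ᵐ ω ∂P, ∀ n x a, 0 < (pol n (BAI.hist (BAI.traj X A Y ω) n, x)).real {a} ∧
      1 / (pol n (BAI.hist (BAI.traj X A Y ω) n, x)).real {a} ≤ κ)
    -- convergent, bounded regression functions
    (reg : ∀ n : ℕ, (Fin n → BAI.Obs 𝒳 K) → 𝒳 → Fin K → ℝ)
    (hreg_meas : ∀ n a, Measurable fun p : (Fin n → BAI.Obs 𝒳 K) × 𝒳 => reg n p.1 p.2 a)
    (gInf : 𝒳 → Fin K → ℝ) (hgInf_meas : ∀ a, Measurable fun x => gInf x a)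
    (hreg : ∀ᵐ ω ∂P, ∀ a, Tendsto (fun n => eLpNorm (fun x =>
      reg n (BAI.hist (BAI.traj X A Y ω) n) x a - gInf x a) 2 PX ^ 2) atTop (𝓝 0))
    (Bg : ℝ) (hBg : ∀ᵐ ω ∂P, ∀ n x a, |reg n (BAI.hist (BAI.traj X A Y ω) n) x a| ≤ Bg)
    -- invertible limiting covariance matrix
    (hcov : IsUnit (BAI.limCov PX Q polInf gInf))
    -- the parameters of the algorithm
    (ρ : ℝ) (hρ : 0 < ρ)
    (w₀ : Fin K → Fin K → ℝ) (hw₀ : ∀ a, w₀ a ∈ BAI.Delta a)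
    (w : ∀ n : ℕ, (Fin n → BAI.Obs 𝒳 K) → Fin K → Fin K → ℝ) (hw_meas : ∀ n, Measurable (w n))
    (hw : ∀ᵐ ω ∂P, BAI.IsSNRWeights (BAI.score pol reg (BAI.traj X A Y ω)) w₀
      (fun n => w n (BAI.hist (BAI.traj X A Y ω) n)))
    -- the burn-in times
    (t₀ : ℝ → ℕ) (ht₀ : Tendsto t₀ (𝓝[>] 0) atTop)
    (ht₀' : Tendsto (fun α => (t₀ α : ℝ) / Real.log (1 / α)) (𝓝[>] 0) (𝓝 0)) :
    -- the stopping time with error tolerance `α` and burn-in time `t₀ α`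
    let τ : ℝ → Ω → ℝ≥0∞ := fun α ω =>
      (BAI.stopTime (BAI.score pol reg (BAI.traj X A Y ω))
        (fun n => w n (BAI.hist (BAI.traj X A Y ω) n)) α ρ (t₀ α) : ℝ≥0∞)
    -- the limiting weights: for suboptimal arms, the unique maximizers of the limiting SNR
    ∃ wInf : Fin K → Fin K → ℝ, wInf aStar = w₀ aStar ∧
      (∀ a, a ≠ aStar → ∀ v : Fin K → ℝ,
        (v ∈ BAI.Delta a ∧ IsMaxOn (BAI.limSNR PX Q polInf gInf) (BAI.Delta a) v) ↔ v = wInf a) ∧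
      -- the limits exist and are at most `2 Γ₁`, in expectation and almost surely
      (∃ l ≤ ENNReal.ofReal (2 * BAI.Gamma₁ PX Q polInf gInf aStar wInf),
        Tendsto (fun α => (∫⁻ ω, τ α ω ∂P) / ENNReal.ofReal (Real.log (1 / α)))
          (𝓝[>] 0) (𝓝 l)) ∧
      (∀ᵐ ω ∂P, ∃ l ≤ ENNReal.ofReal (2 * BAI.Gamma₁ PX Q polInf gInf aStar wInf),
        Tendsto (fun α => τ α ω / ENNReal.ofReal (Real.log (1 / α))) (𝓝[>] 0) (𝓝 l)) := by
  intro τ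
  have hregular := hdata.ae_isRegular hB hκ hreg_meas hBg
  have hreg' : ∀ᵐ ω ∂P, ∀ a, Tendsto (fun n => eLpNorm (fun x =>
      reg n (BAI.hist (BAI.traj X A Y ω) n) x a - gInf x a) 2 PX) atTop (𝓝 0) := by
    filter_upwards [hreg] with ω hω a
    have h1 := (ENNReal.continuous_rpow_const (y := (1 / 2 : ℝ))).tendsto 0 |>.comp (hω a)
    rw [ENNReal.zero_rpow_of_pos (by norm_num)] at h1
    refine h1.congr fun n => ?_
    rw [Function.comp_apply, ← ENNReal.rpow_natCast, ← ENNReal.rpow_mul]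
    norm_num
  -- the limiting instance
  have hlim : BAI.IsRegular PX Q κ Bg B polInf gInf := by
    obtain ⟨ω, h1, h2, h3⟩ := (hregular.and (hpol.and hreg')).exists
    exact BAI.IsRegular.of_tendsto h1 hgInf_meas h2 h3
  obtain ⟨v, hv0, hv⟩ : ∃ v > 0, ∀ b, v ≤ ∫ x, BAI.condVar Q x b ∂PX := by
    have : Nonempty (Fin K) := ⟨aStar⟩
    obtain ⟨b, hb⟩ := Finite.exists_min fun b => ∫ x, BAI.condVar Q x b ∂PX
    exact ⟨_, BAI.integral_condVar_pos hlim.outcome hvar b, hb⟩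
  have hpos := BAI.quad_pos_of_le hv0 (hlim.le_quad_limCov hv)
  choose! u hu using fun a (ha : a ≠ aStar) =>
    BAI.existsUnique_isMaxOn_snr (m := BAI.armMean PX Q) hpos (hopt a ha)
  -- The optimal arm's weights converge to its default, which is therefore its limiting weight.
  set wInf : Fin K → Fin K → ℝ := fun a => if a = aStar then w₀ a else u a with hwInf
  have hmax : ∀ a, a ≠ aStar → ∀ x : Fin K → ℝ,
      (x ∈ BAI.Delta a ∧ IsMaxOn (BAI.limSNR PX Q polInf gInf) (BAI.Delta a) x) ↔ x = wInf a := by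
    intro a ha x
    rw [hlim.limSNR_eq, hu a ha x]
    simp [hwInf, ha]
  have hwInf' : wInf aStar = w₀ aStar := by simp [hwInf]
  -- boundedness
  set R := max (BAI.scoreBound κ Bg B) 1 with hR
  have hR0 : 0 < R := zero_lt_one.trans_le (le_max_right _ _)
  have hmR : ∀ b, |BAI.armMean PX Q b| ≤ R := fun b =>
    (hlim.abs_armMean_le b).trans (le_max_left _ _)
  have hscore : ∀ᵐ ω ∂P, ∀ n b, |BAI.score pol reg (BAI.traj X A Y ω) n b| ≤ R := by
    filter_upwards [hB, hκ, hBg] with ω h1 h2 h3 n b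
    exact (BAI.abs_score_le (h2 n _ b).1 (h2 n _ b).2 (h3 n _ b) (h1 n).le).trans (le_max_left _ _)
  have hstat_meas := fun j n => BAI.measurable_stepStat (PX := PX) (Q := Q) (pol := pol)
    hreg_meas hw_meas j n
  set c := R + (2 * R) ^ 2 + K * R with hc
  have hc0 : 0 < c := by positivity
  have hstat : ∀ j, ∀ᵐ ω ∂P, ∀ n, |BAI.stepStat PX Q pol reg w j n
      (BAI.hist (BAI.traj X A Y ω) n, BAI.traj X A Y ω n)| ≤ c := by
    intro j
    filter_upwards [hscore, hw] with ω h1 h2 n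
    exact BAI.abs_stepStat_le h1 hmR (fun n a => (h2 n a).1) j n
  -- almost sure convergence
  have hpath : ∀ᵐ ω ∂P, Tendsto (fun α => τ α ω / ENNReal.ofReal (Real.log (1 / α))) (𝓝[>] 0)
      (𝓝 (ENNReal.ofReal (2 * BAI.Gamma₁ PX Q polInf gInf aStar wInf))) := by
    have havg := ae_all_iff.2 fun j => hdata.ae_tendsto_average (hstat_meas j) hc0 (hstat j)
    filter_upwards [hregular, hpol, hreg', hscore, hw, havg] with ω h1 h2 h3 h4 h5 h6
    refine BAI.tendsto_stopTime_of_path hlim hopt hv0 hv (hw₀ aStar) hwInf' hmax hR0.le h4 hmR h5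
      (C := fun n => BAI.limCov PX Q ((pol n).sectR (BAI.hist (BAI.traj X A Y ω) n))
        (reg n (BAI.hist (BAI.traj X A Y ω) n))) (fun b => ?_) (fun b c => ?_)
      (fun b c => BAI.tendsto_limCov h1 hgInf_meas h2 h3 b c) hρ ht₀ ht₀'
    · simpa only [BAI.mdiff_score (h1 _)] using h6 (.inl b)
    · simpa only [BAI.mdiff_cov] using h6 (.inr (.inl (b, c)))
  -- Both limits are equal to `2 * Gamma₁`, so each inequality is witnessed by `le_rfl`.
  refine ⟨wInf, hwInf', hmax, ⟨_, le_rfl, ?_⟩, hpath.mono fun ω hω => ⟨_, le_rfl, hω⟩⟩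
  -- convergence in expectation, by domination
  obtain ⟨δ, hδ0, M, hM⟩ := BAI.exists_stopTime_le hopt hR0 hv0 hρ
  obtain ⟨T, hTm, hTi, hT⟩ := hdata.exists_time hstat_meas hc0 hstat hδ0
  -- The time `T ω` need not be an integer while the path bound needs a natural number; rounding up
  -- costs the `+ 1`.
  have hdom : ∀ᵐ ω ∂P, ∀ α : ℝ, 0 < α → 1 ≤ Real.log (1 / α) →
      τ α ω ≤ t₀ α + M * ENNReal.ofReal (Real.log (1 / α)) + M * (T ω + 1) := by
    filter_upwards [hregular, hscore, hw, ae_lt_top hTm hTi] with ω h1 h2 h3 h4 α hα hL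
    have hceil : T ω ≤ (⌈(T ω).toReal⌉₊ : ℝ≥0∞) := by
      rw [← ENNReal.ofReal_toReal h4.ne, ← ENNReal.ofReal_natCast,
        ENNReal.toReal_ofReal ENNReal.toReal_nonneg]
      exact ENNReal.ofReal_le_ofReal (Nat.le_ceil _)
    have hceil' : (⌈(T ω).toReal⌉₊ : ℝ≥0∞) ≤ T ω + 1 := by
      rw [← ENNReal.ofReal_natCast]
      refine (ENNReal.ofReal_le_ofReal
        (Nat.ceil_lt_add_one (ENNReal.toReal_nonneg (a := T ω))).le).trans_eq ?_
      rw [ENNReal.ofReal_add ENNReal.toReal_nonneg zero_le_one, ENNReal.ofReal_toReal h4.ne,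
        ENNReal.ofReal_one]
    have hb : ∀ (n : ℕ) j, ⌈(T ω).toReal⌉₊ ≤ n → |∑ i ∈ Finset.range n,
        BAI.mdiff PX Q pol (BAI.stepStat PX Q pol reg w j) i (BAI.traj X A Y ω)| ≤ n * δ :=
      fun n j hn => hT ω n j (hceil.trans (by exact_mod_cast hn))
    refine (hM _ _ w₀ (fun n => BAI.limCov PX Q ((pol n).sectR (BAI.hist (BAI.traj X A Y ω) n))
      (reg n (BAI.hist (BAI.traj X A Y ω) n))) ⌈(T ω).toReal⌉₊ ⟨h2, hmR, fun i a => (h3 i a).1,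
        fun i x b => (h1 i).le_quad_limCov hv x b, fun n b hn => ?_, fun n b c hn => ?_,
        fun n a hn => ?_⟩ h3 α (t₀ α) hα hL).trans ?_
    · simpa only [BAI.mdiff_score (h1 _)] using hb n (.inl b) hn
    · simpa only [BAI.mdiff_cov] using hb n (.inr (.inl (b, c))) hn
    · simpa only [BAI.mdiff_weighted (h1 _)] using hb n (.inr (.inr a)) hn
    · gcongr
  have hτm : ∀ α, Measurable (τ α) := fun α =>
    BAI.measurable_stopTime (fun n b => hdata.measurable_score hreg_meas n b)
      (fun n a b => (measurable_pi_apply b).comp ((measurable_pi_apply a).comp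
        ((hw_meas n).comp (hdata.measurable_hist n)))) α ρ (t₀ α)
  have hα0 : ∀ᶠ α : ℝ in 𝓝[>] 0, 0 < α := self_mem_nhdsWithin
  have hL1 := BAI.tendsto_log_one_div.eventually_ge_atTop 1
  have hfin : ∫⁻ ω, (1 + M + M * (T ω + 1)) ∂P ≠ ∞ := by
    have h1 : ∫⁻ ω, (T ω + 1) ∂P ≠ ∞ := by
      rw [lintegral_add_right _ measurable_const, lintegral_const, measure_univ, mul_one]
      exact ENNReal.add_ne_top.2 ⟨hTi, ENNReal.one_ne_top⟩
    rw [lintegral_add_left measurable_const, lintegral_const_mul _ (hTm.add_const 1),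
      lintegral_const, measure_univ, mul_one]
    exact ENNReal.add_ne_top.2 ⟨ENNReal.add_ne_top.2 ⟨ENNReal.one_ne_top, ENNReal.natCast_ne_top M⟩,
      ENNReal.mul_ne_top (ENNReal.natCast_ne_top M) h1⟩
  -- After division by `log (1 / α) ≥ 1`, the burn-in contributes at most `1`, the logarithmic term
  -- `M`, and the random time at most `M * (T ω + 1)`. The resulting dominating function is
  -- integrable and does not depend on `α`.
  have hlimE := tendsto_lintegral_filter_of_dominated_convergence (μ := P) (l := 𝓝[>] (0 : ℝ))
    (F := fun α ω => τ α ω / ENNReal.ofReal (Real.log (1 / α)))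
    (fun ω => 1 + M + M * (T ω + 1)) (Eventually.of_forall fun α => (hτm α).div_const _) (by
      filter_upwards [hα0, hL1, ht₀'.eventually (gt_mem_nhds zero_lt_one)] with α h1 h2 h3
      have hLpos : 0 < Real.log (1 / α) := by linarith
      rw [div_lt_one hLpos] at h3
      filter_upwards [hdom] with ω hω
      refine ENNReal.div_le_of_le_mul ((hω α h1 h2).trans ?_)
      rw [add_mul, add_mul, one_mul]
      refine add_le_add (add_le_add ?_ le_rfl) ?_
      · rw [← ENNReal.ofReal_natCast]
        exact ENNReal.ofReal_le_ofReal h3.le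
      · exact le_mul_of_one_le_right' (ENNReal.one_le_ofReal.2 h2))
    hfin hpath
  rw [lintegral_const, measure_univ, mul_one] at hlimE
  refine hlimE.congr fun α => ?_
  simp only [div_eq_mul_inv]
  exact lintegral_mul_const _ (hτm α)
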